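/- Let $\mathfrak g$ be a simple complex Lie algebra of classical type $A_r$ ($r\ge1$), $B_r$ ($r\ge 1$), $C_r$ ($r\ge 1$) or $D_r$ ($r\ge3$), with simple roots $\alpha_0,\dots,\alpha_{r-1}$ labelled as follows: in types $A,B,C$ the Dynkin diagram is the path $0-1-\cdots-(r-1)$, with $\alpha_0$ the short simple root in type $B_r$ and the long simple root in type $C_r$; in type $D_r$ the nodes $0$ and $1$ are both joined to $2$, and $2-3-\cdots-(r-1)$ is a path. Let $(\cdot,\cdot)$ be the symmetric bilinear form with $(\alpha_i,\alpha_j)=d_ia_{ij}$, where $(a_{ij})$ is the Cartan matrix, $d_i=1$ for all $i$ in types $A,D$, $d_0=1$ and $d_i=2$ ($i>0$) in type $B$, and $d_0=2$ and $d_i=1$ ($i>0$) in type $C$. Let $\mathcal F$ be the $\mathbb Q(q)$-vector space with basis the words $[i_1,\dots,i_k]$ in the letters $0,\dots,r-1$, graded by content $|[i_1,\dots,i_k]|=\alpha_{i_1}+\dots+\alpha_{i_k}$, with the quantum shuffle product determined by $x*[\,]=[\,]*x=x$ and $$(x\cdot[i])*(y\cdot[j])=(x*(y\cdot[j]))\cdot[i]+q^{-(|x|+\alpha_i,\alpha_j)}\,((x\cdot[i])*y)\cdot[j],$$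 where $\cdot$ is concatenation, and let $\mathcal W\subseteq(\mathcal F,*)$ be the subalgebra generated by the letters. Order the letters by $0<1<\dots<r-1$ and the words lexicographically from right to left, with the empty word larger than every nonempty word. A word is *good* if it is the smallest word occurring in some nonzero homogeneous element of $\mathcal W$; a nonempty word is *Lyndon* if it is larger than each of its proper nonempty left factors. Then the sets of good Lyndon words are: 1. type $A_r$: $\{[i,\dots,j]\mid 0\le i\le j<r\}$; 2. type $B_r$: $\{[i,\dots,j]\mid 0\le i\le j<r\}\cup\{[j,j-1,\dots,0,0,\dots,k-1,k]\mid 0\le j<k<r\}$; 3. type $C_r$: $\{[i,\dots,j]\mid 0\le i\le j<r\}\cup\{[j,\dots,1,0,1,\dots,k]\mid 1\le j<k<r\}\cup\{[0,\dots,j,1,\dots,j]\mid 1\le j<r\}$; 4. type $D_r$: $\{[0]\}\cup\{[0,2,\dots,i]\mid 2\le i<r\}\cup\{[i,\dots,j]\mid 1\le i\le j<r\}\cup\{[j,\dots,1,0,2,\dots,k]\mid 1\le j<k<r\}$. -/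

import Mathlib

namespace QLyndon

/-! ### Words, ordered lexicographically from right to left

A monomial `[i₁, …, i_k]` in the letters `[i]`, `i : I`, is the list `[i₁, …, i_k] : List I`. -/

section Order

variable {I : Type*} [LinearOrder I]

/-- `wordLt u v` : `u < v` in the right-to-left lexicographic order on words in which the empty
word is larger than every other word. (`List.Lex` makes the empty list the smallest one, so the
reversed words are compared by `List.Lex` for the opposite order on letters, the other way
round.) -/
def wordLt (u v : List I) : Prop :=
  List.Lex (fun a b : I => b < a) v.reverse u.reverse

theorem wordLt_nil_right {u : List I} (hu : u ≠ []) : wordLt u [] := by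
  unfold wordLt
  have : u.reverse ≠ [] := by simpa using hu
  obtain ⟨a, l, h⟩ := List.exists_cons_of_ne_nil this
  rw [h]
  exact List.Lex.nil

theorem not_wordLt_nil_left (v : List I) : ¬ wordLt [] v := by
  unfold wordLt
  intro h
  cases hv : v.reverse <;> rw [hv] at h <;> cases h

theorem wordLt_concat_iff (u v : List I) (a b : I) :
    wordLt (u ++ [a]) (v ++ [b]) ↔ a < b ∨ (a = b ∧ wordLt u v) := by
  unfold wordLt
  simp only [List.reverse_append, List.reverse_cons, List.reverse_nil, List.nil_append,
    List.singleton_append]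
  constructor
  · intro h
    cases h with
    | rel h => exact Or.inl h
    | cons h => exact Or.inr ⟨rfl, h⟩
  · rintro (h | ⟨rfl, h⟩)
    · exact List.Lex.rel h
    · exact List.Lex.cons h

/-- A (nonempty) word is Lyndon (on the right) if it is larger than each of its proper (nonempty)
left factors. -/
def IsLyndon (l : List I) : Prop :=
  l ≠ [] ∧ ∀ p : List I, p ≠ [] → p <+: l → p ≠ l → wordLt p l

end Order

/-! ### The quantum shuffle algebra -/

noncomputable section Shuffle

variable {I : Type*}

/-- The underlying `ℚ(q)`-vector space of the free associative algebra on the letters `[i]`: its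
basis is the set of words. -/
abbrev FreeWords (I : Type*) : Type _ := List I →₀ RatFunc ℚ

/-- The indeterminate `q` of `ℚ(q)`. -/
abbrev qvar : RatFunc ℚ := RatFunc.X

/-- Right multiplication `f ↦ f · [i]` for the concatenation product. -/
def concatLetter (i : I) (f : FreeWords I) : FreeWords I :=
  f.mapDomain (fun w => w ++ [i])

/-- `(|u|, α_j)` for a word `u`, where `form i j = (α_i, α_j)`. -/
def pairWord (form : I → I → ℤ) (u : List I) (j : I) : ℤ :=
  (u.map (fun i => form i j)).sum

/-- The quantum shuffle product of two words given by their letters read from right to left. -/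
def shuffleRev (form : I → I → ℤ) : List I → List I → FreeWords I
  | [], v => Finsupp.single v.reverse 1
  | i :: x, [] => Finsupp.single (i :: x).reverse 1
  | i :: x, j :: y =>
      concatLetter i (shuffleRev form x (j :: y)) +
        qvar ^ (-(pairWord form (i :: x) j)) • concatLetter j (shuffleRev form (i :: x) y)
termination_by u v => u.length + v.length

/-- The quantum shuffle product of two words. It is determined by `x * [] = [] * x = x` and
`(x·[i]) * (y·[j]) = (x * (y·[j]))·[i] + q^{-(|x| + α_i, α_j)} ((x·[i]) * y)·[j]`. -/
def shuffleWord (form : I → I → ℤ) (u v : List I) : FreeWords I :=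
  shuffleRev form u.reverse v.reverse

theorem shuffleWord_nil_left (form : I → I → ℤ) (v : List I) :
    shuffleWord form [] v = Finsupp.single v 1 := by
  simp [shuffleWord, shuffleRev]

theorem shuffleWord_nil_right (form : I → I → ℤ) (u : List I) :
    shuffleWord form u [] = Finsupp.single u 1 := by
  unfold shuffleWord
  cases h : u.reverse with
  | nil =>
    have : u = [] := by simpa using h
    simp [shuffleRev, this]
  | cons a l =>
    have : u = (a :: l).reverse := by rw [← h, List.reverse_reverse]
    simp [shuffleRev, this]

theorem shuffleWord_concat (form : I → I → ℤ) (x y : List I) (i j : I) :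
    shuffleWord form (x ++ [i]) (y ++ [j]) =
      concatLetter i (shuffleWord form x (y ++ [j])) +
        qvar ^ (-(pairWord form x j + form i j)) •
          concatLetter j (shuffleWord form (x ++ [i]) y) := by
  have h : pairWord form (i :: x.reverse) j = pairWord form x j + form i j := by
    simp [pairWord, List.sum_reverse, add_comm]
  simp only [shuffleWord, List.reverse_append, List.reverse_cons, List.reverse_nil,
    List.nil_append, List.singleton_append]
  rw [shuffleRev, h]

/-- The quantum shuffle product, extended bilinearly. -/
def shuffle (form : I → I → ℤ) (f g : FreeWords I) : FreeWords I :=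
  f.sum fun u a => g.sum fun v b => (a * b) • shuffleWord form u v

/-- `𝒲`, the unital subalgebra of the quantum shuffle algebra generated by the letters. -/
def shuffleSubalgebra (form : I → I → ℤ) : Submodule (RatFunc ℚ) (FreeWords I) :=
  sInf {S | Finsupp.single [] 1 ∈ S ∧ (∀ i : I, Finsupp.single [i] 1 ∈ S) ∧
    ∀ f ∈ S, ∀ g ∈ S, shuffle form f g ∈ S}

/-- The content (`𝒬⁺`-degree) of a word: the multiplicity of each letter. -/
def content [DecidableEq I] (w : List I) : I → ℕ := fun i => w.count i

/-- `f` is homogeneous for the `𝒬⁺`-grading. -/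
def IsHomogeneous [DecidableEq I] (f : FreeWords I) : Prop :=
  ∃ ν : I → ℕ, ∀ w ∈ f.support, content w = ν

/-- `w = min(f)`, the smallest word occurring in `f`. -/
def IsMinWord [LinearOrder I] (f : FreeWords I) (w : List I) : Prop :=
  w ∈ f.support ∧ ∀ v ∈ f.support, v ≠ w → wordLt w v

/-- A word is (lower) good if it is `min(f)` for some homogeneous `f ∈ 𝒲`. -/
def IsGood [LinearOrder I] (form : I → I → ℤ) (w : List I) : Prop :=
  ∃ f ∈ shuffleSubalgebra form, IsHomogeneous f ∧ IsMinWord f w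

/-- The set of good Lyndon words. -/
def goodLyndon [LinearOrder I] (form : I → I → ℤ) : Set (List I) :=
  {w | IsGood form w ∧ IsLyndon w}

end Shuffle

/-! ### Classical Cartan data

The simple roots of a simple Lie algebra of classical type and rank `r` are `α_0, …, α_{r-1}`.
The diagram is a path `0 — 1 — … — (r-1)` in types `A`, `B`, `C`, with `α_0` the short simple root
in type `B` and the long simple root in type `C`; in type `D` the nodes `0` and `1` are the two
end nodes of the fork, both joined to `2`, followed by the path `2 — … — (r-1)`. -/

/-- The classical types. -/
inductive ClassicalType
  | A
  | B
  | C
  | D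

/-- The Cartan matrix `a i j = 2 (α_i, α_j) / (α_i, α_i)`. (Mathlib labels the nodes in the opposite
order and normalizes its matrices by `2 (α_i, α_j) / (α_j, α_j)`, hence `Fin.rev` and the
transposition.) -/
def cartan : ClassicalType → (r : ℕ) → Matrix (Fin r) (Fin r) ℤ
  | .A, r => (CartanMatrix.A r).transpose.submatrix Fin.rev Fin.rev
  | .B, r => (CartanMatrix.B r).transpose.submatrix Fin.rev Fin.rev
  | .C, r => (CartanMatrix.C r).transpose.submatrix Fin.rev Fin.rev
  | .D, r => (CartanMatrix.D r).transpose.submatrix Fin.rev Fin.rev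

/-- The numbers `d_i = (α_i, α_i) / 2`: equal to `1` in types `A` and `D`; `d_0 = 1` and `d_i = 2`
for `i > 0` in type `B`; `d_0 = 2` and `d_i = 1` for `i > 0` in type `C`. -/
def rootD : ClassicalType → {r : ℕ} → Fin r → ℤ
  | .A, _, _ => 1
  | .B, _, i => if i.val = 0 then 1 else 2
  | .C, _, i => if i.val = 0 then 2 else 1
  | .D, _, _ => 1

/-- The symmetric bilinear form on simple roots, `(α_i, α_j) = d_i a_{ij}`. -/
def rootForm (T : ClassicalType) (r : ℕ) (i j : Fin r) : ℤ :=
  rootD T i * cartan T r i j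

theorem rootForm_A (r : ℕ) (i j : Fin r) : rootForm .A r i j =
    if i = j then 2 else if i.val + 1 = j.val ∨ j.val + 1 = i.val then -1 else 0 := by
  have := i.isLt
  have := j.isLt
  simp only [rootForm, rootD, cartan, CartanMatrix.A, Matrix.submatrix_apply,
    Matrix.transpose_apply, Matrix.of_apply, Fin.val_rev, Fin.ext_iff]
  split_ifs <;> omega

theorem rootForm_B (r : ℕ) (i j : Fin r) : rootForm .B r i j =
    if i = j then (if i.val = 0 then 2 else 4)
    else if i.val + 1 = j.val ∨ j.val + 1 = i.val then -2 else 0 := by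
  have := i.isLt
  have := j.isLt
  simp only [rootForm, rootD, cartan, CartanMatrix.B, Matrix.submatrix_apply,
    Matrix.transpose_apply, Matrix.of_apply, Fin.val_rev, Fin.ext_iff]
  split_ifs <;> omega

theorem rootForm_C (r : ℕ) (i j : Fin r) : rootForm .C r i j =
    if i = j then (if i.val = 0 then 4 else 2)
    else if i.val + 1 = j.val ∨ j.val + 1 = i.val then
      (if i.val = 0 ∨ j.val = 0 then -2 else -1)
    else 0 := by
  have := i.isLt
  have := j.isLt
  simp only [rootForm, rootD, cartan, CartanMatrix.C, Matrix.submatrix_apply,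
    Matrix.transpose_apply, Matrix.of_apply, Fin.val_rev, Fin.ext_iff]
  split_ifs <;> omega

theorem rootForm_D (r : ℕ) (hr : 3 ≤ r) (i j : Fin r) : rootForm .D r i j =
    if i = j then 2
    else if (1 ≤ i.val ∧ i.val + 1 = j.val) ∨ (1 ≤ j.val ∧ j.val + 1 = i.val) ∨
      (i.val = 0 ∧ j.val = 2) ∨ (j.val = 0 ∧ i.val = 2) then -1
    else 0 := by
  have := i.isLt
  have := j.isLt
  simp only [rootForm, rootD, cartan, CartanMatrix.D, Matrix.submatrix_apply,
    Matrix.transpose_apply, Matrix.of_apply, Fin.val_rev, Fin.ext_iff]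
  split_ifs <;> omega

/-! ### The explicit words -/

/-- The good Lyndon words for the classical type `T` of rank `r` and the order
`0 < 1 < … < r - 1` on the labels, written as lists of natural numbers. -/
def goodLyndonWords (T : ClassicalType) (r : ℕ) : Set (List ℕ) :=
  List.map Fin.val '' goodLyndon (rootForm T r)

/-- The increasing word `[i, i+1, …, j]` (empty if `j < i`). -/
def up (i j : ℕ) : List ℕ := List.range' i (j + 1 - i)

/-- The decreasing word `[j, j-1, …, i]` (empty if `j < i`). -/
def down (j i : ℕ) : List ℕ := (up i j).reverse

end QLyndon

namespace QLyndon

/-! ### The shuffle product through deletion of last letters -/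

noncomputable section ShuffleTheory

variable {I : Type*} [DecidableEq I] (form : I → I → ℤ)

/-! Deleting a last letter `k` (the operator `dR k`) is a skew derivation of the shuffle product. On
`𝒲` these deletions satisfy the quantum Serre relations (`serreRel_delW`), because a Serre
polynomial in them kills `1` and commutes with right multiplication by letters. The coefficient of a
word `w` in `f ∈ 𝒲` is the constant term of the operator monomial of `w` applied to `f`. So if that
monomial is a combination of monomials of smaller words (`Reducible`), then `w` is never a smallest
word of an element of `𝒲` (`not_reducible_of_isMinWord`).

Upper bound. A Lyndon word ends in its largest letter `m`; cut it after each `m` into blocks. The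
iterated `q`-bracket of a block has that block as leading word (`hasLead_bracket`), so a vanishing
bracket makes the block reducible. The Serre relations, transported to brackets, leave for each `m`
one explicit list of blocks, each extending its predecessor by a letter on the left (with one fork
in type `D`). Brackets of consecutive blocks `q`-commute, which makes reducible every word in which
a later block of the list stands directly before an earlier one. But a Lyndon word with at least two
blocks begins with a block that is smaller than its last one, hence later in the list; so there is
just one block (`eq_of_isLyndon`). The only exception is in type `C`: the brackets of `[0,…,m]` and
`[1,…,m]` satisfy only relations of degree three, and the product of these two blocks survives
(`eq_of_isLyndon_of_exception`).

Lower bound. The `q`-commutator of a word with a letter `l` is the sum of all insertions of `l`,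
with coefficients `q^{-s} - q^{s-σ}`, where `s` is the pairing of the preceding letters with `l` and
`σ` is free (`shuffleWord_sub`). For suitable `σ` exactly one word survives, so most of the listed
words lie in `𝒲` themselves. In type `D` one gets a sum of two words that differ by a swap of the
commuting letters `0` and `1`; for the last family of type `C` the element is `0` followed by the
shuffle square of `[1,…,j]`.

Both halves work with letters in `ℕ` and the form `natForm`; `delNat` and `restrictWords` connect
this with rank `r`. -/

theorem qvar_ne_zero : qvar ≠ 0 := RatFunc.X_ne_zero

/-- The quantum shuffle product as a bilinear map. -/
def shuffleHom : FreeWords I →ₗ[RatFunc ℚ] FreeWords I →ₗ[RatFunc ℚ] FreeWords I :=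
  Finsupp.linearCombination (RatFunc ℚ)
    (fun u => Finsupp.linearCombination (RatFunc ℚ) (shuffleWord form u))

theorem shuffle_eq (f g : FreeWords I) : shuffle form f g = shuffleHom form f g := by
  simp only [shuffle, shuffleHom, Finsupp.linearCombination_apply, Finsupp.sum,
    LinearMap.sum_apply, LinearMap.smul_apply, Finset.smul_sum, smul_smul]

@[simp] theorem shuffleHom_single (u v : List I) :
    shuffleHom form (Finsupp.single u 1) (Finsupp.single v 1) = shuffleWord form u v := by
  simp [shuffleHom]

/-- Deletion of a last letter `k`. -/
def dR (k : I) : FreeWords I →ₗ[RatFunc ℚ] FreeWords I :=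
  Finsupp.lcomapDomain (fun w : List I => w ++ [k]) (List.append_left_injective [k])

@[simp] theorem dR_apply (k : I) (f : FreeWords I) (w : List I) : dR k f w = f (w ++ [k]) := rfl

theorem dR_single_nil (k : I) (a : RatFunc ℚ) : dR k (Finsupp.single [] a) = 0 := by
  ext w
  simp

theorem dR_single_concat (k j : I) (u : List I) (a : RatFunc ℚ) :
    dR k (Finsupp.single (u ++ [j]) a) = if j = k then Finsupp.single u a else 0 := by
  ext w
  by_cases h : j = k
  · simp [Finsupp.single_apply, h]
  · simp [Finsupp.single_apply, h]

theorem dR_concatLetter (k j : I) (f : FreeWords I) :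
    dR k (concatLetter j f) = if j = k then f else 0 := by
  induction f using Finsupp.induction_linear with
  | zero => simp [concatLetter]
  | add f g hf hg =>
    rw [concatLetter, Finsupp.mapDomain_add, map_add, ← concatLetter, ← concatLetter, hf, hg]
    split_ifs <;> simp
  | single u a => rw [concatLetter, Finsupp.mapDomain_single, dR_single_concat]

/-- The induction principle of this part: an identity in the shuffle algebra is checked on constant
terms and after each deletion, which shortens the words. -/
theorem ext_dR {f g : FreeWords I} (h0 : f [] = g []) (h : ∀ k, dR k f = dR k g) : f = g := by
  ext w
  rcases List.eq_nil_or_concat' w with rfl | ⟨w, k, rfl⟩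
  · exact h0
  · simpa using DFunLike.congr_fun (h k) w

/-- The operator `f ↦ q^{-(|f|, α_k)} f`. -/
def scaleK (k : I) : FreeWords I →ₗ[RatFunc ℚ] FreeWords I :=
  Finsupp.linearCombination (RatFunc ℚ)
    (fun u => qvar ^ (-pairWord form u k) • Finsupp.single u (1 : RatFunc ℚ))

theorem scaleK_single (k : I) (u : List I) : scaleK form k (Finsupp.single u 1) =
    qvar ^ (-pairWord form u k) • Finsupp.single u 1 := by
  simp [scaleK]

theorem pairWord_concat (u : List I) (i j : I) :
    pairWord form (u ++ [i]) j = pairWord form u j + form i j := by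
  simp [pairWord]

theorem dR_shuffleWord (k : I) (u v : List I) : dR k (shuffleWord form u v) =
    shuffleHom form (dR k (Finsupp.single u 1)) (Finsupp.single v 1) +
      qvar ^ (-pairWord form u k) • shuffleHom form (Finsupp.single u 1)
        (dR k (Finsupp.single v 1)) := by
  rcases List.eq_nil_or_concat' u with rfl | ⟨u, i, rfl⟩
  · rcases List.eq_nil_or_concat' v with rfl | ⟨v, j, rfl⟩
    · simp [shuffleWord_nil_left, dR_single_nil]
    · rw [shuffleWord_nil_left, dR_single_nil, dR_single_concat]
      split_ifs <;> simp [shuffleWord_nil_left, pairWord]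
  · rcases List.eq_nil_or_concat' v with rfl | ⟨v, j, rfl⟩
    · rw [shuffleWord_nil_right, dR_single_nil, dR_single_concat]
      split_ifs <;> simp [shuffleWord_nil_right]
    · rw [shuffleWord_concat, map_add, map_smul, dR_concatLetter, dR_concatLetter,
        dR_single_concat, dR_single_concat]
      congr 1
      · split_ifs <;> simp
      · split_ifs with h
        · subst h
          rw [pairWord_concat, shuffleHom_single]
        · simp

/-- The defining recursion of the product, read as a skew Leibniz rule: the last letter comes either
from `g`, after jumping over all of `f`, or from `f`. -/
theorem dR_shuffleHom (k : I) (f g : FreeWords I) : dR k (shuffleHom form f g) =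
    shuffleHom form (dR k f) g + shuffleHom form (scaleK form k f) (dR k g) := by
  have : (shuffleHom form).compr₂ (dR k) = (shuffleHom form).comp (dR k) +
      ((shuffleHom form).comp (scaleK form k)).compl₂ (dR k) := by
    ext u v : 4
    simp only [LinearMap.coe_comp, Function.comp_apply, Finsupp.lsingle_apply,
      LinearMap.compr₂_apply, LinearMap.add_apply, LinearMap.compl₂_apply, shuffleHom_single,
      scaleK_single, dR_shuffleWord, map_smul, LinearMap.smul_apply]
  exact congrArg (fun φ => φ f g) this

theorem shuffleWord_apply_nil (u v : List I) : shuffleWord form u v [] =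
    (Finsupp.single u (1 : RatFunc ℚ)) [] * (Finsupp.single v (1 : RatFunc ℚ)) [] := by
  have hc : ∀ (j : I) (f : FreeWords I), concatLetter j f [] = 0 := by
    intro j f
    apply Finsupp.mapDomain_of_notMem_range
    simp
  rcases List.eq_nil_or_concat' u with rfl | ⟨u, i, rfl⟩
  · simp [shuffleWord_nil_left]
  · rcases List.eq_nil_or_concat' v with rfl | ⟨v, j, rfl⟩
    · simp [shuffleWord_nil_right]
    · simp [shuffleWord_concat, hc]

theorem shuffleHom_apply_nil (f g : FreeWords I) : shuffleHom form f g [] = f [] * g [] := by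
  have : (shuffleHom form).compr₂ (Finsupp.lapply []) =
      (LinearMap.mul (RatFunc ℚ) (RatFunc ℚ)).compl₁₂ (Finsupp.lapply ([] : List I))
        (Finsupp.lapply []) := by
    ext u v : 4
    simp [shuffleWord_apply_nil]
  exact congrArg (fun φ => φ f g) this

theorem dR_scaleK (k l : I) (f : FreeWords I) :
    dR k (scaleK form l f) = qvar ^ (-form k l) • scaleK form l (dR k f) := by
  have : (dR k).comp (scaleK form l) = qvar ^ (-form k l) • (scaleK form l).comp (dR k) := by
    ext u : 2
    simp only [LinearMap.coe_comp, Function.comp_apply, Finsupp.lsingle_apply, scaleK_single,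
      LinearMap.smul_apply]
    rcases List.eq_nil_or_concat' u with rfl | ⟨u, i, rfl⟩
    · simp [dR_single_nil]
    · rw [map_smul, dR_single_concat]
      split_ifs with h
      · subst h
        rw [scaleK_single, pairWord_concat, smul_smul, ← zpow_add₀ qvar_ne_zero]
        congr 2
        ring
      · simp
  exact congrArg (fun φ => φ f) this

theorem scaleK_apply_nil (l : I) (f : FreeWords I) : scaleK form l f [] = f [] := by
  have : (Finsupp.lapply []).comp (scaleK form l) = Finsupp.lapply ([] : List I) := by
    ext u : 2
    simp only [LinearMap.coe_comp, Function.comp_apply, Finsupp.lsingle_apply, scaleK_single,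
      Finsupp.lapply_apply, Finsupp.smul_apply, Finsupp.single_apply]
    split_ifs with h
    · subst h; simp [pairWord]
    · simp
  exact congrArg (fun φ => φ f) this

theorem dR_single_eq (k : I) (u : List I) : (dR k (Finsupp.single u (1 : RatFunc ℚ)) = 0) ∨
    ∃ u', u = u' ++ [k] ∧ dR k (Finsupp.single u (1 : RatFunc ℚ)) = Finsupp.single u' 1 := by
  rcases List.eq_nil_or_concat' u with rfl | ⟨u, i, rfl⟩
  · exact Or.inl (dR_single_nil k 1)
  · rw [dR_single_concat]
    split_ifs with h
    · subst h; exact Or.inr ⟨u, rfl, rfl⟩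
    · exact Or.inl rfl

/-- The product respects the grading, and the twist depends on the degree only. This is what makes
the skew Leibniz rule compatible with associativity. -/
theorem scaleK_shuffleWord (l : I) (n : ℕ) : ∀ u v : List I, u.length + v.length = n →
    scaleK form l (shuffleWord form u v) =
      qvar ^ (-pairWord form u l - pairWord form v l) • shuffleWord form u v := by
  induction n using Nat.strong_induction_on with
  | _ n ih =>
  intro u v hn
  apply ext_dR
  · rw [scaleK_apply_nil, Finsupp.smul_apply, shuffleWord_apply_nil]
    rcases u with _ | ⟨a, u⟩ <;> rcases v with _ | ⟨b, v⟩ <;> simp [pairWord]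
  · intro k
    rw [dR_scaleK, dR_shuffleWord, map_smul, dR_shuffleWord, map_add, smul_add, smul_add, map_smul]
    congr 1
    · rcases dR_single_eq k u with h | ⟨u', rfl, h⟩
      · simp [h]
      · rw [h, shuffleHom_single, ih _ (by simp at hn; omega) u' v rfl, smul_smul,
          ← zpow_add₀ qvar_ne_zero, pairWord_concat]
        congr 2
        ring
    · rcases dR_single_eq k v with h | ⟨v', rfl, h⟩
      · simp [h]
      · rw [h, shuffleHom_single, ih _ (by simp at hn; omega) u v' rfl, smul_smul, smul_smul,
          smul_smul, ← zpow_add₀ qvar_ne_zero, ← zpow_add₀ qvar_ne_zero,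
          ← zpow_add₀ qvar_ne_zero, pairWord_concat]
        congr 2
        ring

theorem scaleK_shuffleHom (l : I) (f g : FreeWords I) : scaleK form l (shuffleHom form f g) =
    shuffleHom form (scaleK form l f) (scaleK form l g) := by
  have : (shuffleHom form).compr₂ (scaleK form l) =
      (shuffleHom form).compl₁₂ (scaleK form l) (scaleK form l) := by
    ext u v : 4
    simp only [LinearMap.coe_comp, Function.comp_apply, Finsupp.lsingle_apply,
      LinearMap.compr₂_apply, LinearMap.compl₁₂_apply, shuffleHom_single,
      scaleK_single, map_smul, LinearMap.smul_apply]
    rw [scaleK_shuffleWord form l _ u v rfl, smul_smul, ← zpow_add₀ qvar_ne_zero]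
    congr 2
    ring
  exact congrArg (fun φ => φ f g) this

/-- Apply a deletion to both sides: each yields three terms, according to the factor that loses its
last letter, and they agree by induction on the total length. -/
theorem shuffleHom_assoc_single (n : ℕ) : ∀ u v w : List I,
    u.length + v.length + w.length = n →
    shuffleHom form (shuffleHom form (Finsupp.single u 1) (Finsupp.single v 1))
      (Finsupp.single w 1) =
    shuffleHom form (Finsupp.single u 1)
      (shuffleHom form (Finsupp.single v 1) (Finsupp.single w 1)) := by
  induction n using Nat.strong_induction_on with
  | _ n ih =>
  intro u v w hn
  apply ext_dR
  · simp only [shuffleHom_apply_nil, mul_assoc]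
  · intro k
    simp only [dR_shuffleHom, map_add, LinearMap.add_apply, scaleK_shuffleHom]
    rw [add_assoc]
    congr 1
    · rcases dR_single_eq k u with h | ⟨u', rfl, h⟩
      · simp [h]
      · rw [h, ih _ (by simp at hn; omega) u' v w rfl]
    congr 1
    · rcases dR_single_eq k v with h | ⟨v', rfl, h⟩
      · simp [h]
      · simp only [h, scaleK_single, map_smul, LinearMap.smul_apply]
        rw [ih _ (by simp at hn; omega) u v' w rfl]
    · rcases dR_single_eq k w with h | ⟨w', rfl, h⟩
      · simp [h]
      · simp only [h, scaleK_single, map_smul, LinearMap.smul_apply]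
        rw [ih _ (by simp at hn; omega) u v w' rfl]

theorem shuffleHom_assoc (f g h : FreeWords I) :
    shuffleHom form (shuffleHom form f g) h = shuffleHom form f (shuffleHom form g h) := by
  induction f using Finsupp.induction_linear with
  | zero => simp
  | add f₁ f₂ h₁ h₂ => simp only [map_add, LinearMap.add_apply, h₁, h₂]
  | single u a =>
  induction g using Finsupp.induction_linear with
  | zero => simp
  | add f₁ f₂ h₁ h₂ => simp only [map_add, LinearMap.add_apply, h₁, h₂]
  | single v b =>
  induction h using Finsupp.induction_linear with
  | zero => simp
  | add f₁ f₂ h₁ h₂ => simp only [map_add, h₁, h₂]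
  | single w c =>
  rw [← mul_one a, ← mul_one b, ← mul_one c, ← smul_eq_mul, ← smul_eq_mul, ← smul_eq_mul,
    ← Finsupp.smul_single, ← Finsupp.smul_single, ← Finsupp.smul_single]
  simp only [map_smul, LinearMap.smul_apply]
  rw [shuffleHom_assoc_single form _ u v w rfl]

theorem one_shuffleHom (f : FreeWords I) : shuffleHom form (Finsupp.single [] 1) f = f := by
  have : shuffleHom form (Finsupp.single [] 1) = LinearMap.id := by
    ext u : 2
    simp [shuffleWord_nil_left]
  rw [this, LinearMap.id_apply]

theorem shuffleHom_one (f : FreeWords I) : shuffleHom form f (Finsupp.single [] 1) = f := by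
  have : (shuffleHom form).flip (Finsupp.single [] 1) = LinearMap.id := by
    ext u : 2
    simp [shuffleWord_nil_right]
  exact congrArg (fun φ => φ f) this

end ShuffleTheory

end QLyndon

namespace QLyndon

/-! ### Quantum Serre relations for the deletions on `𝒲` -/

noncomputable section SerreRelations

/-- The quantum Serre relations with at most three equal letters, for elements `e i` of an
algebra indexed by the simple roots. -/
structure SerreRel {A I : Type*} [Ring A] [Algebra (RatFunc ℚ) A] (form : I → I → ℤ)
    (e : I → A) : Prop where
  comm : ∀ i j, i ≠ j → form i j = 0 → e i * e j = e j * e i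
  quad : ∀ i j (d : ℤ), i ≠ j → form i i = 2 * d → form i j = -d →
    e i * (e i * e j) - (qvar ^ d + qvar ^ (-d)) • (e i * (e j * e i)) + e j * (e i * e i) = 0
  cubic : ∀ i j (d : ℤ), i ≠ j → form i i = 2 * d → form i j = -(2 * d) →
    e i * (e i * (e i * e j)) -
      (qvar ^ (2 * d) + 1 + qvar ^ (-(2 * d))) • (e i * (e i * (e j * e i))) +
      (qvar ^ (2 * d) + 1 + qvar ^ (-(2 * d))) • (e i * (e j * (e i * e i))) -
      e j * (e i * (e i * e i)) = 0

section Skew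

variable {K F : Type*} [Field K] [AddCommGroup F] [Module K F] (D E R T : F →ₗ[K] F)

/-- Here `D` and `E` are the deletions of `i` and `j`, `R` is right multiplication by a letter and
`T` is the twist that arises when this letter is the deleted one. Expanding the Serre polynomial
past `R`, the terms containing `T` cancel by a quantum binomial identity. The variants `left` and
`right` concern the letters `i` and `j`; `s` stands for `q^d` in the quadratic case and for `q^{2d}`
in the cubic case. -/
theorem quad_commute_left (s : K) (hs : s ≠ 0)
    (hD : ∀ f, D (R f) = R (D f) + T f) (hE : ∀ f, E (R f) = R (E f))
    (hDT : ∀ f, D (T f) = (s ^ 2)⁻¹ • T (D f)) (hET : ∀ f, E (T f) = s • T (E f)) (f : F) :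
    D (D (E (R f))) - (s + s⁻¹) • D (E (D (R f))) + E (D (D (R f))) =
      R (D (D (E f)) - (s + s⁻¹) • D (E (D f)) + E (D (D f))) := by
  simp only [hD, hE, hDT, hET, map_add, map_sub, map_smul]
  match_scalars <;> (field_simp; try ring)

theorem quad_commute_right (s : K) (hs : s ≠ 0)
    (hD : ∀ f, D (R f) = R (D f)) (hE : ∀ f, E (R f) = R (E f) + T f)
    (hDT : ∀ f, D (T f) = s • T (D f)) (f : F) :
    D (D (E (R f))) - (s + s⁻¹) • D (E (D (R f))) + E (D (D (R f))) =
      R (D (D (E f)) - (s + s⁻¹) • D (E (D f)) + E (D (D f))) := by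
  simp only [hD, hE, hDT, map_add, map_sub, map_smul]
  match_scalars <;> (field_simp; try ring)

theorem cubic_commute_left (s : K) (hs : s ≠ 0)
    (hD : ∀ f, D (R f) = R (D f) + T f) (hE : ∀ f, E (R f) = R (E f))
    (hDT : ∀ f, D (T f) = s⁻¹ • T (D f)) (hET : ∀ f, E (T f) = s • T (E f)) (f : F) :
    D (D (D (E (R f)))) - (s + 1 + s⁻¹) • D (D (E (D (R f)))) +
        (s + 1 + s⁻¹) • D (E (D (D (R f)))) - E (D (D (D (R f)))) =
      R (D (D (D (E f))) - (s + 1 + s⁻¹) • D (D (E (D f))) +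
        (s + 1 + s⁻¹) • D (E (D (D f))) - E (D (D (D f)))) := by
  simp only [hD, hE, hDT, hET, map_add, map_sub, map_smul]
  match_scalars <;> (field_simp; try ring)

theorem cubic_commute_right (s : K) (hs : s ≠ 0)
    (hD : ∀ f, D (R f) = R (D f)) (hE : ∀ f, E (R f) = R (E f) + T f)
    (hDT : ∀ f, D (T f) = s • T (D f)) (f : F) :
    D (D (D (E (R f)))) - (s + 1 + s⁻¹) • D (D (E (D (R f)))) +
        (s + 1 + s⁻¹) • D (E (D (D (R f)))) - E (D (D (D (R f)))) =
      R (D (D (D (E f))) - (s + 1 + s⁻¹) • D (D (E (D f))) +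
        (s + 1 + s⁻¹) • D (E (D (D f))) - E (D (D (D f)))) := by
  simp only [hD, hE, hDT, map_add, map_sub, map_smul]
  match_scalars <;> (field_simp; try ring)

end Skew

variable {I : Type*} [DecidableEq I] (form : I → I → ℤ)

theorem one_mem : Finsupp.single [] 1 ∈ shuffleSubalgebra form :=
  Submodule.mem_sInf.2 fun _ hS => hS.1

theorem letter_mem (i : I) : Finsupp.single [i] 1 ∈ shuffleSubalgebra form :=
  Submodule.mem_sInf.2 fun _ hS => hS.2.1 i

theorem shuffleHom_mem {f g : FreeWords I} (hf : f ∈ shuffleSubalgebra form)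
    (hg : g ∈ shuffleSubalgebra form) : shuffleHom form f g ∈ shuffleSubalgebra form := by
  refine Submodule.mem_sInf.2 fun S hS => ?_
  rw [← shuffle_eq]
  exact hS.2.2 f (Submodule.mem_sInf.1 hf S hS) g (Submodule.mem_sInf.1 hg S hS)

/-- By associativity `𝒲` is spanned by products of letters, so closure under right multiplication by
single letters suffices for inductions. -/
theorem shuffleSubalgebra_le {S : Submodule (RatFunc ℚ) (FreeWords I)}
    (h1 : Finsupp.single [] 1 ∈ S)
    (hS : ∀ f ∈ S, ∀ l, shuffleHom form f (Finsupp.single [l] 1) ∈ S) :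
    shuffleSubalgebra form ≤ S := by
  let M : Submodule (RatFunc ℚ) (FreeWords I) := sInf {S | Finsupp.single [] 1 ∈ S ∧
    ∀ f ∈ S, ∀ l, shuffleHom form f (Finsupp.single [l] 1) ∈ S}
  have hM1 : Finsupp.single [] 1 ∈ M := Submodule.mem_sInf.2 fun _ h => h.1
  have hMR : ∀ f ∈ M, ∀ l, shuffleHom form f (Finsupp.single [l] 1) ∈ M := fun f hf l =>
    Submodule.mem_sInf.2 fun S' hS' => hS'.2 f (Submodule.mem_sInf.1 hf S' hS') l
  have hMS : M ≤ S := sInf_le ⟨h1, hS⟩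
  refine le_trans (sInf_le ⟨hM1, fun i => ?_, fun f hf g hg => ?_⟩) hMS
  · have := hMR _ hM1 i
    rwa [one_shuffleHom] at this
  · rw [shuffle_eq]
    -- The elements `g` with `f * g ∈ M` form a space of the same kind as those defining `M`, which
    -- therefore contains `M`.
    have : M ≤ M.comap (shuffleHom form f) := by
      refine sInf_le ⟨?_, fun g hg l => ?_⟩
      · rw [Submodule.mem_comap, shuffleHom_one]
        exact hf
      · rw [Submodule.mem_comap, ← shuffleHom_assoc]
        exact hMR _ hg l
    exact this hg

theorem dR_mul_letter (k l : I) (f : FreeWords I) :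
    dR k (shuffleHom form f (Finsupp.single [l] 1)) =
      shuffleHom form (dR k f) (Finsupp.single [l] 1) + if l = k then scaleK form k f else 0 := by
  have := dR_single_concat k l [] (1 : RatFunc ℚ)
  rw [List.nil_append] at this
  rw [dR_shuffleHom, this]
  split_ifs
  · rw [shuffleHom_one]
  · simp

theorem scaleK_letter (k l : I) : scaleK form k (Finsupp.single [l] 1) =
    qvar ^ (-form l k) • Finsupp.single [l] 1 := by
  rw [scaleK_single]
  simp [pairWord]

/-- Both stabilities are proved at once, since deleting a letter from `f * [l]` produces the twist
of `f`. -/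
theorem dR_mem_and_scaleK_mem {f : FreeWords I} (hf : f ∈ shuffleSubalgebra form) :
    (∀ k, dR k f ∈ shuffleSubalgebra form) ∧ ∀ k, scaleK form k f ∈ shuffleSubalgebra form := by
  have : shuffleSubalgebra form ≤ shuffleSubalgebra form ⊓
      ((⨅ k, (shuffleSubalgebra form).comap (dR k)) ⊓
        ⨅ k, (shuffleSubalgebra form).comap (scaleK form k)) := by
    apply shuffleSubalgebra_le
    · simp only [Submodule.mem_inf, Submodule.mem_iInf, Submodule.mem_comap]
      refine ⟨one_mem form, fun k => ?_, fun k => ?_⟩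
      · rw [dR_single_nil]
        exact Submodule.zero_mem _
      · rw [scaleK_single]
        exact Submodule.smul_mem _ _ (one_mem form)
    · simp only [Submodule.mem_inf, Submodule.mem_iInf, Submodule.mem_comap]
      rintro f ⟨h1, h2, h3⟩ l
      refine ⟨shuffleHom_mem form h1 (letter_mem form l), fun k => ?_, fun k => ?_⟩
      · rw [dR_mul_letter]
        refine Submodule.add_mem _ (shuffleHom_mem form (h2 k) (letter_mem form l)) ?_
        split_ifs
        · exact h3 k
        · exact Submodule.zero_mem _
      · rw [scaleK_shuffleHom, scaleK_letter, map_smul]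
        exact Submodule.smul_mem _ _ (shuffleHom_mem form (h3 k) (letter_mem form l))
  have h := this hf
  simp only [Submodule.mem_inf, Submodule.mem_iInf, Submodule.mem_comap] at h
  exact h.2

/-- An operator commuting with right multiplication by letters and killing `1` vanishes on `𝒲`. -/
theorem vanish_of_commute (P : FreeWords I →ₗ[RatFunc ℚ] FreeWords I)
    (h1 : P (Finsupp.single [] 1) = 0)
    (hP : ∀ f l, P ((shuffleHom form).flip (Finsupp.single [l] 1) f) =
      (shuffleHom form).flip (Finsupp.single [l] 1) (P f))
    {f : FreeWords I} (hf : f ∈ shuffleSubalgebra form) : P f = 0 := by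
  have : shuffleSubalgebra form ≤ LinearMap.ker P := by
    apply shuffleSubalgebra_le
    · exact h1
    · intro f hf l
      rw [LinearMap.mem_ker] at hf ⊢
      rw [← LinearMap.flip_apply, hP, hf, map_zero]
  exact this hf

/-- The vector space underlying `𝒲`. -/
def WSpace : Type _ := shuffleSubalgebra form

instance : AddCommGroup (WSpace form) := (shuffleSubalgebra form).addCommGroup

instance : Module (RatFunc ℚ) (WSpace form) := (shuffleSubalgebra form).module

/-- The inclusion of `𝒲` into the shuffle algebra. -/
def WSpace.incl : WSpace form →ₗ[RatFunc ℚ] FreeWords I where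
  toFun f := f.1
  map_add' _ _ := rfl
  map_smul' _ _ := rfl

/-- Deletion of a last letter, as an operator on `𝒲`. -/
def delW (k : I) : Module.End (RatFunc ℚ) (WSpace form) where
  toFun f := ⟨dR k f.1, (dR_mem_and_scaleK_mem form f.2).1 k⟩
  map_add' f g := Subtype.ext (map_add (dR k) f.1 g.1)
  map_smul' c f := Subtype.ext (map_smul (dR k) c f.1)

theorem WSpace.incl_injective : Function.Injective (WSpace.incl form) := Subtype.val_injective

theorem incl_delW (k : I) (f : WSpace form) :
    WSpace.incl form (delW form k f) = dR k (WSpace.incl form f) := rfl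

section OnW

variable {form}

theorem dR_mul_letter_ne {k l : I} (h : l ≠ k) (f : FreeWords I) :
    dR k ((shuffleHom form).flip (Finsupp.single [l] 1) f) =
      (shuffleHom form).flip (Finsupp.single [l] 1) (dR k f) := by
  rw [LinearMap.flip_apply, dR_mul_letter, if_neg h, add_zero, LinearMap.flip_apply]

theorem dR_mul_letter_self (k : I) (f : FreeWords I) :
    dR k ((shuffleHom form).flip (Finsupp.single [k] 1) f) =
      (shuffleHom form).flip (Finsupp.single [k] 1) (dR k f) + scaleK form k f := by
  rw [LinearMap.flip_apply, dR_mul_letter, if_pos rfl, LinearMap.flip_apply]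

theorem comm_on_shuffleSubalgebra (hsymm : ∀ i j, form i j = form j i) {i j : I} (hij : i ≠ j)
    (h : form i j = 0) {f : FreeWords I} (hf : f ∈ shuffleSubalgebra form) :
    dR i (dR j f) = dR j (dR i f) := by
  refine sub_eq_zero.1 (vanish_of_commute form (dR i ∘ₗ dR j - dR j ∘ₗ dR i) ?_ ?_ hf)
  · simp [dR_single_nil]
  · intro f l
    simp only [LinearMap.sub_apply, LinearMap.comp_apply]
    have h' : form j i = 0 := by rw [hsymm, h]
    by_cases hi : l = i
    · subst hi
      rw [dR_mul_letter_ne hij, dR_mul_letter_self, dR_mul_letter_self, map_add,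
        dR_mul_letter_ne hij, dR_scaleK, h', map_sub]
      simp
    · by_cases hj : l = j
      · subst hj
        rw [dR_mul_letter_ne hi, dR_mul_letter_self, dR_mul_letter_self, map_add,
          dR_mul_letter_ne hi, dR_scaleK, h, map_sub]
        simp
      · rw [dR_mul_letter_ne hj, dR_mul_letter_ne hi, dR_mul_letter_ne hi, dR_mul_letter_ne hj,
          map_sub]

theorem quad_on_shuffleSubalgebra (hsymm : ∀ i j, form i j = form j i) {i j : I} (hij : i ≠ j)
    {s : RatFunc ℚ} (hs : s ≠ 0) (hii : qvar ^ (-form i i) = (s ^ 2)⁻¹)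
    (hfij : qvar ^ (-form i j) = s) {f : FreeWords I} (hf : f ∈ shuffleSubalgebra form) :
    dR i (dR i (dR j f)) - (s + s⁻¹) • dR i (dR j (dR i f)) + dR j (dR i (dR i f)) = 0 := by
  refine vanish_of_commute form (dR i ∘ₗ dR i ∘ₗ dR j - (s + s⁻¹) • dR i ∘ₗ dR j ∘ₗ dR i +
    dR j ∘ₗ dR i ∘ₗ dR i) ?_ ?_ hf
  · simp [dR_single_nil]
  · intro f l
    simp only [LinearMap.sub_apply, LinearMap.add_apply,
      LinearMap.smul_apply, LinearMap.comp_apply]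
    by_cases hi : l = i
    · subst hi
      exact quad_commute_left _ _ _ _ _ hs (dR_mul_letter_self l) (dR_mul_letter_ne hij)
        (fun f => by rw [dR_scaleK, hii]) (fun f => by rw [dR_scaleK, hsymm, hfij]) f
    · by_cases hj : l = j
      · subst hj
        exact quad_commute_right _ _ _ _ _ hs (dR_mul_letter_ne hi) (dR_mul_letter_self l)
          (fun f => by rw [dR_scaleK, hfij]) f
      · simp only [dR_mul_letter_ne hi, dR_mul_letter_ne hj, map_sub, map_add, map_smul]

theorem cubic_on_shuffleSubalgebra (hsymm : ∀ i j, form i j = form j i) {i j : I} (hij : i ≠ j)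
    {s : RatFunc ℚ} (hs : s ≠ 0) (hii : qvar ^ (-form i i) = s⁻¹)
    (hfij : qvar ^ (-form i j) = s) {f : FreeWords I} (hf : f ∈ shuffleSubalgebra form) :
    dR i (dR i (dR i (dR j f))) - (s + 1 + s⁻¹) • dR i (dR i (dR j (dR i f))) +
      (s + 1 + s⁻¹) • dR i (dR j (dR i (dR i f))) - dR j (dR i (dR i (dR i f))) = 0 := by
  refine vanish_of_commute form (dR i ∘ₗ dR i ∘ₗ dR i ∘ₗ dR j -
    (s + 1 + s⁻¹) • dR i ∘ₗ dR i ∘ₗ dR j ∘ₗ dR i +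
    (s + 1 + s⁻¹) • dR i ∘ₗ dR j ∘ₗ dR i ∘ₗ dR i - dR j ∘ₗ dR i ∘ₗ dR i ∘ₗ dR i) ?_ ?_ hf
  · simp [dR_single_nil]
  · intro f l
    simp only [LinearMap.sub_apply, LinearMap.add_apply,
      LinearMap.smul_apply, LinearMap.comp_apply]
    by_cases hi : l = i
    · subst hi
      exact cubic_commute_left _ _ _ _ _ hs (dR_mul_letter_self l) (dR_mul_letter_ne hij)
        (fun f => by rw [dR_scaleK, hii]) (fun f => by rw [dR_scaleK, hsymm, hfij]) f
    · by_cases hj : l = j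
      · subst hj
        exact cubic_commute_right _ _ _ _ _ hs (dR_mul_letter_ne hi) (dR_mul_letter_self l)
          (fun f => by rw [dR_scaleK, hfij]) f
      · simp only [dR_mul_letter_ne hi, dR_mul_letter_ne hj, map_sub, map_add, map_smul]

end OnW

/-- The restriction to `𝒲` is essential: on the space of all words the deletions satisfy no relation
at all. -/
theorem serreRel_delW (hsymm : ∀ i j, form i j = form j i) : SerreRel form (delW form) := by
  have q0 : qvar ≠ 0 := qvar_ne_zero
  constructor
  · intro i j hij h
    refine LinearMap.ext fun f => WSpace.incl_injective form ?_
    exact comm_on_shuffleSubalgebra hsymm hij h f.2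
  · intro i j d hij hii hij'
    refine LinearMap.ext fun f => WSpace.incl_injective form ?_
    have hinv : qvar ^ (-d) = (qvar ^ d)⁻¹ := zpow_neg _ _
    have h := quad_on_shuffleSubalgebra hsymm hij (zpow_ne_zero d q0)
      (by rw [hii, zpow_neg, mul_comm, zpow_mul]; norm_cast) (by rw [hij', neg_neg]) f.2
    simp only [LinearMap.add_apply, LinearMap.sub_apply, LinearMap.smul_apply,
      Module.End.mul_apply, map_add, map_sub, map_smul, incl_delW, LinearMap.zero_apply, map_zero]
    rw [hinv]
    exact h
  · intro i j d hij hii hij'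
    refine LinearMap.ext fun f => WSpace.incl_injective form ?_
    have hinv : qvar ^ (-(2 * d)) = (qvar ^ (2 * d))⁻¹ := zpow_neg _ _
    have h := cubic_on_shuffleSubalgebra hsymm hij (zpow_ne_zero (2 * d) q0)
      (by rw [hii, hinv]) (by rw [hij', neg_neg]) f.2
    simp only [LinearMap.add_apply, LinearMap.sub_apply, LinearMap.smul_apply,
      Module.End.mul_apply, map_add, map_sub, map_smul, incl_delW, LinearMap.zero_apply, map_zero]
    rw [hinv]
    exact h

end SerreRelations

end QLyndon

namespace QLyndon

/-! ### The right-to-left order and concatenation -/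

section Order

variable {I : Type*} [LinearOrder I]

theorem wordLt_append_right {v w : List I} (h : wordLt v w) (u : List I) :
    wordLt (v ++ u) (w ++ u) := by
  induction u using List.reverseRecOn with
  | nil => simpa using h
  | append_singleton u a ih =>
    rw [← List.append_assoc, ← List.append_assoc, wordLt_concat_iff]
    exact Or.inr ⟨rfl, ih⟩

/-- Equal lengths matter: if one word is a proper right factor of the other, the comparison is
decided by the end of a word, and letters added on the left can reverse it. -/
theorem wordLt_append_left (n : ℕ) : ∀ {v w : List I}, v.length = n → w.length = n →
    wordLt v w → ∀ u, wordLt (u ++ v) (u ++ w) := by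
  induction n with
  | zero =>
    intro v w hv hw h
    rw [List.length_eq_zero_iff] at hv hw
    subst hv hw
    exact absurd h (not_wordLt_nil_left _)
  | succ n ih =>
    intro v w hv hw h u
    rcases List.eq_nil_or_concat' v with rfl | ⟨v, a, rfl⟩
    · simp at hv
    rcases List.eq_nil_or_concat' w with rfl | ⟨w, b, rfl⟩
    · simp at hw
    rw [wordLt_concat_iff] at h
    rw [← List.append_assoc, ← List.append_assoc, wordLt_concat_iff]
    rcases h with h | ⟨h, h'⟩
    · exact Or.inl h
    · exact Or.inr ⟨h, ih (by simpa using hv) (by simpa using hw) h' u⟩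

theorem wordLt_trans (n : ℕ) : ∀ {u v w : List I}, u.length ≤ n → wordLt u v → wordLt v w →
    wordLt u w := by
  induction n with
  | zero =>
    intro u v w hu h
    rw [List.length_eq_zero_iff.1 (Nat.le_zero.1 hu)] at h
    exact absurd h (not_wordLt_nil_left _)
  | succ n ih =>
    intro u v w hu h h'
    rcases List.eq_nil_or_concat' u with rfl | ⟨u, a, rfl⟩
    · exact absurd h (not_wordLt_nil_left _)
    rcases List.eq_nil_or_concat' v with rfl | ⟨v, b, rfl⟩
    · exact absurd h' (not_wordLt_nil_left _)
    rcases List.eq_nil_or_concat' w with rfl | ⟨w, c, rfl⟩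
    · exact wordLt_nil_right (by simp)
    rw [wordLt_concat_iff] at *
    rcases h with h | ⟨rfl, h⟩ <;> rcases h' with h' | ⟨rfl, h'⟩
    · exact Or.inl (h.trans h')
    · exact Or.inl h
    · exact Or.inl h'
    · exact Or.inr ⟨rfl, ih (by simpa using hu) h h'⟩

theorem wordLt.trans {u v w : List I} (h : wordLt u v) (h' : wordLt v w) : wordLt u w :=
  wordLt_trans _ le_rfl h h'

theorem wordLt_irrefl (u : List I) : ¬ wordLt u u := by
  induction u using List.reverseRecOn with
  | nil => exact not_wordLt_nil_left _
  | append_singleton u a ih =>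
    rw [wordLt_concat_iff]
    rintro (h | ⟨-, h⟩)
    · exact lt_irrefl a h
    · exact ih h

theorem wordLt.asymm {u v : List I} (h : wordLt u v) (h' : wordLt v u) : False :=
  wordLt_irrefl u (h.trans h')

/-- A word is smaller than its proper right factors. -/
theorem wordLt_of_suffix {u : List I} (hu : u ≠ []) (v : List I) : wordLt (u ++ v) v := by
  simpa using wordLt_append_right (wordLt_nil_right hu) v

end Order

/-! ### Leading words, reducible words and iterated `q`-brackets -/

noncomputable section Normal

section Scalars

theorem qvar_zpow_ne_one {n : ℤ} (hn : n ≠ 0) : qvar ^ n ≠ 1 := by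
  have key : ∀ m : ℕ, m ≠ 0 → qvar ^ m ≠ 1 := by
    intro m hm h
    have h1 : algebraMap (Polynomial ℚ) (RatFunc ℚ) (Polynomial.X ^ m) =
        algebraMap (Polynomial ℚ) (RatFunc ℚ) 1 := by
      rw [map_pow, RatFunc.algebraMap_X, map_one]
      exact h
    have h2 := congrArg Polynomial.natDegree (RatFunc.algebraMap_injective ℚ h1)
    simp at h2
    exact hm h2
  rcases Int.natAbs_eq n with h | h
  · rw [h, zpow_natCast]
    exact key _ (by omega)
  · rw [h, zpow_neg, zpow_natCast, ne_eq, inv_eq_one]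
    exact key _ (by omega)

theorem qvar_zpow_ne {m n : ℤ} (h : m ≠ n) : qvar ^ m ≠ qvar ^ n := by
  intro h'
  apply qvar_zpow_ne_one (sub_ne_zero.2 h)
  rw [zpow_sub₀ qvar_ne_zero, h', div_self (zpow_ne_zero _ qvar_ne_zero)]

theorem qvar_two_ne_zero {d : ℤ} (hd : d ≠ 0) : qvar ^ d + qvar ^ (-d) ≠ 0 := by
  intro h
  -- Multiplying `q^{2d} + 1 = 0` by `q^{2d} - 1` gives `q^{4d} = 1`.
  apply qvar_zpow_ne_one (n := 4 * d) (by omega)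
  have h0 : qvar ^ d ≠ 0 := zpow_ne_zero _ qvar_ne_zero
  have h4 : qvar ^ (4 * d) = (qvar ^ d) ^ 4 := by
    rw [mul_comm, zpow_mul]; norm_cast
  rw [zpow_neg] at h
  rw [h4]
  field_simp at h
  linear_combination ((qvar ^ d) ^ 2 - 1) * h

theorem qvar_three_ne_zero {d : ℤ} (hd : d ≠ 0) :
    qvar ^ (2 * d) + 1 + qvar ^ (-(2 * d)) ≠ 0 := by
  intro h
  apply qvar_zpow_ne_one (n := 6 * d) (by omega)
  have h0 : qvar ^ (2 * d) ≠ 0 := zpow_ne_zero _ qvar_ne_zero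
  have h6 : qvar ^ (6 * d) = (qvar ^ (2 * d)) ^ 3 := by
    rw [show 6 * d = 2 * d * 3 by ring, zpow_mul]; norm_cast
  rw [zpow_neg] at h
  rw [h6]
  field_simp at h
  linear_combination (qvar ^ (2 * d) - 1) * h

end Scalars

variable {A : Type*} [Ring A] [Algebra (RatFunc ℚ) A] (fm : ℕ → ℕ → ℤ) (e : ℕ → A)

/-- The monomial attached to a word. -/
def mono (w : List ℕ) : A := (w.map e).prod

theorem mono_append (u v : List ℕ) : mono e (u ++ v) = mono e u * mono e v := by
  simp [mono]

theorem mono_cons (k : ℕ) (v : List ℕ) : mono e (k :: v) = e k * mono e v := by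
  simp [mono]

theorem mono_singleton (k : ℕ) : mono e [k] = e k := by
  simp [mono]

/-- The span of the monomials of words of the same length smaller than `w`. -/
def lower (w : List ℕ) : Submodule (RatFunc ℚ) A :=
  Submodule.span (RatFunc ℚ) {x | ∃ v : List ℕ, v.length = w.length ∧ wordLt v w ∧ x = mono e v}

/-- A word is reducible if its monomial is a combination of monomials of smaller words. -/
def Reducible (w : List ℕ) : Prop := mono e w ∈ lower e w

/-- `x` has leading word `w`. -/
def HasLead (x : A) (w : List ℕ) : Prop := x - mono e w ∈ lower e w

variable {e}

theorem mono_mem_lower {v w : List ℕ} (hl : v.length = w.length) (h : wordLt v w) :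
    mono e v ∈ lower e w := Submodule.subset_span ⟨v, hl, h, rfl⟩

theorem lower_le {v w : List ℕ} (hl : v.length = w.length) (h : wordLt v w) :
    lower e v ≤ lower e w := by
  rw [lower, Submodule.span_le]
  rintro x ⟨u, hu, huv, rfl⟩
  exact mono_mem_lower (hu.trans hl) (huv.trans h)

theorem HasLead.mem_lower {x : A} {v w : List ℕ} (hx : HasLead e x v)
    (hl : v.length = w.length) (h : wordLt v w) : x ∈ lower e w := by
  rw [← sub_add_cancel x (mono e v)]
  exact Submodule.add_mem _ (lower_le hl h hx) (mono_mem_lower hl h)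

theorem lower_mul_mono {x : A} {w : List ℕ} (hx : x ∈ lower e w) (u : List ℕ) :
    x * mono e u ∈ lower e (w ++ u) := by
  induction hx using Submodule.span_induction with
  | zero => rw [zero_mul]; exact Submodule.zero_mem _
  | add x y _ _ hx hy => rw [add_mul]; exact Submodule.add_mem _ hx hy
  | smul a x _ hx => rw [smul_mul_assoc]; exact Submodule.smul_mem _ _ hx
  | mem x hx =>
    obtain ⟨v, hl, h, rfl⟩ := hx
    rw [← mono_append]
    exact mono_mem_lower (by simp [hl]) (wordLt_append_right h u)

/-- This is where `lower` needs its restriction to words of the same length. -/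
theorem mono_mul_lower {x : A} {w : List ℕ} (hx : x ∈ lower e w) (u : List ℕ) :
    mono e u * x ∈ lower e (u ++ w) := by
  induction hx using Submodule.span_induction with
  | zero => rw [mul_zero]; exact Submodule.zero_mem _
  | add x y _ _ hx hy => rw [mul_add]; exact Submodule.add_mem _ hx hy
  | smul a x _ hx => rw [mul_smul_comm]; exact Submodule.smul_mem _ _ hx
  | mem x hx =>
    obtain ⟨v, hl, h, rfl⟩ := hx
    rw [← mono_append]
    exact mono_mem_lower (by simp [hl]) (wordLt_append_left _ rfl hl.symm h u)

theorem lower_mul_lower {x y : A} {w u : List ℕ} (hx : x ∈ lower e w) (hy : y ∈ lower e u) :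
    x * y ∈ lower e (w ++ u) := by
  induction hy using Submodule.span_induction with
  | zero => rw [mul_zero]; exact Submodule.zero_mem _
  | add y z _ _ hx hy => rw [mul_add]; exact Submodule.add_mem _ hx hy
  | smul a x _ hx => rw [mul_smul_comm]; exact Submodule.smul_mem _ _ hx
  | mem y hy =>
    obtain ⟨v, hl, h, rfl⟩ := hy
    exact lower_le (by simp [hl]) (wordLt_append_left _ rfl hl.symm h w) (lower_mul_mono hx v)

/-- Reducible words are closed under prolongation on both sides, so every factor of an irreducible
word is irreducible. -/
theorem Reducible.append {w : List ℕ} (h : Reducible e w) (u v : List ℕ) :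
    Reducible e (u ++ w ++ v) := by
  rw [Reducible, mono_append, mono_append]
  exact lower_mul_mono (mono_mul_lower h u) v

theorem Reducible.of_infix {w w' : List ℕ} (h : Reducible e w) (hw : w <:+: w') :
    Reducible e w' := by
  obtain ⟨u, v, rfl⟩ := hw
  exact h.append u v

theorem hasLead_mono (w : List ℕ) : HasLead e (mono e w) w := by
  rw [HasLead, sub_self]
  exact Submodule.zero_mem _

theorem HasLead.mul {x y : A} {w u : List ℕ} (hx : HasLead e x w) (hy : HasLead e y u) :
    HasLead e (x * y) (w ++ u) := by
  rw [HasLead, mono_append]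
  have : x * y - mono e w * mono e u = (x - mono e w) * (y - mono e u) +
      (x - mono e w) * mono e u + mono e w * (y - mono e u) := by noncomm_ring
  rw [this]
  exact Submodule.add_mem _ (Submodule.add_mem _ (lower_mul_lower hx hy) (lower_mul_mono hx u))
    (mono_mul_lower hy w)

/-- All reducibility proofs have this shape: a relation rewrites an element with leading word `w`
through elements with smaller leading words. -/
theorem HasLead.reducible {x : A} {w : List ℕ} (hx : HasLead e x w) (h : x ∈ lower e w) :
    Reducible e w := by
  have := Submodule.sub_mem _ h hx
  rwa [sub_sub_cancel] at this

variable (e)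

/-- The iterated `q`-bracket `[e_{i₁}, [e_{i₂}, … [e_{i_{n-1}}, e_{i_n}]…]]`. -/
def bracket : List ℕ → A
  | [] => 0
  | [k] => e k
  | k :: l :: w => e k * bracket (l :: w) -
      qvar ^ pairWord fm (l :: w) k • (bracket (l :: w) * e k)

variable {e fm}

theorem bracket_cons {w : List ℕ} (hw : w ≠ []) (k : ℕ) : bracket fm e (k :: w) =
    e k * bracket fm e w - qvar ^ pairWord fm w k • (bracket fm e w * e k) := by
  cases w with
  | nil => exact absurd rfl hw
  | cons l w => rw [bracket]

theorem bracket_singleton (k : ℕ) : bracket fm e [k] = e k := by rw [bracket]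

theorem pairWord_cons (i : ℕ) (w : List ℕ) (k : ℕ) :
    pairWord fm (i :: w) k = fm i k + pairWord fm w k := by
  simp [pairWord]

/-- In `e_k B - c B e_k` the second product has a leading word ending in `k < m`, hence smaller than
every word ending in `m`. So prepending a letter inside the bracket prepends it to the leading word.
-/
theorem hasLead_bracket {m : ℕ} (w : List ℕ) (hw : ∀ k ∈ w, k < m) :
    HasLead e (bracket fm e (w ++ [m])) (w ++ [m]) := by
  induction w with
  | nil =>
    rw [List.nil_append, bracket_singleton, ← mono_singleton e]
    exact hasLead_mono _
  | cons k w ih =>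
    specialize ih fun x hx => hw x (List.mem_cons_of_mem _ hx)
    have hk : HasLead e (e k) [k] := by
      rw [← mono_singleton e]
      exact hasLead_mono _
    rw [List.cons_append, bracket_cons (by simp), HasLead]
    have h1 := hk.mul ih
    have h2 := ih.mul hk
    have h3 := h2.mem_lower (w := k :: (w ++ [m])) (by simp) (by
      rw [← List.cons_append, wordLt_concat_iff]
      exact Or.inl (hw k List.mem_cons_self))
    have h4 : e k * bracket fm e (w ++ [m]) - mono e (k :: (w ++ [m])) ∈
        lower e (k :: (w ++ [m])) := h1
    have h5 := Submodule.sub_mem _ h4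
      (Submodule.smul_mem _ (qvar ^ pairWord fm (w ++ [m]) k) h3)
    convert h5 using 1
    abel

theorem reducible_of_bracket_eq_zero {m : ℕ} {w : List ℕ} (hw : ∀ k ∈ w, k < m)
    (h : bracket fm e (w ++ [m]) = 0) : Reducible e (w ++ [m]) := by
  refine (hasLead_bracket (fm := fm) w hw).reducible ?_
  rw [h]
  exact Submodule.zero_mem _

theorem wordLt_cons_append {m k : ℕ} (hk : k < m) (w v : List ℕ) :
    wordLt ((w ++ [m]) ++ (k :: v)) (k :: (w ++ [m]) ++ v) := by
  have : wordLt ((w ++ [m]) ++ [k]) (k :: (w ++ [m])) := by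
    rw [← List.cons_append, wordLt_concat_iff]
    exact Or.inl hk
  simpa using wordLt_append_right this v

section AdSerre

variable {K : Type*} [Field K] {R : Type*} [Ring R] [Algebra K R] (x D E : R)

/-- The `q`-bracket with an arbitrary parameter. -/
def qbr (c : K) (e x : R) : R := e * x - c • (x * e)

theorem qbr_comm (b c : K) (h : D * E = E * D) :
    qbr c D (qbr b E x) = qbr b E (qbr c D x) := by
  have h1 : D * (E * x) = E * (D * x) := by rw [← mul_assoc, h, mul_assoc]
  simp only [qbr, mul_sub, sub_mul, smul_mul_assoc, mul_smul_comm, mul_assoc, h, h1]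
  module

/-- Multiply the Serre relation by `x` on the right, and subtract `b c²` times its product with `x`
on the left: this is the Serre relation for the adjoint action. The parameters differ because a
bracket is twisted by the weight of its argument: a previous `D` multiplies the parameter of `D` by
`s²` and that of `E` by `s⁻¹`, and a previous `E` multiplies that of `D` by `s⁻¹`. -/
theorem qbr_quad {s b c c₁ c₂ c₃ c₄ c₅ : K} (hs : s ≠ 0) (h₁ : c₁ = c * s) (h₂ : c₂ = c * s⁻¹)
    (h₃ : c₃ = b * s⁻¹) (h₄ : c₄ = b * (s ^ 2)⁻¹) (h₅ : c₅ = c * s ^ 2)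
    (h : D * (D * E) - (s + s⁻¹) • (D * (E * D)) + E * (D * D) = 0) :
    qbr c₁ D (qbr c₂ D (qbr b E x)) - (s + s⁻¹) • qbr c₁ D (qbr c₃ E (qbr c D x)) +
      qbr c₄ E (qbr c₅ D (qbr c D x)) = 0 := by
  subst h₁ h₂ h₃ h₄ h₅
  have h1 := congrArg (fun y => y * x) h
  have h2 := congrArg (fun y => x * y) h
  have h3 := congrArg₂ (fun y z => y - (b * c ^ 2) • z) h1 h2
  simp only [smul_zero, sub_zero, mul_zero, zero_mul] at h3
  rw [← h3]
  simp only [qbr, mul_sub, sub_mul, mul_add, add_mul, smul_mul_assoc, mul_smul_comm, mul_assoc]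
  match_scalars <;> (field_simp; try ring)

/-- Same argument with the factor `b c³`. Now `s` is `q^{2d}`, so a previous `D` multiplies the
parameter of `D` by `s` only. -/
theorem qbr_cubic {s b c c₁ c₂ c₃ c₄ c₅ c₆ : K} (hs : s ≠ 0) (h₁ : c₁ = c * s)
    (h₂ : c₂ = c * s⁻¹) (h₃ : c₃ = b * s⁻¹) (h₄ : c₄ = b * (s ^ 2)⁻¹) (h₅ : c₅ = c * s ^ 2)
    (h₆ : c₆ = b * (s ^ 3)⁻¹)
    (h : D * (D * (D * E)) - (s + 1 + s⁻¹) • (D * (D * (E * D))) +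
      (s + 1 + s⁻¹) • (D * (E * (D * D))) - E * (D * (D * D)) = 0) :
    qbr c₁ D (qbr c D (qbr c₂ D (qbr b E x))) -
      (s + 1 + s⁻¹) • qbr c₁ D (qbr c D (qbr c₃ E (qbr c D x))) +
      (s + 1 + s⁻¹) • qbr c₁ D (qbr c₄ E (qbr c₁ D (qbr c D x))) -
      qbr c₆ E (qbr c₅ D (qbr c₁ D (qbr c D x))) = 0 := by
  subst h₁ h₂ h₃ h₄ h₅ h₆
  have h1 := congrArg (fun y => y * x) h
  have h2 := congrArg (fun y => x * y) h
  have h3 := congrArg₂ (fun y z => y - (b * c ^ 3) • z) h1 h2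
  simp only [smul_zero, sub_zero, mul_zero, zero_mul] at h3
  rw [← h3]
  simp only [qbr, mul_sub, sub_mul, mul_add, add_mul, smul_mul_assoc, mul_smul_comm, mul_assoc]
  match_scalars <;> (field_simp; try ring)

end AdSerre

theorem bracket_eq_qbr {w : List ℕ} (hw : w ≠ []) (k : ℕ) : bracket fm e (k :: w) =
    qbr (qvar ^ pairWord fm w k) (e k) (bracket fm e w) := bracket_cons hw k

theorem bracket_comm (hS : SerreRel fm e) {k l : ℕ} (hkl : k ≠ l) (h : fm k l = 0)
    (h' : fm l k = 0) {w : List ℕ} (hw : w ≠ []) :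
    bracket fm e (k :: l :: w) = bracket fm e (l :: k :: w) := by
  simp only [bracket_eq_qbr hw, bracket_eq_qbr (List.cons_ne_nil _ _), pairWord_cons, h, h',
    zero_add]
  exact qbr_comm _ _ _ _ _ (hS.comm k l hkl h)

/-- The first letters of bracket words obey the Serre relations; with `bracket_comm` and
`bracket_cubic` this reduces the vanishing of brackets to a calculus on words. -/
theorem bracket_quad (hS : SerreRel fm e) {k l : ℕ} {d : ℤ} (hkl : k ≠ l)
    (hkk : fm k k = 2 * d) (h : fm k l = -d) (h' : fm l k = -d) {w : List ℕ} (hw : w ≠ []) :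
    bracket fm e (k :: k :: l :: w) -
      (qvar ^ d + qvar ^ (-d)) • bracket fm e (k :: l :: k :: w) +
      bracket fm e (l :: k :: k :: w) = 0 := by
  have q0 := qvar_ne_zero
  have hs : qvar ^ d ≠ 0 := zpow_ne_zero _ q0
  have hsq : qvar ^ (2 * d) = (qvar ^ d) ^ 2 := by
    rw [mul_comm, zpow_mul]; norm_cast
  have key := hS.quad k l d hkl hkk h
  simp only [bracket_eq_qbr hw, bracket_eq_qbr (List.cons_ne_nil _ _), pairWord_cons, hkk, h, h',
    zpow_add₀ q0, zpow_neg, hsq] at key ⊢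
  rw [mul_left_comm (qvar ^ d)⁻¹ ((qvar ^ d) ^ 2)]
  refine qbr_quad _ _ _ hs ?_ ?_ ?_ ?_ ?_ key <;> (field_simp; try ring)

theorem bracket_cubic (hS : SerreRel fm e) {k l : ℕ} {d : ℤ} (hkl : k ≠ l)
    (hkk : fm k k = 2 * d) (h : fm k l = -(2 * d)) (h' : fm l k = -(2 * d)) {w : List ℕ}
    (hw : w ≠ []) :
    bracket fm e (k :: k :: k :: l :: w) -
      (qvar ^ (2 * d) + 1 + qvar ^ (-(2 * d))) • bracket fm e (k :: k :: l :: k :: w) +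
      (qvar ^ (2 * d) + 1 + qvar ^ (-(2 * d))) • bracket fm e (k :: l :: k :: k :: w) -
      bracket fm e (l :: k :: k :: k :: w) = 0 := by
  have q0 := qvar_ne_zero
  have hs : qvar ^ (2 * d) ≠ 0 := zpow_ne_zero _ q0
  have key := hS.cubic k l d hkl hkk h
  simp only [bracket_eq_qbr hw, bracket_eq_qbr (List.cons_ne_nil _ _), pairWord_cons, hkk, h, h']
  rw [zpow_neg] at key ⊢
  generalize pairWord fm w k = a
  generalize pairWord fm w l = b
  generalize hσ : qvar ^ (2 * d) = s at *
  have hsn : qvar ^ (-(2 * d)) = s⁻¹ := by rw [zpow_neg, hσ]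
  simp only [zpow_add₀ q0, hσ, hsn]
  have h1 : s⁻¹ * (s * qvar ^ a) = qvar ^ a := by field_simp
  have h2 : s⁻¹ * (s * (s * qvar ^ a)) = s * qvar ^ a := by field_simp
  have h3 : s * (s⁻¹ * qvar ^ a) = qvar ^ a := by field_simp
  simp only [h1, h2, h3]
  refine qbr_cubic _ _ _ hs ?_ ?_ ?_ ?_ ?_ ?_ key <;> (field_simp; try ring)

end Normal

end QLyndon

namespace QLyndon

/-! ### Vanishing and `q`-commutation of brackets -/

noncomputable section Relations

variable {A : Type*} [Ring A] [Algebra (RatFunc ℚ) A] {fm : ℕ → ℕ → ℤ} {e : ℕ → A}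

section Vanishing

theorem bracket_cons_eq_zero {w : List ℕ} (hw : w ≠ []) (h : bracket fm e w = 0) (k : ℕ) :
    bracket fm e (k :: w) = 0 := by
  rw [bracket_cons hw, h]
  simp

theorem bracket_congr {u v : List ℕ} (hu : u ≠ []) (hv : v ≠ [])
    (h : bracket fm e u = bracket fm e v) (k : ℕ) (hp : pairWord fm u k = pairWord fm v k) :
    bracket fm e (k :: u) = bracket fm e (k :: v) := by
  rw [bracket_cons hu, bracket_cons hv, h, hp]

theorem pairWord_eq_zero {w : List ℕ} {k : ℕ} (h : ∀ x ∈ w, fm x k = 0) : pairWord fm w k = 0 := by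
  apply List.sum_eq_zero
  intro x hx
  obtain ⟨y, hy, rfl⟩ := List.mem_map.1 hx
  exact h y hy

theorem pairWord_nil (k : ℕ) : pairWord fm [] k = 0 := rfl

theorem bracket_comm_eq_zero (hS : SerreRel fm e) {k l : ℕ} (hkl : k ≠ l) (h : fm k l = 0)
    (h' : fm l k = 0) {w : List ℕ} (hw : w ≠ []) (h0 : bracket fm e (k :: w) = 0) :
    bracket fm e (k :: l :: w) = 0 := by
  rw [bracket_comm hS hkl h h' hw]
  exact bracket_cons_eq_zero (List.cons_ne_nil _ _) h0 l

theorem bracket_pair_eq_zero (hS : SerreRel fm e) {k l : ℕ} (hkl : k ≠ l) (h : fm k l = 0)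
    (h' : fm l k = 0) : bracket fm e [k, l] = 0 := by
  rw [bracket_cons (by simp), bracket_singleton, hS.comm k l hkl h, pairWord_cons, h']
  simp [pairWord]

theorem bracket_far_eq_zero (hS : SerreRel fm e) {k : ℕ} : ∀ w : List ℕ, w ≠ [] →
    (∀ x ∈ w, k ≠ x ∧ fm k x = 0 ∧ fm x k = 0) → bracket fm e (k :: w) = 0
  | [], h, _ => absurd rfl h
  | [l], _, h => by
    obtain ⟨h1, h2, h3⟩ := h l (by simp)
    exact bracket_pair_eq_zero hS h1 h2 h3
  | l :: l' :: w, _, h => by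
    obtain ⟨h1, h2, h3⟩ := h l (by simp)
    exact bracket_comm_eq_zero hS h1 h2 h3 (by simp)
      (bracket_far_eq_zero hS (l' :: w) (by simp) fun x hx => h x (List.mem_cons_of_mem _ hx))

/-- The pair `(k, l)` satisfies the quadratic Serre relation `[k, [k, l]] = 0`. -/
structure Quad (fm : ℕ → ℕ → ℤ) (k l : ℕ) (d : ℤ) : Prop where
  ne : k ≠ l
  pos : d ≠ 0
  diag : fm k k = 2 * d
  off : fm k l = -d
  off' : fm l k = -d

/-- The pair `(k, l)` satisfies the cubic Serre relation `[k, [k, [k, l]]] = 0`. -/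
structure Cubic (fm : ℕ → ℕ → ℤ) (k l : ℕ) (d : ℤ) : Prop where
  ne : k ≠ l
  pos : d ≠ 0
  diag : fm k k = 2 * d
  off : fm k l = -(2 * d)
  off' : fm l k = -(2 * d)

variable {k l : ℕ} {d : ℤ} {w : List ℕ}

/-- If all but one of the terms of a bracket Serre relation vanish because they contain a vanishing
inner bracket, the remaining one vanishes too, its coefficient being nonzero. The names here and
below spell the first letters of the surviving term. -/
theorem Quad.klk (h : Quad fm k l d) (hS : SerreRel fm e) (hw : w ≠ [])
    (h1 : bracket fm e (k :: k :: w) = 0) (h2 : bracket fm e (l :: w) = 0) :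
    bracket fm e (k :: l :: k :: w) = 0 := by
  have key := bracket_quad hS h.ne h.diag h.off h.off' hw
  have h3 : bracket fm e (k :: k :: l :: w) = 0 :=
    bracket_cons_eq_zero (by simp) (bracket_cons_eq_zero (by simp) h2 k) k
  have h4 : bracket fm e (l :: k :: k :: w) = 0 := bracket_cons_eq_zero (by simp) h1 l
  rw [h3, h4, zero_sub, add_zero, neg_eq_zero, smul_eq_zero] at key
  exact key.resolve_left (qvar_two_ne_zero h.pos)

theorem Quad.kkl (h : Quad fm k l d) (hS : SerreRel fm e) (hw : w ≠ [])
    (h1 : bracket fm e (k :: w) = 0) : bracket fm e (k :: k :: l :: w) = 0 := by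
  have key := bracket_quad hS h.ne h.diag h.off h.off' hw
  have h3 : bracket fm e (k :: l :: k :: w) = 0 :=
    bracket_cons_eq_zero (by simp) (bracket_cons_eq_zero (by simp) h1 l) k
  have h4 : bracket fm e (l :: k :: k :: w) = 0 :=
    bracket_cons_eq_zero (by simp) (bracket_cons_eq_zero (by simp) h1 k) l
  rwa [h3, h4, smul_zero, sub_zero, add_zero] at key

theorem Cubic.kkkl (h : Cubic fm k l d) (hS : SerreRel fm e) (hw : w ≠ [])
    (h1 : bracket fm e (k :: w) = 0) : bracket fm e (k :: k :: k :: l :: w) = 0 := by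
  have key := bracket_cubic hS h.ne h.diag h.off h.off' hw
  have h2 : bracket fm e (k :: k :: w) = 0 := bracket_cons_eq_zero (by simp) h1 k
  have h3 : bracket fm e (k :: k :: l :: k :: w) = 0 :=
    bracket_cons_eq_zero (by simp)
      (bracket_cons_eq_zero (by simp) (bracket_cons_eq_zero (by simp) h1 l) k) k
  have h4 : bracket fm e (k :: l :: k :: k :: w) = 0 :=
    bracket_cons_eq_zero (by simp) (bracket_cons_eq_zero (by simp) h2 l) k
  have h5 : bracket fm e (l :: k :: k :: k :: w) = 0 :=
    bracket_cons_eq_zero (by simp) (bracket_cons_eq_zero (by simp) h2 k) l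
  rwa [h3, h4, h5, smul_zero, sub_zero, add_zero, sub_zero] at key

theorem Cubic.klkk (h : Cubic fm k l d) (hS : SerreRel fm e) (hw : w ≠ [])
    (h1 : bracket fm e (l :: w) = 0) (h2 : bracket fm e (l :: k :: w) = 0)
    (h3 : bracket fm e (k :: k :: k :: w) = 0) : bracket fm e (k :: l :: k :: k :: w) = 0 := by
  have key := bracket_cubic hS h.ne h.diag h.off h.off' hw
  have h4 : bracket fm e (k :: k :: k :: l :: w) = 0 :=
    bracket_cons_eq_zero (by simp)
      (bracket_cons_eq_zero (by simp) (bracket_cons_eq_zero (by simp) h1 k) k) k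
  have h5 : bracket fm e (k :: k :: l :: k :: w) = 0 :=
    bracket_cons_eq_zero (by simp) (bracket_cons_eq_zero (by simp) h2 k) k
  have h6 : bracket fm e (l :: k :: k :: k :: w) = 0 := bracket_cons_eq_zero (by simp) h3 l
  rw [h4, h5, h6, smul_zero, sub_zero, sub_zero, zero_add, smul_eq_zero] at key
  exact key.resolve_left (qvar_three_ne_zero h.pos)

theorem Cubic.kklk (h : Cubic fm k l d) (hS : SerreRel fm e) (hw : w ≠ [])
    (h1 : bracket fm e (l :: w) = 0) (h2 : bracket fm e (k :: k :: w) = 0) :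
    bracket fm e (k :: k :: l :: k :: w) = 0 := by
  have key := bracket_cubic hS h.ne h.diag h.off h.off' hw
  have h3 : bracket fm e (k :: k :: k :: l :: w) = 0 :=
    bracket_cons_eq_zero (by simp)
      (bracket_cons_eq_zero (by simp) (bracket_cons_eq_zero (by simp) h1 k) k) k
  have h4 : bracket fm e (k :: l :: k :: k :: w) = 0 :=
    bracket_cons_eq_zero (by simp) (bracket_cons_eq_zero (by simp) h2 l) k
  have h5 : bracket fm e (l :: k :: k :: k :: w) = 0 :=
    bracket_cons_eq_zero (by simp) (bracket_cons_eq_zero (by simp) h2 k) l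
  rw [h3, h4, h5, zero_sub, smul_zero, add_zero, sub_zero, neg_eq_zero, smul_eq_zero] at key
  exact key.resolve_left (qvar_three_ne_zero h.pos)

/-- With the pairings `-d` and `d` as twists, the expanded bracket is literally the Serre relation.
-/
theorem Quad.base (h : Quad fm k l d) (hS : SerreRel fm e) : bracket fm e [k, k, l] = 0 := by
  have q0 := qvar_ne_zero
  rw [← hS.quad k l d h.ne h.diag h.off]
  simp only [bracket_cons (List.cons_ne_nil _ _), bracket_singleton, pairWord_cons, h.off', h.diag,
    pairWord_nil, add_zero]
  simp only [mul_sub, sub_mul, smul_mul_assoc, mul_smul_comm, mul_assoc, smul_sub, smul_smul,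
    ← zpow_add₀ q0, add_smul]
  simp only [show 2 * d + -d = d by ring, add_neg_cancel, zpow_zero, one_smul]
  abel

theorem Cubic.base (h : Cubic fm k l d) (hS : SerreRel fm e) :
    bracket fm e [k, k, k, l] = 0 := by
  have q0 := qvar_ne_zero
  rw [← hS.cubic k l d h.ne h.diag h.off]
  simp only [bracket_cons (List.cons_ne_nil _ _), bracket_singleton, pairWord_cons, h.off', h.diag,
    pairWord_nil, add_zero]
  simp only [mul_sub, sub_mul, smul_mul_assoc, mul_smul_comm, mul_assoc, smul_sub, smul_smul,
    ← zpow_add₀ q0, add_smul, one_smul]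
  simp only [add_neg_cancel, zero_add, add_zero, zpow_zero, one_smul]
  abel

end Vanishing

section Leibniz

/-- The bracket with `e_k` is a skew derivation, so it can be applied to both sides of a
`q`-commutation relation. -/
theorem qbr_mul (k : ℕ) {u v : List ℕ} (hu : u ≠ []) (hv : v ≠ []) {p : ℤ}
    (hp : p = pairWord fm u k + pairWord fm v k) :
    qbr (qvar ^ p) (e k) (bracket fm e u * bracket fm e v) =
      bracket fm e (k :: u) * bracket fm e v +
        qvar ^ pairWord fm u k • (bracket fm e u * bracket fm e (k :: v)) := by
  subst hp
  rw [bracket_cons hu, bracket_cons hv, qbr, zpow_add₀ qvar_ne_zero]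
  simp only [mul_sub, sub_mul, smul_mul_assoc, mul_smul_comm, mul_assoc, smul_sub, smul_smul]
  abel

theorem qbr_smul {K R : Type*} [Field K] [Ring R] [Algebra K R] (c a : K) (e x : R) :
    qbr c e (a • x) = a • qbr c e x := by
  simp only [qbr, mul_smul_comm, smul_mul_assoc, smul_sub]
  rw [smul_comm]

theorem qbr_add {K R : Type*} [Field K] [Ring R] [Algebra K R] (c : K) (e x y : R) :
    qbr c e (x + y) = qbr c e x + qbr c e y := by
  simp only [qbr, mul_add, add_mul, smul_add]
  abel

/-- Bracket the relation with `e_k`. As the bracket of `k :: v` is zero, only the terms in which `k`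
acts on `u` remain. In `pair_act_right` the roles are exchanged. -/
theorem pair_act_left {k : ℕ} {u v : List ℕ} (hu : u ≠ []) (hv : v ≠ []) {c : RatFunc ℚ}
    (h : bracket fm e u * bracket fm e v = c • (bracket fm e v * bracket fm e u))
    (hk : bracket fm e (k :: v) = 0) :
    bracket fm e (k :: u) * bracket fm e v =
      (c * qvar ^ pairWord fm v k) • (bracket fm e v * bracket fm e (k :: u)) := by
  have := congrArg (qbr (qvar ^ (pairWord fm u k + pairWord fm v k)) (e k)) h
  rw [qbr_smul, qbr_mul k hu hv rfl, qbr_mul k hv hu (add_comm _ _), hk, mul_zero, smul_zero,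
    add_zero, zero_mul, zero_add, smul_smul] at this
  exact this

theorem pair_act_right {k : ℕ} {u v : List ℕ} (hu : u ≠ []) (hv : v ≠ []) {c : RatFunc ℚ}
    (h : bracket fm e u * bracket fm e v = c • (bracket fm e v * bracket fm e u))
    (hk : bracket fm e (k :: u) = 0) :
    bracket fm e u * bracket fm e (k :: v) =
      (c * qvar ^ (-pairWord fm u k)) • (bracket fm e (k :: v) * bracket fm e u) := by
  have := congrArg (qbr (qvar ^ (pairWord fm u k + pairWord fm v k)) (e k)) h
  rw [qbr_smul, qbr_mul k hu hv rfl, qbr_mul k hv hu (add_comm _ _), hk, mul_zero, smul_zero,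
    add_zero, zero_mul, zero_add] at this
  rw [mul_comm c, mul_smul, ← this, smul_smul, ← zpow_add₀ qvar_ne_zero, neg_add_cancel, zpow_zero,
    one_smul]

/-- The step along a chain of words `w`, `k w`, `k' k w` which propagates the `q`-commutation of
consecutive brackets. -/
theorem chain_step {k k' : ℕ} {w : List ℕ} (hw : w ≠ []) {c : RatFunc ℚ}
    (h : bracket fm e (k :: w) * bracket fm e w =
      c • (bracket fm e w * bracket fm e (k :: w)))
    (h1 : bracket fm e (k' :: w) = 0) (h2 : bracket fm e (k :: k' :: k :: w) = 0) :
    bracket fm e (k' :: k :: w) * bracket fm e (k :: w) =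
      (c * qvar ^ (pairWord fm w k' - pairWord fm (k' :: k :: w) k)) •
        (bracket fm e (k :: w) * bracket fm e (k' :: k :: w)) := by
  have h3 := pair_act_right (by simp) hw (pair_act_left (by simp) hw h h1) h2
  rw [h3, mul_assoc, ← zpow_add₀ qvar_ne_zero, sub_eq_add_neg]

/-- The Serre relation for `(l, k)`, rearranged. -/
theorem Quad.pair_base {k l : ℕ} {d : ℤ} (h : Quad fm l k d) (hS : SerreRel fm e) :
    bracket fm e [k, l] * bracket fm e [l] =
      qvar ^ d • (bracket fm e [l] * bracket fm e [k, l]) := by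
  have q0 := qvar_ne_zero
  have key := hS.quad l k d h.ne h.diag h.off
  simp only [bracket_cons (List.cons_ne_nil _ _), bracket_singleton, pairWord_cons, h.off,
    pairWord_nil, add_zero]
  rw [← sub_eq_zero, ← key]
  simp only [mul_sub, sub_mul, smul_mul_assoc, mul_smul_comm, mul_assoc, smul_sub, smul_smul,
    ← zpow_add₀ q0, add_smul, add_neg_cancel, zpow_zero, one_smul]
  abel

end Leibniz

section Leading

/-- `w` ends with its largest letter `m`, which occurs only there. -/
def EndsWith (m : ℕ) (w : List ℕ) : Prop := ∃ u : List ℕ, w = u ++ [m] ∧ ∀ x ∈ u, x < m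

theorem EndsWith.ne_nil {m : ℕ} {w : List ℕ} (h : EndsWith m w) : w ≠ [] := by
  obtain ⟨u, rfl, -⟩ := h
  simp

theorem endsWith_singleton (m : ℕ) : EndsWith m [m] := ⟨[], rfl, by simp⟩

theorem EndsWith.cons {m k : ℕ} {w : List ℕ} (h : EndsWith m w) (hk : k < m) :
    EndsWith m (k :: w) := by
  obtain ⟨u, rfl, hu⟩ := h
  refine ⟨k :: u, rfl, ?_⟩
  simpa [hk] using hu

theorem EndsWith.append {m : ℕ} {w : List ℕ} (h : EndsWith m w) {v : List ℕ}
    (hv : ∀ k ∈ v, k < m) : EndsWith m (v ++ w) := by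
  obtain ⟨u, rfl, hu⟩ := h
  refine ⟨v ++ u, by simp, fun x hx => ?_⟩
  rcases List.mem_append.1 hx with hx | hx
  · exact hv x hx
  · exact hu x hx

theorem EndsWith.hasLead {m : ℕ} {w : List ℕ} (h : EndsWith m w) :
    HasLead e (bracket fm e w) w := by
  obtain ⟨u, rfl, hu⟩ := h
  exact hasLead_bracket u hu

theorem EndsWith.reducible {m : ℕ} {w : List ℕ} (h : EndsWith m w)
    (h0 : bracket fm e w = 0) : Reducible e w := by
  obtain ⟨u, rfl, hu⟩ := h
  exact reducible_of_bracket_eq_zero hu h0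

theorem EndsWith.wordLt {m k : ℕ} {w : List ℕ} (h : EndsWith m w) (hk : k < m) (v : List ℕ) :
    wordLt (w ++ k :: v) (k :: w ++ v) := by
  obtain ⟨u, rfl, hu⟩ := h
  exact wordLt_cons_append hk u v

/-- The two sides of the `q`-commutation have leading words `k w w` and `w k w`. Before the common
right factor `w` these end in `m` and in `k < m`, so the second is smaller. -/
theorem EndsWith.reducible_pair {m k : ℕ} {w : List ℕ} (h : EndsWith m w) (hk : k < m)
    {c : RatFunc ℚ} (hc : bracket fm e (k :: w) * bracket fm e w =
      c • (bracket fm e w * bracket fm e (k :: w))) : Reducible e (k :: w ++ w) := by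
  have h1 := (h.cons hk).hasLead (fm := fm) (e := e)
  have h2 := h.hasLead (fm := fm) (e := e)
  refine (h1.mul h2).reducible ?_
  rw [hc]
  exact Submodule.smul_mem _ _ ((h2.mul h1).mem_lower (by simp; omega) (h.wordLt hk w))

end Leading

section Chain

/-- The letters `≥ a` form a simply laced chain `a — a+1 — ⋯` of roots of square length `2d`. -/
structure ChainForm (fm : ℕ → ℕ → ℤ) (a : ℕ) (d : ℤ) : Prop where
  pos : d ≠ 0
  diag : ∀ k, a ≤ k → fm k k = 2 * d
  adj : ∀ k, a ≤ k → fm k (k + 1) = -d ∧ fm (k + 1) k = -d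
  far : ∀ k l, a ≤ k → k + 1 < l → fm k l = 0 ∧ fm l k = 0

theorem ChainForm.quad_succ {a : ℕ} {d : ℤ} (h : ChainForm fm a d) {k : ℕ} (hk : a ≤ k) :
    Quad fm k (k + 1) d :=
  ⟨by omega, h.pos, h.diag k hk, (h.adj k hk).1, (h.adj k hk).2⟩

theorem ChainForm.quad_pred {a : ℕ} {d : ℤ} (h : ChainForm fm a d) {k : ℕ} (hk : a ≤ k) :
    Quad fm (k + 1) k d :=
  ⟨by omega, h.pos, h.diag _ (by omega), (h.adj k hk).2, (h.adj k hk).1⟩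

theorem up_self (m : ℕ) : up m m = [m] := by
  simp [up]

theorem up_cons {i m : ℕ} (h : i ≤ m) : up i m = i :: up (i + 1) m := by
  have : m + 1 - i = (m + 1 - (i + 1)) + 1 := by omega
  rw [up, this, List.range'_succ, up]

theorem up_ne_nil {i m : ℕ} (h : i ≤ m) : up i m ≠ [] := by
  rw [up_cons h]
  simp

theorem mem_up {i m x : ℕ} : x ∈ up i m ↔ i ≤ x ∧ x ≤ m := by
  simp only [up, List.mem_range'_1]
  omega

theorem up_append_singleton {i m : ℕ} (h : i ≤ m + 1) : up i (m + 1) = up i m ++ [m + 1] := by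
  have : m + 1 + 1 - i = (m + 1 - i) + 1 := by omega
  rw [up, up, this, List.range'_concat, show i + 1 * (m + 1 - i) = m + 1 by omega]

theorem endsWith_up {i m : ℕ} (h : i ≤ m) : EndsWith m (up i m) := by
  rcases m with _ | m
  · obtain rfl : i = 0 := by omega
    rw [up_self]
    exact endsWith_singleton 0
  · refine ⟨up i m, up_append_singleton h, fun x hx => ?_⟩
    have := mem_up.1 hx
    omega

theorem ChainForm.pairWord_far {a : ℕ} {d : ℤ} (h : ChainForm fm a d) {k i m : ℕ} (hk : a ≤ k)
    (hi : k + 1 < i) : pairWord fm (up i m) k = 0 :=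
  pairWord_eq_zero fun x hx => (h.far k x hk (by have := mem_up.1 hx; omega)).2

theorem ChainForm.pairWord_adj {a : ℕ} {d : ℤ} (h : ChainForm fm a d) {k m : ℕ} (hk : a ≤ k)
    (hm : k + 1 ≤ m) : pairWord fm (up (k + 1) m) k = -d := by
  rw [up_cons hm, pairWord_cons, (h.adj k hk).2, h.pairWord_far hk (by omega), add_zero]

theorem ChainForm.pairWord_self {a : ℕ} {d : ℤ} (h : ChainForm fm a d) {k m : ℕ} (hk : a ≤ k)
    (hm : k + 1 ≤ m) : pairWord fm (up k m) k = d := by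
  rw [up_cons (by omega), pairWord_cons, h.diag k hk, h.pairWord_adj hk hm]
  ring

/-- Only the letter `i - 1` can prolong `[i,…,m]`. A letter orthogonal to `i` is moved past it; the
remaining letters `k = i` and `k = i + 1` fall under the patterns `kkl` and `klk`. The induction
shortens the increasing word. -/
theorem ChainForm.bracket_eq_zero {a : ℕ} {d : ℤ} (h : ChainForm fm a d) (hS : SerreRel fm e)
    {m k : ℕ} (n : ℕ) : ∀ i, n = m - i → a ≤ i → i ≤ m → a ≤ k → k < m → k + 1 ≠ i →
    bracket fm e (k :: up i m) = 0 := by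
  induction n using Nat.strong_induction_on generalizing k with
  | _ n ih =>
  intro i hn ha hi hk hkm hki
  rcases Nat.lt_or_ge i m with him | him
  · rw [up_cons hi]
    have hne : up (i + 1) m ≠ [] := up_ne_nil him
    rcases lt_trichotomy k i with hlt | rfl | hgt
    · refine bracket_comm_eq_zero hS (by omega) (h.far k i hk (by omega)).1
        (h.far k i hk (by omega)).2 hne ?_
      exact ih _ (by omega) (i + 1) rfl (by omega) him hk hkm (by omega)
    · rcases Nat.lt_or_ge (k + 1) m with h' | h'
      · rw [up_cons him]
        exact (h.quad_succ hk).kkl hS (up_ne_nil h')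
          (ih _ (by omega) (k + 2) rfl (by omega) h' hk hkm (by omega))
      · obtain rfl : m = k + 1 := by omega
        rw [up_self]
        exact (h.quad_succ hk).base hS
    · rcases Nat.lt_or_ge (i + 1) k with h' | h'
      · refine bracket_comm_eq_zero hS (by omega) (h.far i k ha (by omega)).2
          (h.far i k ha (by omega)).1 hne ?_
        exact ih _ (by omega) (i + 1) rfl (by omega) him hk hkm (by omega)
      · obtain rfl : k = i + 1 := by omega
        rw [up_cons him]
        refine (h.quad_pred ha).klk hS (up_ne_nil (by omega)) ?_ ?_
        · rw [← up_cons him]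
          exact ih _ (by omega) (i + 1) rfl (by omega) him hk hkm (by omega)
        · exact ih _ (by omega) (i + 2) rfl (by omega) (by omega) ha (by omega) (by omega)
  · obtain rfl : i = m := by omega
    rw [up_self]
    exact bracket_pair_eq_zero hS (by omega) (h.far k i hk (by omega)).1
      (h.far k i hk (by omega)).2

theorem ChainForm.bracket_up_eq_zero {a : ℕ} {d : ℤ} (h : ChainForm fm a d) (hS : SerreRel fm e)
    {m k i : ℕ} (ha : a ≤ i) (hi : i ≤ m) (hk : a ≤ k) (hkm : k < m) (hki : k + 1 ≠ i) :
    bracket fm e (k :: up i m) = 0 :=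
  h.bracket_eq_zero hS _ i rfl ha hi hk hkm hki

/-- Descends from the Serre relation for the last two letters; each application of `chain_step`
leaves the constant `q^d` unchanged. -/
theorem ChainForm.pair {a : ℕ} {d : ℤ} (h : ChainForm fm a d) (hS : SerreRel fm e) {m : ℕ}
    (n : ℕ) : ∀ i, n = m - i → a ≤ i → i < m →
    bracket fm e (up i m) * bracket fm e (up (i + 1) m) =
      qvar ^ d • (bracket fm e (up (i + 1) m) * bracket fm e (up i m)) := by
  induction n with
  | zero => intro i hn ha hi; omega
  | succ n ih =>
    intro i hn ha hi
    rcases Nat.lt_or_ge (i + 1) m with h' | h'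
    · have := ih (i + 1) (by omega) (by omega) h'
      rw [up_cons hi.le]
      rw [up_cons h'.le] at this ⊢
      have hz1 := h.bracket_up_eq_zero hS (m := m) (k := i) (i := i + 2) (by omega) (by omega) ha
        hi (by omega)
      have hz2 := h.bracket_up_eq_zero hS (m := m) (k := i + 1) (i := i) (by omega) (by omega)
        (by omega) h' (by omega)
      rw [up_cons hi.le, up_cons h'.le] at hz2
      rw [chain_step (up_ne_nil (by omega)) this hz1 hz2]
      congr 1
      rw [pairWord_cons, ← up_cons h'.le, h.pairWord_far ha (by omega), (h.adj i ha).1,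
        h.pairWord_self (by omega) (by omega)]
      simp
    · obtain rfl : m = i + 1 := by omega
      rw [up_cons hi.le, up_self]
      exact (h.quad_pred ha).pair_base hS

theorem ChainForm.pair_up {a : ℕ} {d : ℤ} (h : ChainForm fm a d) (hS : SerreRel fm e) {i m : ℕ}
    (ha : a ≤ i) (hi : i < m) :
    bracket fm e (up i m) * bracket fm e (up (i + 1) m) =
      qvar ^ d • (bracket fm e (up (i + 1) m) * bracket fm e (up i m)) :=
  h.pair hS _ i rfl ha hi

end Chain

section Tail

/-- Along the increasing part of a chain of words `v (j + 1) = (j + 1) :: v j`, all brackets with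
letters different from the next one vanish. -/
theorem tail_eq_zero (hS : SerreRel fm e) {a : ℕ} {d : ℤ} (h : ChainForm fm a d) {m j₀ : ℕ}
    (ha : a ≤ j₀ + 1) (hfar : ∀ k j, j₀ + 2 ≤ j → k + 1 < j → fm k j = 0 ∧ fm j k = 0)
    {v : ℕ → List ℕ} (hne : ∀ j, v j ≠ []) (hv : ∀ j, j₀ ≤ j → v (j + 1) = (j + 1) :: v j)
    (h0 : ∀ k < m, k ≠ j₀ + 1 → bracket fm e (k :: v j₀) = 0)
    (h1 : j₀ + 1 < m → ∀ k < m, k ≠ j₀ + 2 → bracket fm e (k :: v (j₀ + 1)) = 0) (n : ℕ) :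
    (j₀ + n < m → ∀ k < m, k ≠ j₀ + n + 1 → bracket fm e (k :: v (j₀ + n)) = 0) ∧
    (j₀ + n + 1 < m → ∀ k < m, k ≠ j₀ + n + 2 → bracket fm e (k :: v (j₀ + n + 1)) = 0) := by
  induction n with
  | zero => exact ⟨fun _ => h0, h1⟩
  | succ n ih =>
    -- The statement is kept for two consecutive words, because prolonging by `j + 2` uses the
    -- vanishing both for `v (j + 1)` and for `v j`: the letters `j + 1` and `j + 2` give the
    -- patterns `klk` and `kkl` over `v j`, and all other letters commute past `j + 2`.
    refine ⟨fun hm => ih.2 (by omega), fun hm k hk hkj => ?_⟩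
    obtain ⟨ih1, ih2⟩ := ih
    specialize ih1 (by omega)
    specialize ih2 (by omega)
    set j := j₀ + n with hj
    change bracket fm e (k :: v (j + 1 + 1)) = 0
    rw [hv (j + 1) (by omega)]
    rcases Nat.lt_or_ge k (j + 1) with hlt | hge
    · have := hfar k (j + 1 + 1) (by omega) (by omega)
      exact bracket_comm_eq_zero hS (by omega) this.1 this.2 (hne _) (ih2 k hk (by omega))
    · rcases eq_or_lt_of_le hge with rfl | hgt
      · rw [hv j (by omega)]
        refine (h.quad_succ (by omega)).klk hS (hne _) ?_ (ih1 _ (by omega) (by omega))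
        rw [← hv j (by omega)]
        exact ih2 _ hk (by omega)
      · rcases eq_or_lt_of_le (Nat.succ_le_of_lt hgt) with rfl | hgt'
        · rw [hv j (by omega)]
          exact (h.quad_pred (by omega)).kkl hS (hne _) (ih1 _ hk (by omega))
        · have := h.far (j + 1 + 1) k (by omega) (by omega)
          exact bracket_comm_eq_zero hS (by omega) this.2 this.1 (hne _) (ih2 k hk (by omega))

/-- Iterates `chain_step`; the value of the constant is irrelevant for reducibility and is not
tracked. -/
theorem tail_pair {m j₀ : ℕ} {v : ℕ → List ℕ} (hne : ∀ j, v j ≠ [])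
    (hv : ∀ j, j₀ ≤ j → v (j + 1) = (j + 1) :: v j)
    (hz : ∀ j, j₀ ≤ j → j < m → ∀ k < m, k ≠ j + 1 → bracket fm e (k :: v j) = 0)
    (h0 : j₀ + 1 < m → ∃ c : RatFunc ℚ, bracket fm e (v (j₀ + 1)) * bracket fm e (v j₀) =
      c • (bracket fm e (v j₀) * bracket fm e (v (j₀ + 1)))) (n : ℕ) :
    j₀ + n + 1 < m → ∃ c : RatFunc ℚ,
      bracket fm e (v (j₀ + n + 1)) * bracket fm e (v (j₀ + n)) =
      c • (bracket fm e (v (j₀ + n)) * bracket fm e (v (j₀ + n + 1))) := by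
  induction n with
  | zero => exact h0
  | succ n ih =>
    intro hm
    obtain ⟨c, hc⟩ := ih (by omega)
    set j := j₀ + n with hj
    change ∃ c : RatFunc ℚ, bracket fm e (v (j + 1 + 1)) * bracket fm e (v (j + 1)) =
      c • (bracket fm e (v (j + 1)) * bracket fm e (v (j + 1 + 1)))
    have h2 := hz (j + 1 + 1) (by omega) hm (j + 1) (by omega) (by omega)
    rw [hv (j + 1) (by omega), hv j (by omega)] at h2 ⊢
    rw [hv j (by omega)] at hc
    exact ⟨_, chain_step (hne j) hc (hz j (by omega) (by omega) _ (by omega) (by omega)) h2⟩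

end Tail

end Relations

end QLyndon

namespace QLyndon

/-! ### The relations type by type -/

noncomputable section Types

/-- The form of `rootForm`, with the labels ranging over all natural numbers. -/
def natForm : ClassicalType → ℕ → ℕ → ℤ
  | .A, i, j => if i = j then 2 else if i + 1 = j ∨ j + 1 = i then -1 else 0
  | .B, i, j => if i = j then (if i = 0 then 2 else 4)
      else if i + 1 = j ∨ j + 1 = i then -2 else 0
  | .C, i, j => if i = j then (if i = 0 then 4 else 2)
      else if i + 1 = j ∨ j + 1 = i then (if i = 0 ∨ j = 0 then -2 else -1) else 0
  | .D, i, j => if i = j then 2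
      else if (1 ≤ i ∧ i + 1 = j) ∨ (1 ≤ j ∧ j + 1 = i) ∨ (i = 0 ∧ j = 2) ∨ (j = 0 ∧ i = 2) then -1
      else 0

theorem natForm_symm (T : ClassicalType) (i j : ℕ) : natForm T i j = natForm T j i := by
  cases T <;> simp only [natForm] <;> split_ifs <;> first | rfl | omega

variable {A : Type*} [Ring A] [Algebra (RatFunc ℚ) A] {e : ℕ → A}

theorem down_succ {i j : ℕ} (h : i ≤ j + 1) : down (j + 1) i = (j + 1) :: down j i := by
  rw [down, up_append_singleton h, List.reverse_append, down]
  rfl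

theorem down_self (i : ℕ) : down i i = [i] := by
  rw [down, up_self]
  rfl

theorem mem_down {i j x : ℕ} : x ∈ down j i ↔ i ≤ x ∧ x ≤ j := by
  rw [down, List.mem_reverse, mem_up]

theorem EndsWith.reducible_cons {fm : ℕ → ℕ → ℤ} {m k : ℕ} {w : List ℕ} (h : EndsWith m w)
    (hk : k < m) (h0 : bracket fm e (k :: w) = 0) : Reducible e (k :: w) :=
  (h.cons hk).reducible h0

section Scalars

variable {K R : Type*} [Field K] [Ring R] [Algebra K R]

/-- The outcome for type `B` of bracketing `y z = s z y` twice with `e 0`, where `z`, `y`, `w` are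
successive brackets with `e 0` and the next one is zero. The scalars `s`, `1`, `s⁻¹` are the twists
of `w`, `y`, `z`. -/
theorem double_act {s : K} (hs : s ≠ 0) {w y z : R}
    (h : 0 * z + s • (w * y) + (1 : K) • (w * y + (1 : K) • (y * w)) =
      s • (w * y + (1 : K) • (y * w) + s⁻¹ • (y * w + s⁻¹ • (z * 0)))) :
    w * y = s • (y * w) := by
  simp only [zero_mul, mul_zero, smul_zero, add_zero, zero_add] at h
  rw [← sub_eq_zero] at h ⊢
  rw [← h]
  match_scalars <;> (field_simp; try ring)

/-- Bracketing `y t = s t y` twice with `e 1`, where `e 1` sends `t` to `z`, `y` to `w`, and `z` and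
`w` to zero. Both sides become multiples of `s + s⁻¹`. -/
theorem act_C {s : K} (hs : s ≠ 0) (h2 : s + s⁻¹ ≠ 0) {w y z t : R}
    (h : 0 * t + s • (w * z) + s⁻¹ • (w * z + s⁻¹ • (y * 0)) =
      s • (0 * y + s • (z * w) + s⁻¹ • (z * w + s⁻¹ • (t * 0)))) :
    w * z = s • (z * w) := by
  simp only [zero_mul, mul_zero, smul_zero, add_zero, zero_add] at h
  rw [← sub_eq_zero] at h ⊢
  refine (smul_eq_zero.1 (?_ : (s + s⁻¹) • _ = _)).resolve_left h2
  rw [← h]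
  match_scalars <;> (field_simp; try ring)

/-- The defect is `S = s (t w - w t)`. It commutes with `z` and `y`, because the scalars from moving
either of them past `t` and past `w` are inverse to each other. -/
theorem central_C {s : K} (hs : s ≠ 0) {w y z t : R} (hzt : z * t = s • (t * z))
    (hyt : y * t = s • (t * y)) (hwz : w * z = s • (z * w)) (hwy : w * y = s • (y * w))
    (h : w * t + s⁻¹ • (y * z) = s • (z * y + s⁻¹ • (t * w))) :
    ∃ S : R, y * z = s ^ 2 • (z * y) + S ∧ S * z = z * S ∧ S * y = y * S := by
  refine ⟨s • (t * w - w * t), ?_, ?_, ?_⟩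
  · rw [← sub_eq_zero] at h ⊢
    rw [show (0 : R) = s • (0 : R) by rw [smul_zero], ← h]
    match_scalars <;> (field_simp; try ring)
  · have h1 : t * w * z = z * t * w := by
      rw [mul_assoc, hwz, mul_smul_comm, ← mul_assoc, ← smul_mul_assoc, hzt]
    have h2 : w * t * z = z * w * t := by
      rw [← smul_right_injective R hs |>.eq_iff]
      rw [mul_assoc, ← mul_smul_comm, ← hzt, ← mul_assoc, hwz, smul_mul_assoc]
    rw [smul_mul_assoc, mul_smul_comm, sub_mul, mul_sub, h1, h2, mul_assoc, mul_assoc]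
  · have h1 : t * w * y = y * t * w := by
      rw [mul_assoc, hwy, mul_smul_comm, ← mul_assoc, ← smul_mul_assoc, hyt]
    have h2 : w * t * y = y * w * t := by
      rw [← smul_right_injective R hs |>.eq_iff]
      rw [mul_assoc, ← mul_smul_comm, ← hyt, ← mul_assoc, hwy, smul_mul_assoc]
    rw [smul_mul_assoc, mul_smul_comm, sub_mul, mul_sub, h1, h2, mul_assoc, mul_assoc]

/-- Substitute `S = y z - s² z y` into its commutation with `z` and with `y`. -/
theorem central_C_cubic {s : K} {y z S : R} (h : y * z = s ^ 2 • (z * y) + S)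
    (hz : S * z = z * S) (hy : S * y = y * S) :
    y * z * z = (1 + s ^ 2) • (z * y * z) + (-s ^ 2) • (z * z * y) ∧
      y * y * z = (1 + s ^ 2) • (y * z * y) + (-s ^ 2) • (z * y * y) := by
  have hS : S = y * z - s ^ 2 • (z * y) := by rw [h]; abel
  rw [hS, ← sub_eq_zero] at hz hy
  constructor
  · rw [← sub_eq_zero, ← hz]
    simp only [smul_mul_assoc, mul_smul_comm, sub_mul, mul_sub, mul_assoc]
    module
  · rw [← sub_eq_zero, ← neg_eq_zero, ← hy]
    simp only [smul_mul_assoc, mul_smul_comm, sub_mul, mul_sub, mul_assoc]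
    module

/-- For the two letters `z = e 1` and `f = e 0`, this is the cubic Serre relation written with `y =
f z - s⁻¹ z f`. -/
theorem cubic_C_first {s : K} (hs : s ≠ 0) {z f : R}
    (h : z * (z * (z * f)) - (s + 1 + s⁻¹) • (z * (z * (f * z))) +
      (s + 1 + s⁻¹) • (z * (f * (z * z))) - f * (z * (z * z)) = 0) :
    (f * z - s⁻¹ • (z * f)) * z * z = (1 + s) • (z * (f * z - s⁻¹ • (z * f)) * z) +
      (-s) • (z * z * (f * z - s⁻¹ • (z * f))) := by
  rw [← sub_eq_zero, ← neg_eq_zero, ← h]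
  simp only [smul_mul_assoc, mul_smul_comm, sub_mul, mul_sub, mul_assoc]
  match_scalars <;> (field_simp; try ring)

/-- Multiply the first relation by `f` on the left and move `f` to the right end: the terms ending
in `f` cancel by the first relation, and the rest is the second one. -/
theorem cubic_C_second {s : K} (hs : s ≠ 0) {z f y : R} (hy : y = f * z - s⁻¹ • (z * f))
    (hf : f * y = s • (y * f))
    (h : y * z * z = (1 + s) • (z * y * z) + (-s) • (z * z * y)) :
    y * y * z = (1 + s) • (y * z * y) + (-s) • (z * y * y) := by
  have hfz : f * z = y + s⁻¹ • (z * f) := by rw [hy]; abel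
  have h1 : f * (y * z * z) = s • (y * y * z) + y * z * y + s⁻¹ • (y * z * z * f) := by
    rw [mul_assoc y, ← mul_assoc f, hf, smul_mul_assoc, mul_assoc y f, ← mul_assoc f, hfz, add_mul,
      smul_mul_assoc, mul_assoc z f, hfz]
    simp only [mul_smul_comm, mul_add, mul_assoc, smul_add, smul_smul]
    match_scalars <;> (field_simp; try ring)
  have h2 : f * (z * y * z) = y * y * z + z * y * y + s⁻¹ • (z * y * z * f) := by
    rw [mul_assoc z, ← mul_assoc f, hfz, add_mul, smul_mul_assoc, mul_assoc z f, ← mul_assoc f,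
      hf, smul_mul_assoc, mul_assoc y f, hfz]
    simp only [mul_smul_comm, mul_add, mul_assoc, smul_add, smul_smul]
    match_scalars <;> (field_simp; try ring)
  have h3 : f * (z * z * y) = y * z * y + s⁻¹ • (z * y * y) + s⁻¹ • (z * z * y * f) := by
    rw [mul_assoc z, ← mul_assoc f, hfz, add_mul, smul_mul_assoc, mul_assoc z f, ← mul_assoc f,
      hfz, add_mul, smul_mul_assoc, mul_assoc z f, hf]
    simp only [mul_smul_comm, mul_add, mul_assoc, smul_add, smul_smul]
    match_scalars <;> (field_simp; try ring)
  have h4 := congrArg (f * ·) h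
  simp only [mul_add, mul_smul_comm] at h4
  rw [h1, h2, h3, h] at h4
  rw [← sub_eq_zero] at h4 ⊢
  rw [← neg_eq_zero, ← h4]
  simp only [smul_mul_assoc, add_mul, mul_assoc]
  match_scalars <;> (field_simp; try ring)

/-- The difference of the two relations is `(s + s⁻¹)(b a - a b) = 0`. -/
theorem fork_D {s : K} (h2 : s + s⁻¹ ≠ 0) {z a b y : R}
    (h : y * z + s⁻¹ • (a * b) = s • (b * a + s⁻¹ • (z * y)))
    (h' : y * z + s⁻¹ • (b * a) = s • (a * b + s⁻¹ • (z * y))) : b * a = a * b := by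
  rw [← sub_eq_zero] at h h' ⊢
  refine (smul_eq_zero.1 (?_ : (s + s⁻¹) • _ = _)).resolve_left h2
  rw [← sub_zero 0]
  nth_rewrite 1 [← h']
  rw [← h]
  module

/-- The computation of `act_C` for the fork: `e 0` sends `z` to `b`, `a` to `y`, and `b` and `y` to
zero. -/
theorem act_D {s : K} (hs : s ≠ 0) (h2 : s + s⁻¹ ≠ 0) {z a b y : R}
    (h : 0 * z + s • (y * b) + s⁻¹ • (y * b + s⁻¹ • (a * 0)) =
      s • (0 * a + s • (b * y) + s⁻¹ • (b * y + s⁻¹ • (z * 0)))) : y * b = s • (b * y) := by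
  simp only [zero_mul, mul_zero, smul_zero, add_zero, zero_add] at h
  rw [← sub_eq_zero] at h ⊢
  refine (smul_eq_zero.1 (?_ : (s + s⁻¹) • _ = _)).resolve_left h2
  rw [← h]
  match_scalars <;> (field_simp; try ring)

end Scalars

/-! ### Type `A` -/

section TypeA

theorem chainForm_A : ChainForm (natForm .A) 0 1 := by
  refine ⟨by norm_num, fun k hk => ?_, fun k hk => ?_, fun k l hk h => ?_⟩ <;>
    first
    | (constructor <;> simp only [natForm] <;> split_ifs <;> grind)
    | (simp only [natForm]; split_ifs <;> omega)

end TypeA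

/-! ### Type `B` -/

section TypeB

theorem chainForm_B : ChainForm (natForm .B) 1 2 := by
  refine ⟨by norm_num, fun k hk => ?_, fun k hk => ?_, fun k l hk h => ?_⟩ <;>
    first
    | (constructor <;> simp only [natForm] <;> split_ifs <;> grind)
    | (simp only [natForm]; split_ifs <;> omega)

theorem far_B (k j : ℕ) (h : k + 1 < j) : natForm .B k j = 0 ∧ natForm .B j k = 0 := by
  simp only [natForm]
  split_ifs <;> omega

theorem cubic_B : Cubic (natForm .B) 0 1 1 := by
  constructor <;> simp [natForm]

theorem quad_B : Quad (natForm .B) 1 0 2 := by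
  constructor <;> simp [natForm]

theorem pairWord_B_zero {m : ℕ} (hm : 1 ≤ m) : pairWord (natForm .B) (up 1 m) 0 = -2 := by
  rw [up_cons hm, pairWord_cons,
    pairWord_eq_zero fun x hx => (far_B 0 x (by have := mem_up.1 hx; omega)).2]
  simp [natForm]

variable (hS : SerreRel (natForm .B) e)
include hS

/-- The lemmas `zero_B_*` follow the block list `[i,…,m]`, `[0,0,…,m]`, `[1,0,0,…,m]`, … and show
that every letter below `m` other than the next one in the list gives a zero bracket. The lemmas
`zero_C_*` and `zero_D_*` have the same purpose, except that in type `D` the bracket of `0 :: up 1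
m` is not among the zeros. -/
theorem zero_B_up {i k m : ℕ} (h1 : 1 ≤ i) (hi : i ≤ m) (hk : k < m) (hki : k + 1 ≠ i) :
    bracket (natForm .B) e (k :: up i m) = 0 := by
  rcases Nat.eq_zero_or_pos k with rfl | hk0
  · refine bracket_far_eq_zero hS _ (up_ne_nil hi) fun x hx => ?_
    have hx := mem_up.1 hx
    exact ⟨by omega, far_B 0 x (by omega)⟩
  · exact chainForm_B.bracket_up_eq_zero hS h1 hi hk0 hk hki

theorem zero_B_up_zero {k m : ℕ} (h1 : 1 ≤ k) (hk : k < m) :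
    bracket (natForm .B) e (k :: up 0 m) = 0 := by
  rw [up_cons (Nat.zero_le m)]
  rcases eq_or_lt_of_le h1 with rfl | h2
  · rw [zero_add, up_cons hk.le]
    refine quad_B.klk hS (up_ne_nil hk) ?_ (zero_B_up hS (by omega) hk (by omega) (by omega))
    rw [← up_cons hk.le]
    exact zero_B_up hS le_rfl hk.le hk (by omega)
  · exact bracket_comm_eq_zero hS (by omega) (far_B 0 k h2).2 (far_B 0 k h2).1
      (up_ne_nil (by omega)) (zero_B_up hS le_rfl (by omega) hk (by omega))

theorem zero_B_zero {k m : ℕ} (hk : k < m) (hk1 : k ≠ 1) :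
    bracket (natForm .B) e (k :: 0 :: up 0 m) = 0 := by
  rcases Nat.eq_zero_or_pos k with rfl | hk0
  · rw [up_cons (Nat.zero_le m), zero_add]
    rcases eq_or_lt_of_le (Nat.succ_le_of_lt hk) with rfl | h2
    · rw [Nat.succ_eq_add_one, zero_add, up_self]
      exact cubic_B.base hS
    · rw [up_cons (Nat.succ_le_of_lt hk)]
      exact cubic_B.kkkl hS (up_ne_nil (by omega))
        (zero_B_up hS (by omega) (by omega) (by omega) (by omega))
  · exact bracket_comm_eq_zero hS (by omega) (far_B 0 k (by omega)).2 (far_B 0 k (by omega)).1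
      (up_ne_nil (by omega)) (zero_B_up_zero hS hk0 hk)

/-- The critical letter is `0`: `[0,1,0,0,…]` is the only term of the cubic relation over `up 1 m`
that is not already known to vanish. -/
theorem zero_B_one {k m : ℕ} (h1 : 1 < m) (hk : k < m) (hk2 : k ≠ 2) :
    bracket (natForm .B) e (k :: 1 :: 0 :: up 0 m) = 0 := by
  have hz := zero_B_up_zero hS le_rfl h1
  rcases Nat.lt_trichotomy k 1 with h | rfl | h
  · obtain rfl : k = 0 := by omega
    have h0 := zero_B_zero hS (k := 0) hk (by omega)
    rw [up_cons (Nat.zero_le m)] at hz h0 ⊢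
    exact cubic_B.klkk hS (up_ne_nil (by omega))
      (zero_B_up hS le_rfl (by omega) h1 (by omega)) hz h0
  · exact quad_B.kkl hS (up_ne_nil (by omega)) hz
  · exact bracket_comm_eq_zero hS (by omega) (far_B 1 k (by omega)).2 (far_B 1 k (by omega)).1
      (by simp) (zero_B_zero hS hk (by omega))

theorem zero_B_tail {j k m : ℕ} (hj : j < m) (hk : k < m) (hkj : k ≠ j + 1) :
    bracket (natForm .B) e (k :: (down j 0 ++ up 0 m)) = 0 := by
  have := (tail_eq_zero hS chainForm_B (m := m) (j₀ := 0) le_rfl (fun k j _ h => far_B k j h)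
    (v := fun j => down j 0 ++ up 0 m) (fun j => List.append_ne_nil_of_right_ne_nil _
      (up_ne_nil (Nat.zero_le m))) (fun j _ => by rw [down_succ (by omega)]; rfl)
    (fun k hk hk1 => zero_B_zero hS hk hk1)
    (fun h1 k hk hk2 => by
      have := zero_B_one hS (by omega) hk hk2
      rwa [zero_add, down_succ (by omega), down_self]) j).1
  rw [zero_add] at this
  exact this hj k hk hkj

theorem pair_B_up {i m : ℕ} (hi : i < m) :
    bracket (natForm .B) e (up i m) * bracket (natForm .B) e (up (i + 1) m) = qvar ^ (2 : ℤ) •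
      (bracket (natForm .B) e (up (i + 1) m) * bracket (natForm .B) e (up i m)) := by
  rcases Nat.eq_zero_or_pos i with rfl | h0
  · rcases eq_or_lt_of_le (Nat.succ_le_of_lt hi) with rfl | h2
    · rw [Nat.succ_eq_add_one, up_cons (Nat.zero_le _), up_self]
      exact quad_B.pair_base hS
    · have h := chainForm_B.pair_up hS (le_refl 1) h2
      have h1 := zero_B_up hS (m := m) (k := 0) (i := 2) (by omega) (by omega) hi (by omega)
      have h3 := zero_B_up_zero hS (m := m) le_rfl h2
      rw [up_cons (Nat.zero_le _), zero_add]
      rw [up_cons (Nat.zero_le _), zero_add] at h3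
      rw [up_cons hi] at h h3 ⊢
      rw [chain_step (up_ne_nil h2) h h1 h3]
      congr 1
      rw [pairWord_cons, ← up_cons hi, chainForm_B.pairWord_self le_rfl h2,
        pairWord_eq_zero fun x hx => (far_B 0 x (by have := mem_up.1 hx; omega)).2]
      simp [natForm]
  · exact chainForm_B.pair_up hS h0 hi

/-- Here the letter `0` is prepended twice in a row, so the relation is not reached by `chain_step`
but by acting twice with `e 0` on the preceding one. -/
theorem pair_B_mid {m : ℕ} (hm : 1 ≤ m) :
    bracket (natForm .B) e (0 :: up 0 m) * bracket (natForm .B) e (up 0 m) = qvar ^ (2 : ℤ) •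
      (bracket (natForm .B) e (up 0 m) * bracket (natForm .B) e (0 :: up 0 m)) := by
  have q0 := qvar_ne_zero
  have h := pair_B_up hS (i := 0) (m := m) (by omega)
  have hp := pairWord_B_zero hm
  have h0 := zero_B_zero hS (k := 0) (m := m) (by omega) (by omega)
  have hz : up 1 m ≠ [] := up_ne_nil hm
  rw [up_cons (Nat.zero_le _), zero_add] at h h0 ⊢
  have hp1 : pairWord (natForm .B) (0 :: up 1 m) 0 = 0 := by
    rw [pairWord_cons, hp]; simp [natForm]
  have hp2 : pairWord (natForm .B) (0 :: 0 :: up 1 m) 0 = 2 := by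
    rw [pairWord_cons, hp1]; simp [natForm]
  have h1 := congrArg (qbr (qvar ^ (-2 : ℤ)) (e 0)) h
  rw [qbr_smul, qbr_mul 0 (by simp) hz (by rw [hp, hp1]; rfl),
    qbr_mul 0 hz (by simp) (by rw [hp, hp1]; rfl), hp, hp1] at h1
  have h2 := congrArg (qbr (qvar ^ (0 : ℤ)) (e 0)) h1
  rw [qbr_add, qbr_smul, qbr_smul, qbr_add, qbr_smul,
    qbr_mul 0 (by simp) hz (by rw [hp, hp2]; rfl),
    qbr_mul 0 hz (by simp) (by rw [hp, hp2]; rfl),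
    qbr_mul 0 (by simp) (by simp) (by rw [hp1]; rfl), hp, hp1, hp2, h0, zpow_neg, zpow_zero] at h2
  exact double_act (zpow_ne_zero _ q0) h2

theorem pair_B_tail {j m : ℕ} (hj : j + 1 < m) : ∃ c : RatFunc ℚ,
    bracket (natForm .B) e (down (j + 1) 0 ++ up 0 m) *
        bracket (natForm .B) e (down j 0 ++ up 0 m) =
      c • (bracket (natForm .B) e (down j 0 ++ up 0 m) *
        bracket (natForm .B) e (down (j + 1) 0 ++ up 0 m)) := by
  have := tail_pair (m := m) (j₀ := 0) (fm := natForm .B) (e := e)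
    (v := fun j => down j 0 ++ up 0 m) (fun j => List.append_ne_nil_of_right_ne_nil _
      (up_ne_nil (Nat.zero_le m))) (fun j _ => by rw [down_succ (by omega)]; rfl)
    (fun j _ hj k hk hkj => zero_B_tail hS hj hk hkj) (fun h1 => by
      have hm : 1 < m := by omega
      have h2 := zero_B_one hS (k := 0) hm (by omega) (by omega)
      have h3 := zero_B_up_zero hS le_rfl hm
      rw [zero_add, down_succ (by omega), down_self]
      exact ⟨_, chain_step (up_ne_nil (by omega)) (pair_B_mid hS hm.le) h3 h2⟩) j
  rw [zero_add] at this
  exact this hj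

end TypeB

/-! ### Type `C` -/

section TypeC

theorem chainForm_C : ChainForm (natForm .C) 1 1 := by
  refine ⟨by norm_num, fun k hk => ?_, fun k hk => ?_, fun k l hk h => ?_⟩ <;>
    first
    | (constructor <;> simp only [natForm] <;> split_ifs <;> grind)
    | (simp only [natForm]; split_ifs <;> omega)

theorem far_C (k j : ℕ) (h : k + 1 < j) : natForm .C k j = 0 ∧ natForm .C j k = 0 := by
  simp only [natForm]
  split_ifs <;> omega

theorem cubic_C : Cubic (natForm .C) 1 0 1 := by
  constructor <;> simp [natForm]

theorem quad_C : Quad (natForm .C) 0 1 2 := by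
  constructor <;> simp [natForm]

variable (hS : SerreRel (natForm .C) e)
include hS

theorem zero_C_up {i k m : ℕ} (h1 : 1 ≤ i) (hi : i ≤ m) (hk : k < m) (hki : k + 1 ≠ i) :
    bracket (natForm .C) e (k :: up i m) = 0 := by
  rcases Nat.eq_zero_or_pos k with rfl | hk0
  · refine bracket_far_eq_zero hS _ (up_ne_nil hi) fun x hx => ?_
    have hx := mem_up.1 hx
    exact ⟨by omega, far_C 0 x (by omega)⟩
  · exact chainForm_C.bracket_up_eq_zero hS h1 hi hk0 hk hki

theorem zero_C_up_zero {k m : ℕ} (hk1 : k ≠ 1) (hk : k < m) :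
    bracket (natForm .C) e (k :: up 0 m) = 0 := by
  rw [up_cons (Nat.zero_le m), zero_add]
  rcases Nat.eq_zero_or_pos k with rfl | hk0
  · rcases eq_or_lt_of_le (Nat.succ_le_of_lt hk) with rfl | h2
    · rw [Nat.succ_eq_add_one, zero_add, up_self]
      exact quad_C.base hS
    · rw [up_cons (Nat.succ_le_of_lt hk)]
      exact quad_C.kkl hS (up_ne_nil (by omega))
        (zero_C_up hS (by omega) (by omega) (by omega) (by omega))
  · exact bracket_comm_eq_zero hS (by omega) (far_C 0 k (by omega)).2 (far_C 0 k (by omega)).1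
      (up_ne_nil (by omega)) (zero_C_up hS le_rfl (by omega) hk (by omega))

theorem zero_C_one {k m : ℕ} (h1 : 1 < m) (hk : k < m) (hk2 : k ≠ 2) :
    bracket (natForm .C) e (k :: 1 :: up 0 m) = 0 := by
  rcases Nat.lt_or_ge 1 k with h | h
  · exact bracket_comm_eq_zero hS (by omega) (far_C 1 k (by omega)).2 (far_C 1 k (by omega)).1
      (up_ne_nil (Nat.zero_le m)) (zero_C_up_zero hS (by omega) hk)
  have h0 := zero_C_up_zero hS (k := 0) (m := m) (by omega) (by omega)
  have h2 := zero_C_up hS (k := 1) (i := 1) (m := m) le_rfl (by omega) h1 (by omega)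
  have h3 := zero_C_up hS (k := 0) (i := 2) (m := m) (by omega) h1 (by omega) (by omega)
  rw [up_cons (Nat.zero_le m), zero_add, up_cons h1.le] at h0 ⊢
  rw [up_cons h1.le] at h2
  rcases Nat.eq_zero_or_pos k with rfl | hk0
  · exact quad_C.klk hS (by simp) h0 h2
  · obtain rfl : k = 1 := by omega
    exact cubic_C.kklk hS (up_ne_nil (by omega)) h3 h2

theorem zero_C_tail {j k m : ℕ} (hj : j < m) (hk : k < m) (hkj : k ≠ j + 1) :
    bracket (natForm .C) e (k :: (down j 1 ++ up 0 m)) = 0 := by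
  have := (tail_eq_zero hS chainForm_C (m := m) (j₀ := 0) le_rfl (fun k j _ h => far_C k j h)
    (v := fun j => down j 1 ++ up 0 m) (fun j => List.append_ne_nil_of_right_ne_nil _
      (up_ne_nil (Nat.zero_le m))) (fun j _ => by rw [down_succ (by omega)]; rfl)
    (fun k hk hk1 => zero_C_up_zero hS hk1 hk)
    (fun h1 k hk hk2 => by
      have := zero_C_one hS (by omega) hk hk2
      rwa [zero_add, down_self]) j).1
  rw [zero_add] at this
  exact this hj k hk hkj

theorem pair_C_up {i m : ℕ} (h1 : 1 ≤ i) (hi : i < m) :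
    bracket (natForm .C) e (up i m) * bracket (natForm .C) e (up (i + 1) m) = qvar ^ (1 : ℤ) •
      (bracket (natForm .C) e (up (i + 1) m) * bracket (natForm .C) e (up i m)) :=
  chainForm_C.pair_up hS h1 hi

/-- The relations between the brackets in the middle of the chain for type `C`. -/
theorem pair_C_mid {m : ℕ} (hm : 2 ≤ m) :
    bracket (natForm .C) e (1 :: up 0 m) * bracket (natForm .C) e (up 1 m) = qvar ^ (1 : ℤ) •
      (bracket (natForm .C) e (up 1 m) * bracket (natForm .C) e (1 :: up 0 m)) ∧
    bracket (natForm .C) e (1 :: up 0 m) * bracket (natForm .C) e (up 0 m) = qvar ^ (1 : ℤ) •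
      (bracket (natForm .C) e (up 0 m) * bracket (natForm .C) e (1 :: up 0 m)) ∧
    ∃ S : A, bracket (natForm .C) e (up 0 m) * bracket (natForm .C) e (up 1 m) =
      (qvar ^ (1 : ℤ)) ^ 2 • (bracket (natForm .C) e (up 1 m) * bracket (natForm .C) e (up 0 m)) +
        S ∧
      S * bracket (natForm .C) e (up 1 m) = bracket (natForm .C) e (up 1 m) * S ∧
      S * bracket (natForm .C) e (up 0 m) = bracket (natForm .C) e (up 0 m) * S := by
  have q0 := qvar_ne_zero
  have htz := pair_C_up hS (i := 1) (m := m) le_rfl hm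
  have h02 := zero_C_up hS (k := 0) (i := 2) (m := m) (by omega) hm (by omega) (by omega)
  have h11 := zero_C_up hS (k := 1) (i := 1) (m := m) le_rfl (by omega) hm (by omega)
  have h11w := zero_C_one hS (k := 1) (m := m) hm hm (by omega)
  have h01w := zero_C_one hS (k := 0) (m := m) hm (by omega) (by omega)
  have ht : up 2 m ≠ [] := up_ne_nil hm
  have ht0 : pairWord (natForm .C) (up 2 m) 0 = 0 :=
    pairWord_eq_zero fun x hx => (far_C 0 x (by have := mem_up.1 hx; omega)).2
  have ht1 : pairWord (natForm .C) (up 2 m) 1 = -1 := chainForm_C.pairWord_adj le_rfl hm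
  rw [up_cons (Nat.zero_le m), zero_add] at h11w h01w ⊢
  have hz : up 1 m = 1 :: up 2 m := up_cons (by omega)
  rw [hz] at h11 h11w h01w htz ⊢
  have hz0 : pairWord (natForm .C) (1 :: up 2 m) 0 = -2 := by
    rw [pairWord_cons, ht0]; simp [natForm]
  have hz1 : pairWord (natForm .C) (1 :: up 2 m) 1 = 1 := by
    rw [pairWord_cons, ht1]; simp [natForm]
  have hy0 : pairWord (natForm .C) (0 :: 1 :: up 2 m) 0 = 2 := by
    rw [pairWord_cons, hz0]; simp [natForm]
  have hy1 : pairWord (natForm .C) (0 :: 1 :: up 2 m) 1 = -1 := by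
    rw [pairWord_cons, hz1]; simp [natForm]
  have hw0 : pairWord (natForm .C) (1 :: 0 :: 1 :: up 2 m) 0 = 0 := by
    rw [pairWord_cons, hy0]; simp [natForm]
  have hw1 : pairWord (natForm .C) (1 :: 0 :: 1 :: up 2 m) 1 = 1 := by
    rw [pairWord_cons, hy1]; simp [natForm]
  have hyt := pair_act_left (k := 0) (by simp) ht htz h02
  rw [ht0, zpow_zero, mul_one] at hyt
  -- With `t`, `z`, `y`, `w` the brackets of `[2,…,m]`, `[1,…,m]`, `[0,…,m]`, `[1,0,…,m]`: one
  -- action of `e 1` on `y t = q t y` relates `y z` to `z y` up to `t` and `w`, and a second action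
  -- gives `w z = q z w`.
  have h1 := congrArg (qbr (qvar ^ (-2 : ℤ)) (e 1)) hyt
  rw [qbr_smul, qbr_mul 1 (by simp) ht (by rw [ht1, hy1]; rfl),
    qbr_mul 1 ht (by simp) (by rw [ht1, hy1]; rfl), ht1, hy1] at h1
  have h2 := congrArg (qbr (qvar ^ (0 : ℤ)) (e 1)) h1
  rw [qbr_add, qbr_smul, qbr_smul, qbr_add, qbr_smul,
    qbr_mul 1 (by simp) ht (by rw [hw1, ht1]; rfl),
    qbr_mul 1 (by simp) (by simp) (by rw [hy1, hz1]; rfl),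
    qbr_mul 1 (by simp) (by simp) (by rw [hy1, hz1]; rfl),
    qbr_mul 1 ht (by simp) (by rw [hw1, ht1]; rfl), h11, h11w, hw1, hy1, hz1, ht1] at h2
  rw [zpow_neg] at h1 h2
  have hwz := act_C (zpow_ne_zero _ q0)
    (by rw [← zpow_neg]; exact qvar_two_ne_zero (by norm_num)) h2
  have hwy := pair_act_right (k := 0) (by simp) (by simp) hwz h01w
  rw [hw0, neg_zero, zpow_zero, mul_one] at hwy
  exact ⟨hwz, hwy, central_C (zpow_ne_zero _ q0) htz hyt hwz hwy h1⟩

theorem pair_C_tail {j m : ℕ} (hj : j + 1 < m) : ∃ c : RatFunc ℚ,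
    bracket (natForm .C) e (down (j + 1) 1 ++ up 0 m) *
        bracket (natForm .C) e (down j 1 ++ up 0 m) =
      c • (bracket (natForm .C) e (down j 1 ++ up 0 m) *
        bracket (natForm .C) e (down (j + 1) 1 ++ up 0 m)) := by
  have := tail_pair (m := m) (j₀ := 0) (fm := natForm .C) (e := e)
    (v := fun j => down j 1 ++ up 0 m) (fun j => List.append_ne_nil_of_right_ne_nil _
      (up_ne_nil (Nat.zero_le m))) (fun j _ => by rw [down_succ (by omega)]; rfl)
    (fun j _ hj k hk hkj => zero_C_tail hS hj hk hkj) (fun h1 => by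
      rw [zero_add, down_self]
      exact ⟨_, (pair_C_mid hS (by omega)).2.1⟩) j
  rw [zero_add] at this
  exact this hj

/-- The two relations of degree three in the largest letter for type `C`. -/
theorem triple_C {m : ℕ} (hm : 1 ≤ m) {z y : A} (hz : z = bracket (natForm .C) e (up 1 m))
    (hy : y = bracket (natForm .C) e (up 0 m)) : ∃ a b : RatFunc ℚ,
      y * z * z = a • (z * y * z) + b • (z * z * y) ∧
      y * y * z = a • (y * z * y) + b • (z * y * y) := by
  have q0 := qvar_ne_zero
  -- For `m = 1` there is no block `[2,…,m]`, so the Serre relation between `0` and `1` is used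
  -- directly.
  rcases eq_or_lt_of_le hm with rfl | h2
  · have h00 := zero_C_up_zero hS (k := 0) (m := 1) (by omega) (by omega)
    rw [up_self, bracket_singleton] at hz
    rw [up_cons (by omega), zero_add, up_self] at hy h00
    have key := hS.cubic 1 0 1 cubic_C.ne cubic_C.diag cubic_C.off
    rw [zpow_neg, ← hz] at key
    have hp : pairWord (natForm .C) [0, 1] 0 = 2 := by simp [pairWord, natForm]
    have hp1 : pairWord (natForm .C) [1] 0 = -2 := by simp [pairWord, natForm]
    have hy' : y = e 0 * z - (qvar ^ (2 * 1 : ℤ))⁻¹ • (z * e 0) := by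
      rw [hy, bracket_cons (by simp), bracket_singleton, hp1, hz, zpow_neg, mul_one]
    have hzz : y * z * z = (1 + qvar ^ (2 * 1 : ℤ)) • (z * y * z) +
        (-qvar ^ (2 * 1 : ℤ)) • (z * z * y) := by
      rw [hy']
      exact cubic_C_first (zpow_ne_zero _ q0) key
    refine ⟨_, _, hzz, ?_⟩
    have hYY : e 0 * y = qvar ^ (2 * 1 : ℤ) • (y * e 0) := by
      rw [bracket_cons (by simp), hp, ← hy, sub_eq_zero] at h00
      exact h00
    exact cubic_C_second (zpow_ne_zero _ q0) hy' hYY hzz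
  · obtain ⟨-, -, S, h1, h3, h4⟩ := pair_C_mid hS h2
    rw [← hz, ← hy] at h1
    rw [← hz] at h3
    rw [← hy] at h4
    exact ⟨_, _, central_C_cubic h1 h3 h4⟩

end TypeC

/-! ### Type `D` -/

section TypeD

theorem chainForm_D : ChainForm (natForm .D) 1 1 := by
  refine ⟨by norm_num, fun k hk => ?_, fun k hk => ?_, fun k l hk h => ?_⟩ <;>
    first
    | (constructor <;> simp only [natForm] <;> split_ifs <;> grind)
    | (simp only [natForm]; split_ifs <;> omega)

theorem far_D (k j : ℕ) (h : k + 1 < j) (hj : 3 ≤ j) :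
    natForm .D k j = 0 ∧ natForm .D j k = 0 := by
  simp only [natForm]
  split_ifs <;> omega

theorem comm_D : natForm .D 0 1 = 0 ∧ natForm .D 1 0 = 0 := by
  simp [natForm]

theorem quad_D : Quad (natForm .D) 0 2 1 := by
  constructor <;> simp [natForm]

theorem quad_D' : Quad (natForm .D) 2 0 1 := by
  constructor <;> simp [natForm]

variable (hS : SerreRel (natForm .D) e)
include hS

theorem reducible_D_zero_one : Reducible e [0, 1] :=
  (endsWith_singleton 1).reducible_cons (by omega)
    (bracket_pair_eq_zero hS (by omega) comm_D.1 comm_D.2)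

theorem zero_D_up {i k m : ℕ} (h1 : 1 ≤ i) (hi : i ≤ m) (hk1 : 1 ≤ k) (hk : k < m)
    (hki : k + 1 ≠ i) : bracket (natForm .D) e (k :: up i m) = 0 :=
  chainForm_D.bracket_up_eq_zero hS h1 hi hk1 hk hki

theorem zero_D_up_zero {i m : ℕ} (h1 : 3 ≤ i) (hi : i ≤ m) :
    bracket (natForm .D) e (0 :: up i m) = 0 := by
  refine bracket_far_eq_zero hS _ (up_ne_nil hi) fun x hx => ?_
  have hx := mem_up.1 hx
  exact ⟨by omega, far_D 0 x (by omega) (by omega)⟩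

theorem zero_D_zero {k m : ℕ} (hm : 2 ≤ m) (hk : k < m) (hk1 : k ≠ 1) :
    bracket (natForm .D) e (k :: 0 :: up 2 m) = 0 := by
  rcases Nat.lt_or_ge 2 k with h | h
  · exact bracket_comm_eq_zero hS (by omega) (far_D 0 k (by omega) h).2
      (far_D 0 k (by omega) h).1 (up_ne_nil hm)
      (zero_D_up hS (by omega) hm (by omega) hk (by omega))
  · rcases Nat.eq_zero_or_pos k with rfl | h0
    · rcases eq_or_lt_of_le hm with rfl | h3
      · rw [up_self]
        exact quad_D.base hS
      · rw [up_cons hm]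
        exact quad_D.kkl hS (up_ne_nil h3) (zero_D_up_zero hS le_rfl h3)
    · obtain rfl : k = 2 := by omega
      have := zero_D_up hS (k := 2) (i := 2) (by omega) hm (by omega) hk (by omega)
      rw [up_cons hm] at this ⊢
      exact quad_D'.klk hS (up_ne_nil hk) this (zero_D_up_zero hS le_rfl hk)

/-- The letters `0` and `1` commute, so both orders give the same bracket. Vanishing can be proved
in whichever order makes a Serre pattern visible. -/
theorem swap_D {w : List ℕ} (hw : w ≠ []) :
    bracket (natForm .D) e (1 :: 0 :: w) = bracket (natForm .D) e (0 :: 1 :: w) :=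
  bracket_comm hS (by omega) comm_D.2 comm_D.1 hw

theorem swap_D_cons {w : List ℕ} (hw : w ≠ []) (k : ℕ) :
    bracket (natForm .D) e (k :: 1 :: 0 :: w) = bracket (natForm .D) e (k :: 0 :: 1 :: w) :=
  bracket_congr (by simp) (by simp) (swap_D hS hw) k (by simp only [pairWord_cons]; ring)

theorem zero_D_one {k m : ℕ} (hm : 2 ≤ m) (hk : k < m) (hk2 : k ≠ 2) :
    bracket (natForm .D) e (k :: 1 :: 0 :: up 2 m) = 0 := by
  have hne : up 2 m ≠ [] := up_ne_nil hm
  rcases Nat.lt_or_ge 2 k with h | h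
  · exact bracket_comm_eq_zero hS (by omega) (far_D 1 k (by omega) h).2
      (far_D 1 k (by omega) h).1 (by simp) (zero_D_zero hS hm hk (by omega))
  · rcases Nat.eq_zero_or_pos k with rfl | h0
    · exact bracket_comm_eq_zero hS (by omega) comm_D.1 comm_D.2 (by simp)
        (zero_D_zero hS hm hk (by omega))
    · obtain rfl : k = 1 := by omega
      rw [swap_D_cons hS hne]
      have := zero_D_up hS (k := 1) (i := 1) (m := m) le_rfl (by omega) le_rfl hk (by omega)
      rw [up_cons (by omega)] at this
      exact bracket_comm_eq_zero hS (by omega) comm_D.2 comm_D.1 (by simp) this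

/-- For the letter `0`, swap `1` and `0` to obtain `[0,2,0,1,2,…]`, which is a pattern `klk`. -/
theorem zero_D_two {k m : ℕ} (hm : 2 < m) (hk : k < m) (hk3 : k ≠ 3) :
    bracket (natForm .D) e (k :: 2 :: 1 :: 0 :: up 2 m) = 0 := by
  have hne : up 2 m ≠ [] := up_ne_nil hm.le
  rcases Nat.lt_or_ge 2 k with h | h
  · exact bracket_comm_eq_zero hS (by omega) (far_D 2 k (by omega) h).2
      (far_D 2 k (by omega) h).1 (by simp) (zero_D_one hS hm.le hk (by omega))
  have h20 := zero_D_zero hS (k := 2) (m := m) hm.le hm (by omega)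
  have h21 := zero_D_up hS (k := 2) (i := 1) (m := m) le_rfl (by omega) (by omega) hm (by omega)
  have h11 := zero_D_one hS (k := 1) (m := m) hm.le (by omega) (by omega)
  have h01 := zero_D_one hS (k := 0) (m := m) hm.le (by omega) (by omega)
  rw [up_cons (by omega), show 1 + 1 = 2 from rfl] at h21
  obtain rfl | rfl | rfl : k = 0 ∨ k = 1 ∨ k = 2 := by omega
  · rw [swap_D_cons hS hne] at h01
    have h := quad_D.klk hS (w := 1 :: up 2 m) (by simp) h01 h21
    rw [← h]
    refine bracket_congr (by simp) (by simp) (swap_D_cons hS hne 2) 0 ?_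
    simp only [pairWord_cons]
    ring
  · exact (chainForm_D.quad_succ le_rfl).klk hS (by simp) h11 h20
  · exact (chainForm_D.quad_pred le_rfl).kkl hS (by simp) h20

theorem zero_D_tail {j k m : ℕ} (h1 : 1 ≤ j) (hj : j < m) (hk : k < m) (hkj : k ≠ j + 1) :
    bracket (natForm .D) e (k :: (down j 1 ++ 0 :: up 2 m)) = 0 := by
  have := (tail_eq_zero hS chainForm_D (m := m) (j₀ := 1) (by omega)
    (fun k j hj h => far_D k j h hj)
    (v := fun j => down j 1 ++ 0 :: up 2 m) (fun j => by simp)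
    (fun j _ => by rw [down_succ (by omega)]; rfl)
    (fun k hk hk1 => by
      rw [down_self]
      exact zero_D_one hS (by omega) hk hk1)
    (fun h1 k hk hk2 => by
      rw [down_succ (by omega), down_self]
      exact zero_D_two hS (by omega) hk (by omega)) (j - 1)).1
  rw [Nat.add_sub_cancel' h1] at this
  exact this hj k hk hkj

theorem pair_D_up {i m : ℕ} (h1 : 1 ≤ i) (hi : i < m) :
    bracket (natForm .D) e (up i m) * bracket (natForm .D) e (up (i + 1) m) = qvar ^ (1 : ℤ) •
      (bracket (natForm .D) e (up (i + 1) m) * bracket (natForm .D) e (up i m)) :=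
  chainForm_D.pair_up hS h1 hi

theorem pair_D_zero {m : ℕ} (hm : 2 ≤ m) :
    bracket (natForm .D) e (0 :: up 2 m) * bracket (natForm .D) e (up 2 m) = qvar ^ (1 : ℤ) •
      (bracket (natForm .D) e (up 2 m) * bracket (natForm .D) e (0 :: up 2 m)) := by
  rcases eq_or_lt_of_le hm with rfl | h3
  · rw [up_self]
    exact quad_D'.pair_base hS
  · have h := pair_D_up hS (i := 2) (m := m) (by omega) h3
    have h2 := zero_D_zero hS (k := 2) (m := m) hm h3 (by omega)
    have hp := chainForm_D.pairWord_self (k := 2) (m := m) (by omega) h3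
    rw [up_cons hm] at h h2 hp ⊢
    rw [chain_step (up_ne_nil h3) h (zero_D_up_zero hS le_rfl h3) h2]
    congr 1
    rw [pairWord_cons, hp,
      pairWord_eq_zero fun x hx => (far_D 0 x (by have := mem_up.1 hx; omega)
        (by have := mem_up.1 hx; omega)).2]
    simp [natForm]

/-- The relations between the brackets in the middle of the chain for type `D`. -/
theorem pair_D_mid {m : ℕ} (hm : 2 ≤ m) :
    bracket (natForm .D) e (0 :: up 2 m) * bracket (natForm .D) e (up 1 m) =
      bracket (natForm .D) e (up 1 m) * bracket (natForm .D) e (0 :: up 2 m) ∧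
    bracket (natForm .D) e (1 :: 0 :: up 2 m) * bracket (natForm .D) e (0 :: up 2 m) =
      qvar ^ (1 : ℤ) • (bracket (natForm .D) e (0 :: up 2 m) *
        bracket (natForm .D) e (1 :: 0 :: up 2 m)) := by
  have q0 := qvar_ne_zero
  have hs : qvar ^ (1 : ℤ) + (qvar ^ (1 : ℤ))⁻¹ ≠ 0 := by
    rw [← zpow_neg]; exact qvar_two_ne_zero (by norm_num)
  have hne : up 2 m ≠ [] := up_ne_nil hm
  have hA := pair_D_up hS (i := 1) (m := m) le_rfl (by omega)
  have hB := pair_D_zero hS hm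
  have h00 := zero_D_zero hS (k := 0) (m := m) hm (by omega) (by omega)
  have h11 := zero_D_up hS (k := 1) (i := 1) (m := m) le_rfl (by omega) le_rfl (by omega)
    (by omega)
  have h01 := zero_D_one hS (k := 0) (m := m) hm (by omega) (by omega)
  have hz : up 1 m = 1 :: up 2 m := up_cons (by omega)
  rw [hz] at hA h11 ⊢
  rw [show 1 + 1 = 2 from rfl] at hA
  have hp0 : pairWord (natForm .D) (up 2 m) 0 = -1 := by
    rw [up_cons hm, pairWord_cons,
      pairWord_eq_zero fun x hx => (far_D 0 x (by have := mem_up.1 hx; omega)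
        (by have := mem_up.1 hx; omega)).2]
    simp [natForm]
  have hp1 : pairWord (natForm .D) (up 2 m) 1 = -1 := chainForm_D.pairWord_adj le_rfl hm
  have ha0 : pairWord (natForm .D) (1 :: up 2 m) 0 = -1 := by
    rw [pairWord_cons, hp0]; simp [natForm]
  have hb0 : pairWord (natForm .D) (0 :: up 2 m) 0 = 1 := by
    rw [pairWord_cons, hp0]; simp [natForm]
  have hb1 : pairWord (natForm .D) (0 :: up 2 m) 1 = -1 := by
    rw [pairWord_cons, hp1]; simp [natForm]
  have hy0 : pairWord (natForm .D) (1 :: 0 :: up 2 m) 0 = 1 := by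
    rw [pairWord_cons, hb0]; simp [natForm]
  have h1 := congrArg (qbr (qvar ^ (-2 : ℤ)) (e 0)) hA
  rw [qbr_smul, qbr_mul 0 (by simp) hne (by rw [hp0, ha0]; rfl),
    qbr_mul 0 hne (by simp) (by rw [hp0, ha0]; rfl), hp0, ha0, ← swap_D hS hne] at h1
  have h2 := congrArg (qbr (qvar ^ (-2 : ℤ)) (e 1)) hB
  rw [qbr_smul, qbr_mul 1 (by simp) hne (by rw [hp1, hb1]; rfl),
    qbr_mul 1 hne (by simp) (by rw [hp1, hb1]; rfl), hp1, hb1] at h2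
  have h3 := congrArg (qbr (qvar ^ (0 : ℤ)) (e 0)) h1
  rw [qbr_add, qbr_smul, qbr_smul, qbr_add, qbr_smul,
    qbr_mul 0 (by simp) hne (by rw [hp0, hy0]; rfl),
    qbr_mul 0 (by simp) (by simp) (by rw [ha0, hb0]; rfl),
    qbr_mul 0 (by simp) (by simp) (by rw [ha0, hb0]; rfl),
    qbr_mul 0 hne (by simp) (by rw [hp0, hy0]; rfl), h00, h01, ← swap_D hS hne, hp0, ha0, hb0,
    hy0] at h3
  rw [zpow_neg] at h1 h2 h3
  exact ⟨fork_D hs h1 h2, act_D (zpow_ne_zero _ q0) hs h3⟩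

theorem pair_D_tail {j m : ℕ} (h1 : 1 ≤ j) (hj : j + 1 < m) : ∃ c : RatFunc ℚ,
    bracket (natForm .D) e (down (j + 1) 1 ++ 0 :: up 2 m) *
        bracket (natForm .D) e (down j 1 ++ 0 :: up 2 m) =
      c • (bracket (natForm .D) e (down j 1 ++ 0 :: up 2 m) *
        bracket (natForm .D) e (down (j + 1) 1 ++ 0 :: up 2 m)) := by
  have := tail_pair (m := m) (j₀ := 1) (fm := natForm .D) (e := e)
    (v := fun j => down j 1 ++ 0 :: up 2 m) (fun j => by simp)
    (fun j _ => by rw [down_succ (by omega)]; rfl)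
    (fun j h1 hj k hk hkj => zero_D_tail hS h1 hj hk hkj) (fun h1 => by
      rw [down_succ (by omega), down_self]
      exact ⟨_, chain_step (by simp) (pair_D_mid hS (by omega)).2
        (zero_D_zero hS (by omega) (by omega) (by omega))
        (zero_D_two hS (by omega) (by omega) (by omega))⟩) (j - 1)
  rw [Nat.add_sub_cancel' h1] at this
  exact this hj

end TypeD

end Types

end QLyndon

namespace QLyndon

/-! ### Combinatorics of blocks in irreducible Lyndon words -/

noncomputable section Blocks

variable {A : Type*} [Ring A] [Algebra (RatFunc ℚ) A] {e : ℕ → A}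

theorem exists_blocks {m : ℕ} (u : List ℕ) (hu : ∀ x ∈ u, x ≤ m) :
    ∃ bs : List (List ℕ), bs ≠ [] ∧ (∀ b ∈ bs, EndsWith m b) ∧ u ++ [m] = bs.flatten := by
  induction u with
  | nil => exact ⟨[[m]], by simp, by simpa using endsWith_singleton m, by simp⟩
  | cons k u ih =>
    obtain ⟨bs, hne, hbs, hf⟩ := ih fun x hx => hu x (List.mem_cons_of_mem _ hx)
    rcases lt_or_eq_of_le (hu k List.mem_cons_self) with hk | rfl
    · obtain ⟨b, bs', rfl⟩ := List.exists_cons_of_ne_nil hne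
      refine ⟨(k :: b) :: bs', by simp, ?_, ?_⟩
      · rintro x hx
        rcases List.mem_cons.1 hx with rfl | hx
        · exact (hbs b List.mem_cons_self).cons hk
        · exact hbs x (List.mem_cons_of_mem _ hx)
      · rw [List.cons_append, hf]
        simp
    · refine ⟨[k] :: bs, by simp, ?_, ?_⟩
      · rintro x hx
        rcases List.mem_cons.1 hx with rfl | hx
        · exact endsWith_singleton _
        · exact hbs x hx
      · rw [List.cons_append, hf]
        simp

/-- The left factor ending at a letter `x` is smaller than the whole word, and this comparison
starts with the last letters. -/
theorem IsLyndon.exists_last {I : Type*} [LinearOrder I] {w : List I} (h : IsLyndon w) :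
    ∃ u m, w = u ++ [m] ∧ ∀ x ∈ u, x ≤ m := by
  obtain ⟨hne, hp⟩ := h
  obtain ⟨u, m, rfl⟩ := List.eq_nil_or_concat w |>.resolve_left hne
  refine ⟨u, m, by simp, fun x hx => ?_⟩
  obtain ⟨s, t, rfl⟩ := List.append_of_mem hx
  have := hp (s ++ [x]) (by simp) ⟨t ++ [m], by simp⟩ (by simp)
  rw [List.concat_eq_append, wordLt_concat_iff] at this
  rcases this with h | h
  · exact h.le
  · exact h.1.le

/-- A chain of words ending in `m` contains all irreducible words ending in `m` if all the other
ways of continuing the chain are reducible. -/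
theorem mem_chain {m N : ℕ} {c : ℕ → List ℕ} (h0 : c 0 = [m])
    (hred : ∀ n ≤ N, ∀ k < m, (n < N → k :: c n ≠ c (n + 1)) → Reducible e (k :: c n))
    {w : List ℕ} (hw : EndsWith m w) (hr : ¬ Reducible e w) : ∃ n ≤ N, w = c n := by
  obtain ⟨u, rfl, hu⟩ := hw
  induction u with
  | nil => exact ⟨0, Nat.zero_le _, h0.symm⟩
  | cons k u ih =>
    obtain ⟨n, hn, hc⟩ := ih (fun x hx => hu x (List.mem_cons_of_mem _ hx))
      fun h => hr (h.of_infix ⟨[k], [], by simp⟩)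
    rw [List.cons_append, hc] at hr ⊢
    by_contra hcon
    push Not at hcon
    exact hr (hred n hn k (hu k List.mem_cons_self) fun hlt h => hcon (n + 1) hlt h)

theorem chain_suffix {N : ℕ} {c : ℕ → List ℕ} (hc : ∀ n < N, ∃ k, c (n + 1) = k :: c n) {a : ℕ}
    (d : ℕ) : a + d ≤ N → c a <:+ c (a + d) := by
  induction d with
  | zero => exact fun _ => List.suffix_rfl
  | succ d ih =>
    intro h
    obtain ⟨k, hk⟩ := hc (a + d) (by omega)
    rw [← add_assoc, hk]
    exact (ih (by omega)).trans (List.suffix_cons _ _)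

/-- The order on a chain is reversed, because a word is smaller than its proper right factors. -/
theorem chain_wordLt {N : ℕ} {c : ℕ → List ℕ} (hc : ∀ n < N, ∃ k, c (n + 1) = k :: c n)
    {a b : ℕ} (hab : a < b) (hb : b ≤ N) : wordLt (c b) (c a) := by
  obtain ⟨k, hk⟩ := hc a (by omega)
  obtain ⟨p, hp⟩ := chain_suffix hc (a := a + 1) (b - (a + 1)) (by omega)
  rw [show a + 1 + (b - (a + 1)) = b by omega, hk] at hp
  rw [← hp, List.append_cons]
  exact wordLt_of_suffix (by simp) _

/-- As `c d` is a right factor of `c b`, it suffices to treat consecutive blocks. -/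
theorem chain_reducible {N : ℕ} {c : ℕ → List ℕ} (hc : ∀ n < N, ∃ k, c (n + 1) = k :: c n)
    {a b d : ℕ} (h : Reducible e (c d ++ c a)) (hd : d ≤ b) (hb : b ≤ N) :
    Reducible e (c b ++ c a) := by
  obtain ⟨p, hp⟩ := chain_suffix hc (a := d) (b - d) (by omega)
  rw [Nat.add_sub_cancel' hd] at hp
  rw [← hp]
  exact h.of_infix ⟨p, [], by simp⟩

/-- In a sequence whose only descents are from `m` to `m - 1`, all members are at least the first
one, unless this is `m`. -/
theorem le_of_descent {m a : ℕ} (ha : a ≠ m) (l : List ℕ)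
    (h : ∀ x y, [x, y] <:+: l → x ≤ y ∨ x = m ∧ y + 1 = m) (hl : ∀ x ∈ l.head?, a ≤ x) :
    ∀ x ∈ l, a ≤ x := by
  induction l with
  | nil => simp
  | cons x l ih =>
    have hx : a ≤ x := hl x (by simp)
    intro y hy
    rcases List.mem_cons.1 hy with rfl | hy
    · exact hx
    · refine ih (fun z t hz => h z t (hz.trans (List.suffix_cons _ _).isInfix)) ?_ y hy
      intro z hz
      obtain ⟨l', rfl⟩ : ∃ l', l = z :: l' := by
        cases l with
        | nil => simp at hz
        | cons b l' => simp at hz; subst hz; exact ⟨_, rfl⟩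
      have := h x z ⟨[], l', by simp⟩
      omega

/-- The hypotheses force the sequence `m, m-1, m, m-1, …, m, m-1`. After the initial `m`, an entry
above `m` would prevent the sequence from ending below `m`; a second `m` would, by induction, be
followed by `m-1` and give `m, m, m-1`. So `m-1` follows, and then either the sequence stops or the
same argument shows that the next entry is `m`. -/
theorem alternating {m : ℕ} (n : ℕ) : ∀ l : List ℕ, l.length ≤ n →
    (∀ x y, [x, y] <:+: m :: l → x ≤ y ∨ x = m ∧ y + 1 = m) →
    (∀ y, y + 1 = m → ¬ [m, y, y] <:+: m :: l) → (∀ y, y + 1 = m → ¬ [m, m, y] <:+: m :: l) →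
    (∃ x, x < m ∧ [x] <:+ l) → ∃ y, y + 1 = m ∧ [m, y] <+: m :: l ∧ [m, y] <:+ m :: l := by
  induction n with
  | zero =>
    intro l hl _ _ _ ⟨x, _, hx⟩
    rw [List.length_eq_zero_iff.1 (Nat.le_zero.1 hl)] at hx
    simp at hx
  | succ n ih =>
    rintro l hl h h1 h2 ⟨x, hxm, hx⟩
    have htail : ∀ s t : List ℕ, s <:+ m :: l → (∀ x y, [x, y] <:+: s →
        x ≤ y ∨ x = m ∧ y + 1 = m) := fun s _ hs x y hi => h x y (hi.trans hs.isInfix)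
    cases l with
    | nil => simp at hx
    | cons b l =>
      have hb := h m b ⟨[], l, by simp⟩
      -- Once an entry exceeds `m`, all later ones are at least as large, but the last entry `x` is
      -- below `m`.
      have hge : ∀ c l', c :: l' <:+ m :: b :: l → m < c → ¬ x ∈ c :: l' := by
        intro c l' hs hc hmem
        have := le_of_descent hc.ne' (c :: l') (htail _ [] hs) (by simp) x hmem
        omega
      have hxb : x ∈ b :: l := hx.subset (by simp)
      rcases Nat.lt_trichotomy b m with hlt | rfl | hgt
      · have hbm : b + 1 = m := by omega
        cases l with
        | nil => exact ⟨b, hbm, by simp, by simp⟩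
        | cons c l =>
          have hc := h b c ⟨[m], l, by simp⟩
          have hcb : c ≠ b := by
            rintro rfl
            exact h1 c hbm ⟨[], l, by simp⟩
          have hxc : [x] <:+ c :: l := by
            rcases List.suffix_cons_iff.1 hx with h | h
            · simp at h
            · exact h
          rcases Nat.lt_trichotomy c m with h' | rfl | h'
          · omega
          · have hs : c :: l <:+ c :: b :: c :: l := ⟨[c, b], by simp⟩
            have hxl : [x] <:+ l := by
              rcases List.suffix_cons_iff.1 hxc with h | h
              · simp only [List.cons.injEq] at h; omega
              · exact h
            obtain ⟨y, hy, hp, hsuf⟩ := ih l (by simp at hl; omega) (htail _ [] hs)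
              (fun y hy hi => h1 y hy (hi.trans hs.isInfix))
              (fun y hy hi => h2 y hy (hi.trans hs.isInfix)) ⟨x, hxm, hxl⟩
            exact ⟨y, hy, ⟨c :: l, by simp; omega⟩, hsuf.trans hs⟩
          · exact absurd (hxc.subset (by simp)) (hge c l ⟨[m, b], by simp⟩ h')
      · have hs : b :: l <:+ b :: b :: l := ⟨[b], by simp⟩
        have hxl : [x] <:+ l := by
          rcases List.suffix_cons_iff.1 hx with h | h
          · simp only [List.cons.injEq] at h; omega
          · exact h
        obtain ⟨y, hy, ⟨t, ht⟩, -⟩ := ih l (by simp at hl; omega) (htail _ [] hs)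
          (fun y hy hi => h1 y hy (hi.trans hs.isInfix))
          (fun y hy hi => h2 y hy (hi.trans hs.isInfix)) ⟨x, hxm, hxl⟩
        exact absurd ⟨[], t, by rw [← ht]; simp⟩ (h2 y hy)
      · exact absurd hxb (hge b l ⟨[m], by simp⟩ hgt)

theorem flatten_infix {c : ℕ → List ℕ} {s l : List ℕ} (h : s <:+: l) :
    (s.map c).flatten <:+: (l.map c).flatten := by
  obtain ⟨u, v, rfl⟩ := h
  exact ⟨(u.map c).flatten, (v.map c).flatten, by simp⟩

/-- The indices of the blocks of an irreducible Lyndon word. -/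
theorem exists_indices {m N : ℕ} {c : ℕ → List ℕ}
    (h1 : ∀ w, EndsWith m w → ¬ Reducible e w → ∃ n ≤ N, w = c n)
    {u : List ℕ} (hu : ∀ x ∈ u, x ≤ m) (hr : ¬ Reducible e (u ++ [m])) :
    ∃ l : List ℕ, l ≠ [] ∧ (∀ n ∈ l, n ≤ N) ∧ u ++ [m] = (l.map c).flatten := by
  obtain ⟨bs, hne, hbs, hf⟩ := exists_blocks u hu
  have key : ∀ bs : List (List ℕ), (∀ b ∈ bs, EndsWith m b ∧ ¬ Reducible e b) →
      ∃ l : List ℕ, (∀ n ∈ l, n ≤ N) ∧ bs = l.map c := by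
    intro bs
    induction bs with
    | nil => exact fun _ => ⟨[], by simp, rfl⟩
    | cons b bs ih =>
      intro h
      obtain ⟨l, hl, hb⟩ := ih fun x hx => h x (List.mem_cons_of_mem _ hx)
      obtain ⟨n, hn, rfl⟩ := h1 b (h b List.mem_cons_self).1 (h b List.mem_cons_self).2
      refine ⟨n :: l, ?_, by rw [hb]; rfl⟩
      rintro x hx
      rcases List.mem_cons.1 hx with rfl | hx
      · exact hn
      · exact hl x hx
  obtain ⟨l, hl, rfl⟩ := key bs fun b hb => ⟨hbs b hb, fun h => hr <| by
    obtain ⟨s, t, rfl⟩ := List.append_of_mem hb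
    rw [hf]
    exact h.of_infix ⟨s.flatten, t.flatten, by simp⟩⟩
  exact ⟨l, by rintro rfl; simp at hne, hl, hf⟩

/-- The first block is a proper left factor, hence smaller than the Lyndon word, which in turn is
smaller than its right factor, the last block. -/
theorem first_lt_last {c : ℕ → List ℕ} (hne : ∀ n, c n ≠ []) {a b : ℕ} {l : List ℕ}
    (hL : IsLyndon ((a :: l).map c).flatten) (hb : [b] <:+ l) : wordLt (c a) (c b) := by
  obtain ⟨s, rfl⟩ := hb
  have h1 : wordLt (c a) ((a :: (s ++ [b])).map c).flatten := by
    refine hL.2 _ (hne a) ⟨((s ++ [b]).map c).flatten, by simp⟩ fun h => hne b ?_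
    simp only [List.map_cons, List.map_append, List.flatten_cons, List.flatten_append,
      List.map_nil, List.flatten_nil, List.append_nil] at h
    have h' := congrArg List.length h
    simp only [List.length_append] at h'
    exact List.length_eq_zero_iff.1 (by omega)
  refine h1.trans ?_
  have := wordLt_of_suffix (u := ((a :: s).map c).flatten) (by simp [hne a]) (c b)
  simpa using this

theorem wordLt_antitone {N : ℕ} {c : ℕ → List ℕ}
    (h3 : ∀ a b, a < b → b ≤ N → wordLt (c b) (c a)) {a b : ℕ} (hb : b ≤ N)
    (h : wordLt (c a) (c b)) : b < a := by
  rcases Nat.lt_trichotomy a b with h' | rfl | h'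
  · exact (h.asymm (h3 a b h' hb)).elim
  · exact absurd h (wordLt_irrefl _)
  · exact h'

theorem exists_getLast {l : List ℕ} (h : l ≠ []) : ∃ b, [b] <:+ l := by
  obtain ⟨s, b, rfl⟩ := (List.eq_nil_or_concat l).resolve_left h
  exact ⟨b, s, by simp⟩

/-- Irreducibility makes the block indices weakly increasing, while with two or more blocks the
Lyndon property makes the first index larger than the last. -/
theorem eq_of_isLyndon {m N : ℕ} {c : ℕ → List ℕ} (hne : ∀ n, c n ≠ [])
    (h1 : ∀ w, EndsWith m w → ¬ Reducible e w → ∃ n ≤ N, w = c n)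
    (h2 : ∀ a b, a < b → b ≤ N → Reducible e (c b ++ c a))
    (h3 : ∀ a b, a < b → b ≤ N → wordLt (c b) (c a))
    {u : List ℕ} (hu : ∀ x ∈ u, x ≤ m) (hr : ¬ Reducible e (u ++ [m]))
    (hL : IsLyndon (u ++ [m])) : ∃ n ≤ N, u ++ [m] = c n := by
  obtain ⟨l, hl, hN, hw⟩ := exists_indices h1 hu hr
  rw [hw] at hr hL ⊢
  obtain ⟨a, l, rfl⟩ := List.exists_cons_of_ne_nil hl
  by_cases hl' : l = []
  · subst hl'
    exact ⟨a, hN a (by simp), by simp⟩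
  obtain ⟨b, hb⟩ := exists_getLast hl'
  have hbl : b ∈ l := hb.subset (by simp)
  -- Smaller blocks have larger indices, so the last index is below the first.
  have hlt := wordLt_antitone h3 (hN b (by simp [hbl])) (first_lt_last hne hL hb)
  have := le_of_descent (m := a + 1) (a := a) (by omega) (a :: l) (fun x y hi => by
    by_contra! hcon
    have := h2 y x (by omega) (hN x (hi.subset (by simp)))
    exact hr (this.of_infix (by simpa using flatten_infix (c := c) hi))) (by simp) b (by simp [hbl])
  omega

/-- Version for type `C`, where the descent from index `m` to index `m - 1` is allowed. The letter
`m` also serves as an index because `c m` will be `[0,…,m]` and `c (m - 1)` will be `[1,…,m]`. -/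
theorem eq_of_isLyndon_of_exception {m N : ℕ} {c : ℕ → List ℕ} (hne : ∀ n, c n ≠ [])
    (h1 : ∀ w, EndsWith m w → ¬ Reducible e w → ∃ n ≤ N, w = c n)
    (h2 : ∀ a b, a < b → b ≤ N → ¬ (b = m ∧ a + 1 = m) → Reducible e (c b ++ c a))
    (h3 : ∀ a b, a < b → b ≤ N → wordLt (c b) (c a))
    (h4 : ∀ a, a + 1 = m → Reducible e (c m ++ c a ++ c a))
    (h5 : ∀ a, a + 1 = m → Reducible e (c m ++ c m ++ c a))
    {u : List ℕ} (hu : ∀ x ∈ u, x ≤ m) (hr : ¬ Reducible e (u ++ [m]))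
    (hL : IsLyndon (u ++ [m])) :
    (∃ n ≤ N, u ++ [m] = c n) ∨ ∃ a, a + 1 = m ∧ u ++ [m] = c m ++ c a := by
  obtain ⟨l, hl, hN, hw⟩ := exists_indices h1 hu hr
  rw [hw] at hr hL ⊢
  obtain ⟨a, l, rfl⟩ := List.exists_cons_of_ne_nil hl
  by_cases hl' : l = []
  · subst hl'
    exact Or.inl ⟨a, hN a (by simp), by simp⟩
  obtain ⟨b, hb⟩ := exists_getLast hl'
  have hbl : b ∈ l := hb.subset (by simp)
  have hlt := wordLt_antitone h3 (hN b (by simp [hbl])) (first_lt_last hne hL hb)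
  have hd : ∀ x y, [x, y] <:+: a :: l → x ≤ y ∨ x = m ∧ y + 1 = m := fun x y hi => by
    by_contra! hcon
    have := h2 y x (by omega) (hN x (hi.subset (by simp))) (by omega)
    exact hr (this.of_infix (by simpa using flatten_infix (c := c) hi))
  obtain rfl : a = m := by
    by_contra ham
    have := le_of_descent ham (a :: l) hd (by simp) b (by simp [hbl])
    omega
  obtain ⟨y, hy, ⟨t, ht⟩, ⟨s, hs⟩⟩ := alternating l.length l le_rfl hd
    (fun y hy hi => hr ((h4 y hy).of_infix (by simpa using flatten_infix (c := c) hi)))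
    (fun y hy hi => hr ((h5 y hy).of_infix (by simpa using flatten_infix (c := c) hi)))
    ⟨b, hlt, hb⟩
  rcases eq_or_ne t [] with rfl | hne'
  · exact Or.inr ⟨y, hy, by rw [← ht]; simp⟩
  -- Several repetitions are impossible: the same word `c m ++ c y` would be a proper left factor
  -- and a proper right factor, hence both smaller and larger than the Lyndon word.
  exfalso
  have hs' : s ≠ [] := by
    rintro rfl
    rw [← ht] at hs
    simp at hs
    exact hne' hs
  have hflat : ∀ t : List ℕ, t ≠ [] → (t.map c).flatten ≠ [] := by
    intro t ht
    obtain ⟨x, t, rfl⟩ := List.exists_cons_of_ne_nil ht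
    simp [hne x]
  refine wordLt_irrefl (([a, y].map c).flatten)
    ((hL.2 _ (hflat _ (by simp)) ⟨(t.map c).flatten, by rw [← ht]; simp⟩ fun h => ?_).trans ?_)
  · rw [← ht, List.map_append, List.flatten_append] at h
    exact hflat t hne' (by simpa using h)
  · rw [← hs, List.map_append, List.flatten_append]
    exact wordLt_of_suffix (hflat s hs') _

end Blocks

end QLyndon

namespace QLyndon

/-! ### Upper bound: the irreducible Lyndon words of each type -/

noncomputable section UpperBound

variable {A : Type*} [Ring A] [Algebra (RatFunc ℚ) A] {e : ℕ → A}

theorem up_pred {n m : ℕ} (h : n < m) : up (m - (n + 1)) m = (m - (n + 1)) :: up (m - n) m := by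
  rw [up_cons (by omega), show m - (n + 1) + 1 = m - n by omega]

theorem isLyndon_reducible_A (hS : SerreRel (natForm .A) e) {u : List ℕ} {m : ℕ}
    (hu : ∀ x ∈ u, x ≤ m) (hr : ¬ Reducible e (u ++ [m])) (hL : IsLyndon (u ++ [m])) :
    ∃ i ≤ m, u ++ [m] = up i m := by
  set c : ℕ → List ℕ := fun n => up (m - n) m with hc
  have hstep : ∀ n < m, ∃ k, c (n + 1) = k :: c n := fun n hn => ⟨_, up_pred hn⟩
  have h1 : ∀ w, EndsWith m w → ¬ Reducible e w → ∃ n ≤ m, w = c n := fun w hw hr =>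
    mem_chain (e := e) (c := c) (by simp [hc, up_self]) (fun n hn k hk hk' =>
      (endsWith_up (Nat.sub_le m n)).reducible_cons hk
        (chainForm_A.bracket_up_eq_zero hS (Nat.zero_le _) (Nat.sub_le m n) (Nat.zero_le _) hk
          fun h => by
            refine hk' (by omega) ?_
            simp only [hc]
            rw [up_pred (by omega), show m - (n + 1) = k by omega])) hw hr
  have h2 : ∀ a b, a < b → b ≤ m → Reducible e (c b ++ c a) := fun a b hab hb => by
    refine chain_reducible hstep (d := a + 1) ?_ hab hb
    have h := chainForm_A.pair_up hS (i := m - (a + 1)) (m := m) (Nat.zero_le _) (by omega)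
    simp only [hc]
    rw [show m - (a + 1) + 1 = m - a by omega, up_pred (by omega)] at h
    rw [up_pred (by omega)]
    exact (endsWith_up (Nat.sub_le m a)).reducible_pair (by omega) h
  obtain ⟨n, -, hn⟩ := eq_of_isLyndon (fun n => up_ne_nil (Nat.sub_le m n)) h1 h2
    (fun a b => chain_wordLt hstep) hu hr hL
  exact ⟨_, Nat.sub_le m n, hn⟩

theorem endsWith_down_append {i j m : ℕ} {w : List ℕ} (h : EndsWith m w) (hj : j < m) :
    EndsWith m (down j i ++ w) :=
  h.append fun k hk => by have := mem_down.1 hk; omega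

theorem isLyndon_reducible_B (hS : SerreRel (natForm .B) e) {u : List ℕ} {m : ℕ}
    (hu : ∀ x ∈ u, x ≤ m) (hr : ¬ Reducible e (u ++ [m])) (hL : IsLyndon (u ++ [m])) :
    (∃ i ≤ m, u ++ [m] = up i m) ∨ ∃ j < m, u ++ [m] = down j 0 ++ up 0 m := by
  -- The block list goes down `[m], …, [0,…,m]` at the indices `0, …, m`, then prepends `0`, `1`, …,
  -- `m - 1` at the indices `m + 1, …, 2m`.
  set c : ℕ → List ℕ := fun n => if n ≤ m then up (m - n) m else down (n - m - 1) 0 ++ up 0 m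
    with hc
  have c1 : ∀ n, n ≤ m → c n = up (m - n) m := fun n hn => by simp only [hc, if_pos hn]
  have c2 : ∀ j, c (m + 1 + j) = down j 0 ++ up 0 m := fun j => by
    simp only [hc]
    rw [if_neg (by omega), show m + 1 + j - m - 1 = j by omega]
  have s1 : ∀ n < m, c (n + 1) = (m - (n + 1)) :: c n := fun n hn => by
    rw [c1 _ hn, c1 _ hn.le, up_pred hn]
  have s2 : c (m + 1) = 0 :: c m := by
    rw [c1 m le_rfl, ← add_zero (m + 1), c2, down_self, Nat.sub_self]
    rfl
  have s3 : ∀ j, c (m + 1 + j + 1) = (j + 1) :: c (m + 1 + j) := fun j => by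
    rw [c2, add_assoc, c2, down_succ (by omega)]
    rfl
  have hcase : ∀ n ≤ 2 * m, n < m ∨ n = m ∨ ∃ j < m, n = m + 1 + j := fun n hn => by
    rcases Nat.lt_trichotomy n m with h | h | h
    · exact Or.inl h
    · exact Or.inr (Or.inl h)
    · exact Or.inr (Or.inr ⟨n - m - 1, by omega, by omega⟩)
  have hend : ∀ n ≤ 2 * m, EndsWith m (c n) := fun n hn => by
    rcases hcase n hn with h | rfl | ⟨j, hj, rfl⟩
    · rw [c1 n h.le]; exact endsWith_up (Nat.sub_le m n)
    · rw [c1 _ le_rfl]; exact endsWith_up (Nat.sub_le _ _)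
    · rw [c2]; exact endsWith_down_append (endsWith_up (Nat.zero_le m)) hj
  have hstep : ∀ n < 2 * m, ∃ k, c (n + 1) = k :: c n := fun n hn => by
    rcases hcase n hn.le with h | rfl | ⟨j, hj, rfl⟩
    · exact ⟨_, s1 n h⟩
    · exact ⟨_, s2⟩
    · exact ⟨_, s3 j⟩
  have h1 : ∀ w, EndsWith m w → ¬ Reducible e w → ∃ n ≤ 2 * m, w = c n := by
    refine fun w hw hr => mem_chain (e := e) (c := c) (by simp [hc, up_self])
      (fun n hn k hk hk' => (hend n hn).reducible_cons (fm := natForm .B) hk ?_) hw hr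
    rcases hcase n hn with h | rfl | ⟨j, hj, rfl⟩
    · rw [c1 n h.le]
      refine zero_B_up hS (by omega) (Nat.sub_le _ _) hk fun hkn => hk' (by omega) ?_
      rw [s1 n h, show m - (n + 1) = k by omega]
    · rw [c1 _ le_rfl, Nat.sub_self]
      refine zero_B_up_zero hS ?_ hk
      by_contra hk0
      exact hk' (by omega) (by rw [s2, show k = 0 by omega])
    · rw [c2]
      refine zero_B_tail hS hj hk fun hkj => hk' (by omega) ?_
      rw [s3, hkj]
  have h2 : ∀ a b, a < b → b ≤ 2 * m → Reducible e (c b ++ c a) := fun a b hab hb => by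
    refine chain_reducible hstep (d := a + 1) ?_ hab hb
    rcases hcase a (by omega) with h | rfl | ⟨j, hj, rfl⟩
    · have hp := pair_B_up hS (i := m - (a + 1)) (m := m) (by omega)
      rw [show m - (a + 1) + 1 = m - a by omega, ← c1 _ h.le, ← c1 _ h, s1 a h] at hp
      rw [s1 a h]
      exact (hend a (by omega)).reducible_pair (by omega) hp
    · have hp := pair_B_mid hS (m := a) (by omega)
      rw [s2]
      rw [← Nat.sub_self a, ← c1 _ le_rfl, Nat.sub_self] at hp
      exact (hend a (by omega)).reducible_pair (by omega) hp
    · obtain ⟨_, hp⟩ := pair_B_tail hS (m := m) (j := j) (by omega)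
      rw [← c2, ← c2, ← add_assoc, s3] at hp
      rw [s3]
      exact (hend _ (by omega)).reducible_pair (by omega) hp
  have hne : ∀ n, c n ≠ [] := fun n => by
    simp only [hc]
    split_ifs
    · exact up_ne_nil (Nat.sub_le m n)
    · exact List.append_ne_nil_of_right_ne_nil _ (up_ne_nil (Nat.zero_le m))
  obtain ⟨n, hN, hn⟩ := eq_of_isLyndon hne h1 h2 (fun a b => chain_wordLt hstep) hu hr hL
  rcases hcase n hN with h | rfl | ⟨j, hj, rfl⟩
  · exact Or.inl ⟨m - n, Nat.sub_le _ _, by rw [hn, c1 n h.le]⟩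
  · exact Or.inl ⟨0, Nat.zero_le _, by rw [hn, c1 _ le_rfl, Nat.sub_self]⟩
  · exact Or.inr ⟨j, hj, by rw [hn, c2]⟩

theorem isLyndon_reducible_C (hS : SerreRel (natForm .C) e) {u : List ℕ} {m : ℕ}
    (hu : ∀ x ∈ u, x ≤ m) (hr : ¬ Reducible e (u ++ [m])) (hL : IsLyndon (u ++ [m])) :
    (∃ i ≤ m, u ++ [m] = up i m) ∨ (∃ j < m, 1 ≤ j ∧ u ++ [m] = down j 1 ++ up 0 m) ∨
      (1 ≤ m ∧ u ++ [m] = up 0 m ++ up 1 m) := by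
  -- Unlike in type `B`, the letter `0` is not repeated: after `[0,…,m]` at index `m` the letters
  -- `1, …, m - 1` are prepended, up to index `2m - 1`.
  set c : ℕ → List ℕ := fun n => if n ≤ m then up (m - n) m else down (n - m) 1 ++ up 0 m
    with hc
  have c1 : ∀ n, n ≤ m → c n = up (m - n) m := fun n hn => by simp only [hc, if_pos hn]
  have c2 : ∀ j, c (m + j) = down j 1 ++ up 0 m := fun j => by
    rcases Nat.eq_zero_or_pos j with rfl | hj
    · rw [add_zero, c1 m le_rfl, Nat.sub_self]; rfl
    · simp only [hc]
      rw [if_neg (by omega), show m + j - m = j by omega]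
  have s1 : ∀ n < m, c (n + 1) = (m - (n + 1)) :: c n := fun n hn => by
    rw [c1 _ hn, c1 _ hn.le, up_pred hn]
  have s3 : ∀ j, c (m + j + 1) = (j + 1) :: c (m + j) := fun j => by
    rw [c2, add_assoc, c2, down_succ (by omega)]
    rfl
  -- For `m = 0` truncated subtraction gives the bound `0`, so index `m` itself still occurs; this
  -- is the extra alternative `j = 0`.
  have hcase : ∀ n ≤ 2 * m - 1, n < m ∨ ∃ j, (j < m ∨ m = 0 ∧ j = 0) ∧ n = m + j :=
    fun n hn => by
      rcases Nat.lt_or_ge n m with h | h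
      · exact Or.inl h
      · exact Or.inr ⟨n - m, by omega, by omega⟩
  have hend : ∀ n ≤ 2 * m - 1, EndsWith m (c n) := fun n hn => by
    rcases hcase n hn with h | ⟨j, hj | ⟨hm, rfl⟩, rfl⟩
    · rw [c1 n h.le]; exact endsWith_up (Nat.sub_le m n)
    · rw [c2]; exact endsWith_down_append (endsWith_up (Nat.zero_le m)) hj
    · rw [c1 _ le_rfl]; exact endsWith_up (Nat.sub_le _ _)
  have hstep : ∀ n < 2 * m - 1, ∃ k, c (n + 1) = k :: c n := fun n hn => by
    rcases hcase n hn.le with h | ⟨j, hj, rfl⟩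
    · exact ⟨_, s1 n h⟩
    · exact ⟨_, s3 j⟩
  have h1 : ∀ w, EndsWith m w → ¬ Reducible e w → ∃ n ≤ 2 * m - 1, w = c n := by
    refine fun w hw hr => mem_chain (e := e) (c := c) (by simp [hc, up_self])
      (fun n hn k hk hk' => (hend n hn).reducible_cons (fm := natForm .C) hk ?_) hw hr
    rcases hcase n hn with h | ⟨j, hj, rfl⟩
    · rw [c1 n h.le]
      refine zero_C_up hS (by omega) (Nat.sub_le _ _) hk fun hkn => hk' (by omega) ?_
      rw [s1 n h, show m - (n + 1) = k by omega]
    · rw [c2]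
      refine zero_C_tail hS (by omega) hk fun hkj => hk' (by omega) ?_
      rw [s3, hkj]
  have h2 : ∀ a b, a < b → b ≤ 2 * m - 1 → ¬ (b = m ∧ a + 1 = m) → Reducible e (c b ++ c a) :=
    fun a b hab hb hex => by
    rcases hcase a (by omega) with h | ⟨j, hj, rfl⟩
    · rcases Nat.lt_or_ge (a + 1) m with h' | h'
      · refine chain_reducible hstep (d := a + 1) ?_ hab hb
        have hp := pair_C_up hS (i := m - (a + 1)) (m := m) (by omega) (by omega)
        rw [show m - (a + 1) + 1 = m - a by omega, ← c1 _ h.le, ← c1 _ h, s1 a h] at hp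
        rw [s1 a h]
        exact (hend a (by omega)).reducible_pair (by omega) hp
      -- Since `c m ++ c (m - 1)` is the exception, the argument starts from `c (m + 1) ++ c (m -
      -- 1)`, by the relation `w z = q z w`. Here the blocks differ by two letters, so the leading
      -- words are compared directly.
      · refine chain_reducible hstep (d := m + 1) ?_ (by omega) hb
        have hma : a + 1 = m := by omega
        have hp := (pair_C_mid hS (m := m) (by omega)).1
        have e0 : c m = up 0 m := by rw [c1 m le_rfl, Nat.sub_self]
        have e1 : c a = up 1 m := by rw [c1 a (by omega), show m - a = 1 by omega]
        have e2 : c (m + 1) = 1 :: up 0 m := by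
          rw [← e0]
          exact s3 0
        have hE0 := hend m (by omega)
        have hE1 := hend a (by omega)
        have hy : up 0 m = 0 :: up 1 m := up_cons (Nat.zero_le m)
        rw [e0] at hE0
        rw [e1] at hE1
        rw [e1, e2]
        have l0 := (hE0.cons (k := 1) (by omega)).hasLead (fm := natForm .C) (e := e)
        have l1 := hE1.hasLead (fm := natForm .C) (e := e)
        refine (l0.mul l1).reducible ?_
        rw [hp]
        refine Submodule.smul_mem _ _ ((l1.mul l0).mem_lower (by simp; omega) ?_)
        obtain ⟨v, hv, hv'⟩ := hE1
        have key : wordLt (v ++ [m] ++ [1, 0]) (1 :: 0 :: (v ++ [m])) := by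
          have : wordLt (v ++ [m] ++ [1] ++ [0]) ((1 :: 0 :: v) ++ [m]) := by
            rw [wordLt_concat_iff]
            exact Or.inl (by omega)
          simpa using this
        rw [hy, hv]
        simpa using wordLt_append_right key (v ++ [m])
    · refine chain_reducible hstep (d := m + j + 1) ?_ hab hb
      obtain ⟨_, hp⟩ := pair_C_tail hS (m := m) (j := j) (by omega)
      rw [← c2, ← c2, ← add_assoc, s3] at hp
      rw [s3]
      exact (hend _ (by omega)).reducible_pair (by omega) hp
  have hne : ∀ n, c n ≠ [] := fun n => by
    simp only [hc]
    split_ifs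
    · exact up_ne_nil (Nat.sub_le m n)
    · exact List.append_ne_nil_of_right_ne_nil _ (up_ne_nil (Nat.zero_le m))
  have hyz : ∀ a, a + 1 = m → c a = up 1 m ∧ c m = up 0 m ∧ EndsWith m (up 1 m) ∧
      EndsWith m (up 0 m) ∧ wordLt (up 1 m ++ up 0 m) (up 0 m ++ up 1 m) := fun a ha => by
    have hz : EndsWith m (up 1 m) := endsWith_up (by omega)
    refine ⟨by rw [c1 a (by omega), show m - a = 1 by omega], by rw [c1 m le_rfl, Nat.sub_self],
      hz, endsWith_up (by omega), ?_⟩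
    rw [up_cons (Nat.zero_le m), zero_add]
    exact hz.wordLt (by omega) _
  have h4 : ∀ a, a + 1 = m → Reducible e (c m ++ c a ++ c a) := fun a ha => by
    obtain ⟨e1, e0, hz, hy, hlt⟩ := hyz a ha
    obtain ⟨s, t, hst, -⟩ := triple_C hS (m := m) (by omega) rfl rfl
    rw [e1, e0]
    have lz := hz.hasLead (fm := natForm .C) (e := e)
    have ly := hy.hasLead (fm := natForm .C) (e := e)
    refine ((ly.mul lz).mul lz).reducible ?_
    rw [hst]
    have l1 := wordLt_append_right hlt (up 1 m)
    refine Submodule.add_mem _ (Submodule.smul_mem _ _ (((lz.mul ly).mul lz).mem_lower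
      (by simp; omega) l1)) (Submodule.smul_mem _ _ (((lz.mul lz).mul ly).mem_lower
      (by simp; omega) ?_))
    have l2 := wordLt_append_left _ rfl (by simp; omega) hlt (up 1 m)
    rw [← List.append_assoc, ← List.append_assoc] at l2
    exact l2.trans l1
  have h5 : ∀ a, a + 1 = m → Reducible e (c m ++ c m ++ c a) := fun a ha => by
    obtain ⟨e1, e0, hz, hy, hlt⟩ := hyz a ha
    obtain ⟨s, t, -, hst⟩ := triple_C hS (m := m) (by omega) rfl rfl
    rw [e1, e0]
    have lz := hz.hasLead (fm := natForm .C) (e := e)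
    have ly := hy.hasLead (fm := natForm .C) (e := e)
    refine ((ly.mul ly).mul lz).reducible ?_
    rw [hst]
    have l1 := wordLt_append_left _ rfl (by simp; omega) hlt (up 0 m)
    rw [← List.append_assoc, ← List.append_assoc] at l1
    refine Submodule.add_mem _ (Submodule.smul_mem _ _ (((ly.mul lz).mul ly).mem_lower
      (by simp; omega) l1)) (Submodule.smul_mem _ _ (((lz.mul ly).mul ly).mem_lower
      (by simp; omega) ?_))
    exact (wordLt_append_right hlt (up 0 m)).trans l1
  rcases eq_of_isLyndon_of_exception hne h1 h2 (fun a b => chain_wordLt hstep) h4 h5 hu hr hL with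
    ⟨n, hN, hn⟩ | ⟨a, ha, hw⟩
  · rcases hcase n hN with h | ⟨j, hj, rfl⟩
    · exact Or.inl ⟨m - n, Nat.sub_le _ _, by rw [hn, c1 n h.le]⟩
    · rcases Nat.eq_zero_or_pos j with rfl | hj0
      · exact Or.inl ⟨0, Nat.zero_le _, by rw [hn, add_zero, c1 _ le_rfl, Nat.sub_self]⟩
      · exact Or.inr (Or.inl ⟨j, by omega, hj0, by rw [hn, c2]⟩)
  · obtain ⟨e1, e0, -⟩ := hyz a ha
    exact Or.inr (Or.inr ⟨by omega, by rw [hw, e0, e1]⟩)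

theorem isLyndon_reducible_D_of_le {u : List ℕ} {m : ℕ} (hm : 2 ≤ m) (hS : SerreRel (natForm .D) e)
    (hu : ∀ x ∈ u, x ≤ m) (hr : ¬ Reducible e (u ++ [m])) (hL : IsLyndon (u ++ [m])) :
    (∃ i ≤ m, 1 ≤ i ∧ u ++ [m] = up i m) ∨ u ++ [m] = 0 :: up 2 m ∨
      ∃ j < m, 1 ≤ j ∧ u ++ [m] = down j 1 ++ 0 :: up 2 m := by
  -- The list is not a chain: `c (m - 1) = [1,…,m]` and `c m = [0,2,…,m]` both extend `c (m - 2) =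
  -- [2,…,m]` by one letter, and the list continues from `c m`.
  set c : ℕ → List ℕ := fun n => if n < m then up (m - n) m else down (n - m) 1 ++ 0 :: up 2 m
    with hc
  have c1 : ∀ n, n < m → c n = up (m - n) m := fun n hn => by simp only [hc, if_pos hn]
  have c2 : ∀ j, c (m + j) = down j 1 ++ 0 :: up 2 m := fun j => by
    simp only [hc]
    rw [if_neg (by omega), show m + j - m = j by omega]
  have c3 : c m = 0 :: up 2 m := c2 0
  have s1 : ∀ n, n + 1 < m → c (n + 1) = (m - (n + 1)) :: c n := fun n hn => by
    rw [c1 _ hn, c1 _ (by omega), up_pred (by omega)]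
  have s2 : ∀ n, n + 2 = m → c m = 0 :: c n := fun n hn => by
    rw [c3, c1 _ (by omega), show m - n = 2 by omega]
  have s3 : ∀ j, c (m + j + 1) = (j + 1) :: c (m + j) := fun j => by
    rw [c2, add_assoc, c2, down_succ (by omega)]
    rfl
  have hcase : ∀ n ≤ 2 * m - 1, n < m ∨ ∃ j < m, n = m + j := fun n hn => by
    rcases Nat.lt_or_ge n m with h | h
    · exact Or.inl h
    · exact Or.inr ⟨n - m, by omega, by omega⟩
  have hend : ∀ n ≤ 2 * m - 1, EndsWith m (c n) := fun n hn => by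
    rcases hcase n hn with h | ⟨j, hj, rfl⟩
    · rw [c1 n h]; exact endsWith_up (Nat.sub_le m n)
    · rw [c2]; exact endsWith_down_append ((endsWith_up hm).cons (by omega)) hj
  have hne : ∀ n, c n ≠ [] := fun n => by
    simp only [hc]
    split_ifs
    · exact up_ne_nil (Nat.sub_le m n)
    · simp
  have ht1 : ∀ n < m - 1, ∃ k, c (n + 1) = k :: c n := fun n hn => ⟨_, s1 n (by omega)⟩
  have ht2 : ∀ j < m, ∃ k, c (m + (j + 1)) = k :: c (m + j) := fun j _ => ⟨_, s3 j⟩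
  -- Leaving out the side branch `[1,…,m]` gives a genuine chain, to which the suffix arguments
  -- apply.
  set d : ℕ → List ℕ := fun n => if n + 1 < m then c n else c (n + 1) with hd
  have d1 : ∀ n, n + 1 < m → d n = c n := fun n hn => by simp only [hd, if_pos hn]
  have d2 : ∀ n, m ≤ n + 1 → d n = c (n + 1) := fun n hn => by
    simp only [hd, if_neg (not_lt.2 hn)]
  have hdcase : ∀ n, n + 2 < m ∨ n + 2 = m ∨ ∃ j, n + 1 = m + j := fun n => by
    rcases Nat.lt_trichotomy (n + 2) m with h | h | h
    · exact Or.inl h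
    · exact Or.inr (Or.inl h)
    · exact Or.inr (Or.inr ⟨n + 1 - m, by omega⟩)
  have ht3 : ∀ n < 2 * m - 2, ∃ k, d (n + 1) = k :: d n := fun n hn => by
    rcases hdcase n with h | h | ⟨j, hj⟩
    · rw [d1 _ (by omega), d1 _ (by omega)]
      exact ⟨_, s1 n (by omega)⟩
    · rw [d2 _ (by omega), d1 _ (by omega)]
      exact ⟨_, by rw [h]; exact s2 n h⟩
    · rw [d2 _ (by omega), d2 _ (by omega), hj]
      exact ⟨_, s3 j⟩
  have h1 : ∀ w, EndsWith m w → ¬ Reducible e w → ∃ n ≤ 2 * m - 1, w = c n := by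
    rintro w ⟨u, rfl, hu⟩ hr
    induction u with
    | nil => exact ⟨0, Nat.zero_le _, by rw [c1 0 (by omega), Nat.sub_zero, up_self]; rfl⟩
    | cons k u ih =>
      obtain ⟨n, hn, hcn⟩ := ih (fun x hx => hu x (List.mem_cons_of_mem _ hx))
        fun h => hr (h.of_infix ⟨[k], [], by simp⟩)
      have hk := hu k List.mem_cons_self
      rw [List.cons_append, hcn] at hr ⊢
      have h0 : bracket (natForm .D) e (k :: c n) ≠ 0 := fun h => hr ((hend n hn).reducible_cons hk h)
      rcases hcase n hn with h | ⟨j, hj, rfl⟩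
      · rw [c1 n h] at h0
        rcases Nat.eq_zero_or_pos k with rfl | hk0
        · rcases Nat.lt_trichotomy (n + 2) m with h' | h' | h'
          · exact absurd (zero_D_up_zero hS (by omega) (Nat.sub_le _ _)) h0
          · exact ⟨m, by omega, (s2 n h').symm⟩
          -- The bracket of `[0,1,2,…,m]` equals that of `[1,0,2,…,m]` and is not used here; the
          -- word is reducible because it contains `[0,1]`.
          · refine absurd ((reducible_D_zero_one hS).of_infix ⟨[], up 2 m, ?_⟩) hr
            rw [c1 n h, show m - n = 1 by omega, up_cons (i := 1) (by omega)]
            rfl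
        · by_cases hkn : k + 1 = m - n
          · exact ⟨n + 1, by omega, by rw [s1 n (by omega), show m - (n + 1) = k by omega]⟩
          · exact absurd (zero_D_up hS (by omega) (Nat.sub_le _ _) hk0 hk hkn) h0
      · by_cases hkj : k = j + 1
        · exact ⟨m + j + 1, by omega, by rw [s3, hkj]⟩
        · rw [c2] at h0
          rcases Nat.eq_zero_or_pos j with rfl | hj0
          · exact absurd (zero_D_zero hS hm hk (by omega)) h0
          · exact absurd (zero_D_tail hS hj0 hj hk hkj) h0
  have hmid : ∀ a, a + 1 = m → ∀ j, m + j ≤ 2 * m - 1 → ∃ p, c (m + j) = p ++ c m := fun a ha j hj => by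
    obtain ⟨p, hp⟩ := chain_suffix (c := fun j => c (m + j)) (N := m) ht2 (a := 0) j (by omega)
    rw [zero_add] at hp
    exact ⟨p, hp.symm⟩
  have hlt : ∀ p, wordLt (p ++ 0 :: up 2 m) (1 :: up 2 m) := fun p => by
    have : wordLt (p ++ [0]) [1] := by
      have := (wordLt_concat_iff p [] 0 1).2 (Or.inl (by omega))
      exact this
    simpa using wordLt_append_right this (up 2 m)
  have hr2 : ∀ a, a + 1 = m → c a = 1 :: up 2 m := fun a ha => by
    rw [c1 a (by omega), show m - a = 1 by omega, up_cons (by omega)]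
  have h3 : ∀ a b, a < b → b ≤ 2 * m - 1 → wordLt (c b) (c a) := fun a b hab hb => by
    rcases Nat.lt_or_ge b m with hbm | hbm
    · exact chain_wordLt ht1 hab (by omega)
    obtain ⟨j, rfl⟩ := Nat.exists_eq_add_of_le hbm
    rcases Nat.lt_trichotomy (a + 1) m with ham | ham | ham
    · have := chain_wordLt (N := 2 * m - 2) ht3 (a := a) (b := m + j - 1) (by omega) (by omega)
      rwa [d1 _ ham, d2 _ (by omega), Nat.sub_add_cancel (by omega)] at this
    · obtain ⟨p, hp⟩ := hmid a ham j hb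
      rw [hp, c3, hr2 a ham]
      exact hlt p
    · have := chain_wordLt (N := 2 * m - 2) ht3 (a := a - 1) (b := m + j - 1) (by omega) (by omega)
      rwa [d2 _ (by omega), d2 _ (by omega), Nat.sub_add_cancel (by omega),
        Nat.sub_add_cancel (by omega)] at this
  have hp1 : ∀ a, a + 1 < m → Reducible e (c (a + 1) ++ c a) := fun a ha => by
    have hp := pair_D_up hS (i := m - (a + 1)) (m := m) (by omega) (by omega)
    rw [show m - (a + 1) + 1 = m - a by omega, ← c1 _ (by omega), ← c1 _ (by omega), s1 a ha] at hp
    rw [s1 a ha]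
    exact (hend a (by omega)).reducible_pair (by omega) hp
  have hp2 : ∀ n < 2 * m - 2, Reducible e (d (n + 1) ++ d n) := fun n hn => by
    rcases hdcase n with h | h | ⟨j, hj⟩
    · rw [d1 _ (by omega), d1 _ (by omega)]
      exact hp1 n (by omega)
    · have hp := pair_D_zero hS hm
      have hcn : c n = up 2 m := by rw [c1 _ (by omega), show m - n = 2 by omega]
      rw [d2 _ (by omega), d1 _ (by omega), h, s2 n h]
      rw [← hcn] at hp
      exact (hend n (by omega)).reducible_pair (by omega) hp
    · rw [d2 _ (by omega), d2 _ (by omega), hj, s3]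
      obtain ⟨t, hp⟩ : ∃ t : RatFunc ℚ,
          bracket (natForm .D) e (c (m + (j + 1))) * bracket (natForm .D) e (c (m + j)) =
          t • (bracket (natForm .D) e (c (m + j)) * bracket (natForm .D) e (c (m + (j + 1)))) := by
        rw [c2, c2]
        rcases Nat.eq_zero_or_pos j with rfl | hj0
        · rw [zero_add, down_self]
          exact ⟨_, (pair_D_mid hS hm).2⟩
        · exact pair_D_tail hS hj0 (by omega)
      rw [← add_assoc, s3] at hp
      exact (hend _ (by omega)).reducible_pair (by omega) hp
  have h2 : ∀ a b, a < b → b ≤ 2 * m - 1 → Reducible e (c b ++ c a) := fun a b hab hb => by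
    rcases Nat.lt_or_ge b m with hbm | hbm
    · exact chain_reducible (N := m - 1) ht1 (hp1 a (by omega)) hab (by omega)
    obtain ⟨j, rfl⟩ := Nat.exists_eq_add_of_le hbm
    rcases Nat.lt_trichotomy (a + 1) m with ham | ham | ham
    · have := chain_reducible (N := 2 * m - 2) ht3 (hp2 a (by omega)) (b := m + j - 1) (by omega)
        (by omega)
      rwa [d1 _ ham, d2 _ (by omega), Nat.sub_add_cancel (by omega)] at this
    · obtain ⟨p, hp⟩ := hmid a ham j hb
      -- The two branches of the fork: their brackets commute, and the order of the leading words is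
      -- decided by `0 < 1`.
      have key : Reducible e (c m ++ c a) := by
        have hE0 := (hend m (by omega)).hasLead (fm := natForm .D) (e := e)
        have hE1 := (hend a (by omega)).hasLead (fm := natForm .D) (e := e)
        refine (hE0.mul hE1).reducible ?_
        have hpm := (pair_D_mid hS hm).1
        rw [show up 1 m = c a by rw [hr2 a ham, up_cons (by omega)], ← c3] at hpm
        rw [hpm]
        refine (hE1.mul hE0).mem_lower (by simp; omega) ?_
        obtain ⟨v, hv⟩ : ∃ v, up 2 m = v ++ [m] := by
          obtain ⟨v, hv, -⟩ := endsWith_up hm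
          exact ⟨v, hv⟩
        rw [hr2 a ham, c3]
        have hk : wordLt ((1 :: up 2 m) ++ [0]) ((0 :: up 2 m) ++ [1]) :=
          (wordLt_concat_iff _ _ 0 1).2 (Or.inl (by omega))
        simpa using wordLt_append_right hk (up 2 m)
      rw [hp]
      exact key.of_infix ⟨p, [], by simp⟩
    · have := chain_reducible (N := 2 * m - 2) ht3 (hp2 (a - 1) (by omega)) (b := m + j - 1)
        (by omega) (by omega)
      rwa [d2 _ (by omega), d2 _ (by omega), Nat.sub_add_cancel (by omega),
        Nat.sub_add_cancel (by omega)] at this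
  obtain ⟨n, hN, hn⟩ := eq_of_isLyndon hne h1 h2 h3 hu hr hL
  rcases hcase n hN with h | ⟨j, hj, rfl⟩
  · exact Or.inl ⟨m - n, Nat.sub_le _ _, by omega, by rw [hn, c1 n h]⟩
  · rcases Nat.eq_zero_or_pos j with rfl | hj0
    · exact Or.inr (Or.inl (by rw [hn, c2]; rfl))
    · exact Or.inr (Or.inr ⟨j, hj, hj0, by rw [hn, c2]⟩)

theorem isLyndon_reducible_D (hS : SerreRel (natForm .D) e) {u : List ℕ} {m : ℕ}
    (hu : ∀ x ∈ u, x ≤ m) (hr : ¬ Reducible e (u ++ [m])) (hL : IsLyndon (u ++ [m])) :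
    u ++ [m] = [0] ∨ (∃ i ≤ m, 1 ≤ i ∧ u ++ [m] = up i m) ∨ (2 ≤ m ∧ u ++ [m] = 0 :: up 2 m) ∨
      ∃ j < m, 1 ≤ j ∧ u ++ [m] = down j 1 ++ 0 :: up 2 m := by
  rcases Nat.lt_or_ge m 2 with hm | hm
  -- For `m ≤ 1` the only block is `[m]`, since `[0,1]` is reducible.
  · obtain ⟨n, -, hn⟩ := eq_of_isLyndon (N := 0) (c := fun _ => [m]) (by simp)
      (fun w hw hr => mem_chain (e := e) rfl (fun n _ k hk _ => by
        obtain rfl : k = 0 := by omega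
        obtain rfl : m = 1 := by omega
        exact reducible_D_zero_one hS) hw hr) (fun a b _ _ => by omega) (fun a b _ _ => by omega)
      hu hr hL
    rcases Nat.eq_zero_or_pos m with rfl | hm0
    · exact Or.inl hn
    · exact Or.inr (Or.inl ⟨m, le_rfl, hm0, by rw [hn, up_self]⟩)
  · rcases isLyndon_reducible_D_of_le hm hS hu hr hL with h | h | h
    · exact Or.inr (Or.inl h)
    · exact Or.inr (Or.inr (Or.inl ⟨hm, h⟩))
    · exact Or.inr (Or.inr (Or.inr h))

end UpperBound

end QLyndon

namespace QLyndon

/-! ### Transfer between letters in `Fin r` and letters in `ℕ` -/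

noncomputable section Transfer

variable {r : ℕ}

theorem map_val_injective : Function.Injective (List.map (Fin.val : Fin r → ℕ)) :=
  List.map_injective_iff.2 Fin.val_injective

theorem wordLt_map_val (u : List (Fin r)) : ∀ v : List (Fin r),
    wordLt (u.map Fin.val) (v.map Fin.val) ↔ wordLt u v := by
  induction u using List.reverseRecOn with
  | nil =>
    intro v
    exact iff_of_false (not_wordLt_nil_left _) (not_wordLt_nil_left _)
  | append_singleton u a ih =>
    intro v
    rcases List.eq_nil_or_concat v with rfl | ⟨v, b, rfl⟩
    · exact iff_of_true (wordLt_nil_right (by simp)) (wordLt_nil_right (by simp))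
    · simp only [List.concat_eq_append, List.map_append, List.map_cons, List.map_nil,
        wordLt_concat_iff, ih, Fin.lt_def, Fin.ext_iff]

theorem isLyndon_map_val {w : List (Fin r)} : IsLyndon (w.map Fin.val) ↔ IsLyndon w := by
  unfold IsLyndon
  constructor
  · rintro ⟨h0, h⟩
    refine ⟨by simpa using h0, fun p hp hpw hne => ?_⟩
    rw [← wordLt_map_val]
    exact h _ (by simpa using hp) (hpw.map _) fun h' => hne (map_val_injective h')
  · rintro ⟨h0, h⟩
    refine ⟨by simpa using h0, fun p hp hpw hne => ?_⟩
    obtain ⟨p, hp', rfl⟩ := List.prefix_map_iff.1 hpw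
    rw [wordLt_map_val]
    exact h _ (by simpa using hp) hp' fun h' => hne (by rw [h'])

theorem natForm_val (T : ClassicalType) (hT : T = .D → 3 ≤ r) (i j : Fin r) :
    natForm T i j = rootForm T r i j := by
  cases T
  · simp only [natForm, rootForm_A, Fin.ext_iff]
  · simp only [natForm, rootForm_B, Fin.ext_iff]
  · simp only [natForm, rootForm_C, Fin.ext_iff]
  · simp only [natForm, rootForm_D r (hT rfl), Fin.ext_iff]

/-- The deletion operators of the rank `r` algebra, indexed by all natural numbers. -/
def delNat (form : Fin r → Fin r → ℤ) (i : ℕ) : Module.End (RatFunc ℚ) (WSpace form) :=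
  if h : i < r then delW form ⟨i, h⟩ else 0

theorem delNat_val (form : Fin r → Fin r → ℤ) (i : Fin r) : delNat form i = delW form i := by
  simp [delNat]

theorem delNat_of_le (form : Fin r → Fin r → ℤ) {i : ℕ} (h : r ≤ i) : delNat form i = 0 := by
  simp [delNat, not_lt.2 h]

/-- Every term of a relation contains both letters, so relations involving a letter `≥ r`, whose
operator is zero, hold trivially. -/
theorem serreRel_delNat {form : Fin r → Fin r → ℤ} {fm : ℕ → ℕ → ℤ}
    (h : ∀ i j : Fin r, fm i j = form i j) (hsymm : ∀ i j, form i j = form j i) :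
    SerreRel fm (delNat form) := by
  have hS := serreRel_delW form hsymm
  have key : ∀ i j : ℕ, (∃ i' j' : Fin r, i = i' ∧ j = j') ∨ delNat form i = 0 ∨
      delNat form j = 0 := fun i j => by
    rcases Nat.lt_or_ge i r with hi | hi
    · rcases Nat.lt_or_ge j r with hj | hj
      · exact Or.inl ⟨⟨i, hi⟩, ⟨j, hj⟩, rfl, rfl⟩
      · exact Or.inr (Or.inr (delNat_of_le _ hj))
    · exact Or.inr (Or.inl (delNat_of_le _ hi))
  constructor
  · intro i j hij h0
    rcases key i j with ⟨i, j, rfl, rfl⟩ | hz | hz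
    · rw [delNat_val, delNat_val]
      exact hS.comm i j (fun h => hij (by rw [h])) (by rw [← h, h0])
    · simp [hz]
    · simp [hz]
  · intro i j d hij h1 h2
    rcases key i j with ⟨i, j, rfl, rfl⟩ | hz | hz
    · rw [delNat_val, delNat_val]
      exact hS.quad i j d (fun h => hij (by rw [h])) (by rw [← h, h1]) (by rw [← h, h2])
    · simp [hz]
    · simp [hz]
  · intro i j d hij h1 h2
    rcases key i j with ⟨i, j, rfl, rfl⟩ | hz | hz
    · rw [delNat_val, delNat_val]
      exact hS.cubic i j d (fun h => hij (by rw [h])) (by rw [← h, h1]) (by rw [← h, h2])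
    · simp [hz]
    · simp [hz]

/-- The rightmost operator acts first and deletes the last letter, so the product strips off `w`
from the right. -/
theorem mono_delNat_apply (form : Fin r → Fin r → ℤ) (w : List (Fin r)) : ∀ f : WSpace form,
    WSpace.incl form (mono (delNat form) (w.map Fin.val) f) [] = WSpace.incl form f w := by
  induction w using List.reverseRecOn with
  | nil => intro f; simp [mono]
  | append_singleton w k ih =>
    intro f
    rw [List.map_append, mono_append, Module.End.mul_apply, ih, List.map_cons, List.map_nil,
      mono_singleton, delNat_val, incl_delW, dR_apply]

theorem mono_delNat_eq_zero (form : Fin r → Fin r → ℤ) {w : List ℕ} {x : ℕ} (hx : x ∈ w)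
    (hr : r ≤ x) : mono (delNat form) w = 0 := by
  obtain ⟨s, t, rfl⟩ := List.append_of_mem hx
  rw [mono_append, mono_cons, delNat_of_le _ hr, zero_mul, mul_zero]

theorem exists_map_val {w : List ℕ} (h : ∀ x ∈ w, x < r) : ∃ v : List (Fin r),
    w = v.map Fin.val := by
  induction w with
  | nil => exact ⟨[], rfl⟩
  | cons x w ih =>
    obtain ⟨v, rfl⟩ := ih fun y hy => h y (List.mem_cons_of_mem _ hy)
    exact ⟨⟨x, h x List.mem_cons_self⟩ :: v, rfl⟩

/-- Evaluate the relation expressing reducibility at `f` and take constant terms: the coefficient of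
`w` becomes a combination of coefficients of smaller words, which all vanish in `f`. -/
theorem not_reducible_of_isMinWord {form : Fin r → Fin r → ℤ} {f : FreeWords (Fin r)}
    (hf : f ∈ shuffleSubalgebra form) {w : List (Fin r)} (hw : IsMinWord f w) :
    ¬ Reducible (delNat form) (w.map Fin.val) := by
  intro h
  let f' : WSpace form := ⟨f, hf⟩
  have hf' : WSpace.incl form f' = f := rfl
  have key : ∀ x ∈ lower (delNat form) (w.map Fin.val), WSpace.incl form (x f') [] = 0 := by
    intro x hx
    induction hx using Submodule.span_induction with
    | zero => simp
    | add x y _ _ hx hy => rw [LinearMap.add_apply, map_add, Finsupp.add_apply, hx, hy, add_zero]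
    | smul a x _ hx => rw [LinearMap.smul_apply, map_smul, Finsupp.smul_apply, hx, smul_zero]
    | mem x hx =>
      obtain ⟨v, -, hlt, rfl⟩ := hx
      by_cases hv : ∀ x ∈ v, x < r
      · obtain ⟨v, rfl⟩ := exists_map_val hv
        rw [mono_delNat_apply, hf']
        by_contra hne
        rw [wordLt_map_val] at hlt
        refine hlt.asymm (hw.2 v (Finsupp.mem_support_iff.2 hne) ?_)
        rintro rfl
        exact wordLt_irrefl _ hlt
      · push Not at hv
        obtain ⟨x, hx, hxr⟩ := hv
        rw [mono_delNat_eq_zero _ hx hxr]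
        simp
  have := key _ h
  rw [mono_delNat_apply, hf'] at this
  exact Finsupp.mem_support_iff.1 hw.1 this

theorem exists_of_mem_goodLyndonWords {T : ClassicalType} (hT : T = .D → 3 ≤ r) {w : List ℕ}
    (hw : w ∈ goodLyndonWords T r) : SerreRel (natForm T) (delNat (rootForm T r)) ∧
      ∃ u m, w = u ++ [m] ∧ m < r ∧ (∀ x ∈ u, x ≤ m) ∧
        ¬ Reducible (delNat (rootForm T r)) (u ++ [m]) ∧ IsLyndon (u ++ [m]) := by
  have hv := natForm_val T hT
  refine ⟨serreRel_delNat hv fun i j => by rw [← hv, ← hv, natForm_symm], ?_⟩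
  obtain ⟨w, ⟨⟨f, hf, -, hmin⟩, hL⟩, rfl⟩ := hw
  rw [← isLyndon_map_val] at hL
  obtain ⟨u, m, hum, hu⟩ := hL.exists_last
  have hr := not_reducible_of_isMinWord hf hmin
  have hm : m ∈ w.map Fin.val := by rw [hum]; simp
  obtain ⟨m', -, rfl⟩ := List.mem_map.1 hm
  exact ⟨u, m', hum, m'.isLt, hu, by rwa [hum] at hr, by rwa [hum] at hL⟩

theorem scaleK_apply {I : Type*} [DecidableEq I] (form : I → I → ℤ) (k : I) (f : FreeWords I)
    (w : List I) : scaleK form k f w = qvar ^ (-pairWord form w k) * f w := by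
  have : (Finsupp.lapply w).comp (scaleK form k) =
      qvar ^ (-pairWord form w k) • Finsupp.lapply (R := RatFunc ℚ) (M := RatFunc ℚ) w := by
    ext u : 2
    simp only [LinearMap.coe_comp, Function.comp_apply, Finsupp.lsingle_apply, scaleK_single,
      Finsupp.lapply_apply, Finsupp.smul_apply, Finsupp.single_apply, LinearMap.smul_apply]
    split_ifs with h
    · subst h; rfl
    · simp
  exact congrArg (fun φ => φ f) this

/-- Restriction of functions on words to words with letters `< r`. -/
def restrictWords (r : ℕ) (f : FreeWords ℕ) : FreeWords (Fin r) :=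
  f.comapDomain (List.map Fin.val) map_val_injective.injOn

theorem restrictWords_apply (f : FreeWords ℕ) (w : List (Fin r)) :
    restrictWords r f w = f (w.map Fin.val) := rfl

theorem restrictWords_add (f g : FreeWords ℕ) :
    restrictWords r (f + g) = restrictWords r f + restrictWords r g := by
  ext w
  simp [restrictWords_apply]

theorem restrictWords_smul (c : RatFunc ℚ) (f : FreeWords ℕ) :
    restrictWords r (c • f) = c • restrictWords r f := by
  ext w
  simp [restrictWords_apply]

theorem restrictWords_single (w : List (Fin r)) (c : RatFunc ℚ) :
    restrictWords r (Finsupp.single (w.map Fin.val) c) = Finsupp.single w c := by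
  ext v
  simp only [restrictWords_apply, Finsupp.single_apply, map_val_injective.eq_iff]

/-- Discarding words with a letter `≥ r` is multiplicative, because a shuffle contains all letters
of both factors. Formally, it commutes with deletions and twists for letters `< r`. -/
theorem restrictWords_shuffleHom {form : Fin r → Fin r → ℤ} {fm : ℕ → ℕ → ℤ}
    (h : ∀ i j : Fin r, fm i j = form i j) (w : List (Fin r)) : ∀ f g : FreeWords ℕ,
    shuffleHom fm f g (w.map Fin.val) =
      shuffleHom form (restrictWords r f) (restrictWords r g) w := by
  induction w using List.reverseRecOn with
  | nil =>
    intro f g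
    rw [List.map_nil, shuffleHom_apply_nil, shuffleHom_apply_nil]
    rfl
  | append_singleton w k ih =>
    intro f g
    have hd : ∀ f, dR k (restrictWords r f) = restrictWords r (dR (k : ℕ) f) := fun f => by
      ext v
      rw [dR_apply, restrictWords_apply, restrictWords_apply, dR_apply, List.map_append]
      rfl
    have hs : ∀ f, scaleK form k (restrictWords r f) =
        restrictWords r (scaleK fm (k : ℕ) f) := fun f => by
      ext v
      rw [scaleK_apply, restrictWords_apply, restrictWords_apply, scaleK_apply]
      congr 3
      simp only [pairWord, List.map_map, Function.comp_def, h]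
    rw [List.map_append, List.map_cons, List.map_nil, ← dR_apply, ← dR_apply, dR_shuffleHom,
      dR_shuffleHom, Finsupp.add_apply, Finsupp.add_apply, ih, ih, hd, hd, hs]

theorem restrictWords_mem {form : Fin r → Fin r → ℤ} {fm : ℕ → ℕ → ℤ}
    (h : ∀ i j : Fin r, fm i j = form i j) {f : FreeWords ℕ} (hf : f ∈ shuffleSubalgebra fm) :
    restrictWords r f ∈ shuffleSubalgebra form := by
  let S : Submodule (RatFunc ℚ) (FreeWords ℕ) :=
    { carrier := {f | restrictWords r f ∈ shuffleSubalgebra form}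
      add_mem' := fun {a b} ha hb => by
        simp only [Set.mem_ofPred_eq] at *
        rw [restrictWords_add]
        exact Submodule.add_mem _ ha hb
      zero_mem' := by
        simp only [Set.mem_ofPred_eq]
        convert Submodule.zero_mem (shuffleSubalgebra form) using 1
        ext; simp [restrictWords_apply]
      smul_mem' := fun c a ha => by
        simp only [Set.mem_ofPred_eq] at *
        rw [restrictWords_smul]
        exact Submodule.smul_mem _ _ ha }
  refine shuffleSubalgebra_le fm (S := S) ?_ ?_ hf
  · change restrictWords r (Finsupp.single (([] : List (Fin r)).map Fin.val) 1) ∈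
      shuffleSubalgebra form
    rw [restrictWords_single]
    exact one_mem form
  · intro f hf l
    have hmul : restrictWords r (shuffleHom fm f (Finsupp.single [l] 1)) =
        shuffleHom form (restrictWords r f) (restrictWords r (Finsupp.single [l] 1)) := by
      ext w
      exact restrictWords_shuffleHom h w _ _
    change restrictWords r (shuffleHom fm f (Finsupp.single [l] 1)) ∈ shuffleSubalgebra form
    rw [hmul]
    refine shuffleHom_mem form hf ?_
    rcases Nat.lt_or_ge l r with hl | hl
    · have := restrictWords_single [⟨l, hl⟩] (1 : RatFunc ℚ)
      rw [List.map_cons, List.map_nil] at this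
      rw [this]
      exact letter_mem form _
    · convert Submodule.zero_mem (shuffleSubalgebra form) using 1
      ext w
      rw [restrictWords_apply, Finsupp.single_apply, if_neg, Finsupp.zero_apply]
      intro hw
      have : l ∈ w.map Fin.val := by rw [← hw]; simp
      obtain ⟨x, -, rfl⟩ := List.mem_map.1 this
      exact absurd x.isLt (not_lt.2 hl)

/-- Goodness may be proved in the algebra on all letters: restricting a witness keeps its smallest
word and its homogeneity. -/
theorem mem_goodLyndonWords {T : ClassicalType} (hT : T = .D → 3 ≤ r) {w : List ℕ}
    (hr : ∀ x ∈ w, x < r) (hg : IsGood (natForm T) w) (hL : IsLyndon w) :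
    w ∈ goodLyndonWords T r := by
  obtain ⟨w, rfl⟩ := exists_map_val hr
  obtain ⟨f, hf, ⟨ν, hν⟩, hmem, hmin⟩ := hg
  have hsupp : ∀ v, v ∈ (restrictWords r f).support ↔ v.map Fin.val ∈ f.support := fun v => by
    rw [Finsupp.mem_support_iff, Finsupp.mem_support_iff, restrictWords_apply]
  refine ⟨w, ⟨⟨restrictWords r f, restrictWords_mem (natForm_val T hT) hf, ⟨fun i => ν i, ?_⟩,
    (hsupp w).2 hmem, ?_⟩, isLyndon_map_val.1 hL⟩, rfl⟩
  · intro v hv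
    funext i
    rw [← hν _ ((hsupp v).1 hv)]
    exact (List.count_map_of_injective v _ Fin.val_injective i).symm
  · intro v hv hne
    rw [← wordLt_map_val]
    exact hmin _ ((hsupp v).1 hv) fun h => hne (map_val_injective h)

end Transfer

end QLyndon

namespace QLyndon

/-! ### Insertion of a letter by `q`-commutators -/

noncomputable section Insertion

variable (fm : ℕ → ℕ → ℤ)

/-- Left concatenation with a word. -/
def pre (a : List ℕ) : FreeWords ℕ →ₗ[RatFunc ℚ] FreeWords ℕ :=
  Finsupp.lmapDomain (RatFunc ℚ) (RatFunc ℚ) (a ++ ·)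

theorem pre_single (a u : List ℕ) (c : RatFunc ℚ) :
    pre a (Finsupp.single u c) = Finsupp.single (a ++ u) c := by
  simp [pre]

theorem pre_pre (a b : List ℕ) (f : FreeWords ℕ) : pre a (pre b f) = pre (a ++ b) f := by
  simp only [pre, Finsupp.lmapDomain_apply, ← Finsupp.mapDomain_comp]
  congr 1
  funext u
  simp

theorem pre_nil (f : FreeWords ℕ) : pre [] f = f :=
  Finsupp.mapDomain_id

theorem pre_apply_append (a u : List ℕ) (f : FreeWords ℕ) : pre a f (a ++ u) = f u := by
  rw [pre, Finsupp.lmapDomain_apply]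
  exact Finsupp.mapDomain_apply (List.append_right_injective a) f u

theorem concatLetter_add (i : ℕ) (f g : FreeWords ℕ) :
    concatLetter i (f + g) = concatLetter i f + concatLetter i g :=
  Finsupp.mapDomain_add

theorem concatLetter_smul (i : ℕ) (c : RatFunc ℚ) (f : FreeWords ℕ) :
    concatLetter i (c • f) = c • concatLetter i f :=
  Finsupp.mapDomain_smul c f

theorem concatLetter_single (i : ℕ) (u : List ℕ) (c : RatFunc ℚ) :
    concatLetter i (Finsupp.single u c) = Finsupp.single (u ++ [i]) c :=
  Finsupp.mapDomain_single

theorem concatLetter_pre (i : ℕ) (a : List ℕ) (f : FreeWords ℕ) :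
    concatLetter i (pre a f) = pre a (concatLetter i f) := by
  simp only [concatLetter, pre, Finsupp.lmapDomain_apply, ← Finsupp.mapDomain_comp]
  congr 1
  funext u
  simp

/-- In `u * [l]` the inserted `l` is weighted by the letters before it; in `[l] * u` (next lemma) by
the letters after it. -/
theorem shuffleWord_cons_letter (x l : ℕ) (u : List ℕ) : shuffleWord fm (x :: u) [l] =
    Finsupp.single (l :: x :: u) 1 + qvar ^ (-fm x l) • pre [x] (shuffleWord fm u [l]) := by
  induction u using List.reverseRecOn with
  | nil =>
    have := shuffleWord_concat fm [] [] x l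
    simp only [List.nil_append] at this
    rw [this, shuffleWord_nil_left, shuffleWord_nil_right, pre_single,
      concatLetter_single, concatLetter_single]
    simp [pairWord]
  | append_singleton u i ih =>
    have h1 := shuffleWord_concat fm (x :: u) [] i l
    have h2 := shuffleWord_concat fm u [] i l
    simp only [List.nil_append, List.cons_append, shuffleWord_nil_right] at h1 h2
    rw [h1, h2, ih, concatLetter_add, concatLetter_smul, concatLetter_single, concatLetter_single,
      concatLetter_single, concatLetter_pre, map_add, smul_add, add_assoc, map_smul, pre_single,
      smul_smul, ← zpow_add₀ qvar_ne_zero, pairWord_cons]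
    congr 4
    ring

theorem letter_shuffleWord_cons (hs : ∀ i j, fm i j = fm j i) (x l : ℕ) (u : List ℕ) :
    shuffleWord fm [l] (x :: u) = qvar ^ (-pairWord fm (x :: u) l) •
      Finsupp.single (l :: x :: u) 1 + pre [x] (shuffleWord fm [l] u) := by
  induction u using List.reverseRecOn with
  | nil =>
    have := shuffleWord_concat fm [] [] l x
    simp only [List.nil_append] at this
    rw [this, shuffleWord_nil_left, shuffleWord_nil_right, pre_single,
      concatLetter_single, concatLetter_single, add_comm, hs l x]
    simp [pairWord]
  | append_singleton u i ih =>
    have h1 := shuffleWord_concat fm [] (x :: u) l i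
    have h2 := shuffleWord_concat fm [] u l i
    simp only [List.nil_append, List.cons_append, shuffleWord_nil_left] at h1 h2
    rw [h1, h2, ih, concatLetter_add, concatLetter_smul, concatLetter_single, concatLetter_single,
      concatLetter_single, concatLetter_pre, map_add, smul_add, map_smul, pre_single,
      smul_smul, ← zpow_add₀ qvar_ne_zero, ← List.cons_append, pairWord_concat, hs l i,
      add_left_comm]
    simp only [pairWord, List.map_nil, List.sum_nil, zero_add, List.cons_append, List.nil_append]
    congr 4
    ring

/-- The coefficient with which a letter is inserted after a prefix of pairing `s`. -/
def insCoeff (σ s : ℤ) : RatFunc ℚ := qvar ^ (-s) - qvar ^ (s - σ)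

/-- The sum of all insertions of the letter `l` into a word, with the coefficients `insCoeff`. -/
def ins (l : ℕ) (σ : ℤ) : ℤ → List ℕ → FreeWords ℕ
  | s, [] => insCoeff σ s • Finsupp.single [l] 1
  | s, x :: u => insCoeff σ s • Finsupp.single (l :: x :: u) 1 + pre [x] (ins l σ (s + fm x l) u)

/-- At a position with preceding pairing `s`, the two products contribute `q^{-s}` and `q^{(u,l)-σ}
q^{-((u,l)-s)} = q^{s-σ}`. The initial value `s` is general for the induction over prefixes. -/
theorem shuffleWord_sub (hs : ∀ i j, fm i j = fm j i) (l : ℕ) (σ : ℤ) (u : List ℕ) : ∀ s : ℤ,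
    qvar ^ (-s) • shuffleWord fm u [l] -
      qvar ^ (s + pairWord fm u l - σ) • shuffleWord fm [l] u = ins fm l σ s u := by
  induction u with
  | nil =>
    intro s
    rw [shuffleWord_nil_left, shuffleWord_nil_right, ins, insCoeff, sub_smul]
    simp [pairWord]
  | cons x u ih =>
    intro s
    rw [shuffleWord_cons_letter, letter_shuffleWord_cons _ hs, ins, ← ih, insCoeff, smul_add,
      smul_add, map_sub, map_smul, map_smul, smul_smul, smul_smul, ← zpow_add₀ qvar_ne_zero,
      ← zpow_add₀ qvar_ne_zero, sub_smul, pairWord_cons, add_sub_add_comm]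
    refine congrArg₂ (· + ·) (congrArg₂ (· - ·) rfl ?_) (congrArg₂ (· - ·) ?_ ?_) <;>
      (congr 2; ring)

theorem insCoeff_eq_zero {σ s : ℤ} (h : 2 * s = σ) : insCoeff σ s = 0 := by
  rw [insCoeff, sub_eq_zero]
  congr 1
  omega

theorem insCoeff_ne_zero {σ s : ℤ} (h : 2 * s ≠ σ) : insCoeff σ s ≠ 0 :=
  sub_ne_zero.2 (qvar_zpow_ne (by omega))

theorem ins_skip {l : ℕ} {σ s : ℤ} (h : 2 * s = σ) (a v : List ℕ) (ha : ∀ y ∈ a, fm y l = 0) :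
    ins fm l σ s (a ++ v) = pre a (ins fm l σ s v) := by
  induction a with
  | nil => rw [pre_nil]; rfl
  | cons y a ih =>
    rw [List.cons_append, ins, insCoeff_eq_zero h, zero_smul, zero_add, ha y List.mem_cons_self,
      add_zero, ih fun x hx => ha x (List.mem_cons_of_mem _ hx), pre_pre]
    rfl

theorem ins_eq_zero {l : ℕ} {σ s : ℤ} (h : 2 * s = σ) {a : List ℕ} (ha : ∀ y ∈ a, fm y l = 0) :
    ins fm l σ s a = 0 := by
  rw [← List.append_nil a, ins_skip fm h a [] ha, ins, insCoeff_eq_zero h, zero_smul, map_zero]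

theorem ins_concat {l x : ℕ} {a : List ℕ} (ha : ∀ y ∈ a, fm y l = 0) :
    ins fm l 0 0 (a ++ [x]) = insCoeff 0 (fm x l) • Finsupp.single (a ++ [x] ++ [l]) 1 := by
  rw [ins_skip fm (by norm_num) a _ ha, ins, insCoeff_eq_zero (by norm_num), zero_smul, zero_add,
    ins, map_smul, map_smul, pre_single, pre_single, zero_add]
  simp

/-- The hypothesis on the part of a word that follows the letter `l`. -/
def TailOK (l : ℕ) (s : ℤ) (b : List ℕ) : Prop :=
  b = [] ∨ ∃ y b', b = y :: b' ∧ fm y l = s ∧ ∀ z ∈ b', fm z l = 0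

/-- Inserting `l` just before or just after an existing `l` gives the same word. The preceding
pairings are `2s` and `0`, whose coefficients are opposite for `σ = 2s`; further right the pairing
is `s` and the coefficient is zero. -/
theorem ins_tail {l : ℕ} {s : ℤ} (hl : fm l l = -(2 * s)) {b : List ℕ} (hb : TailOK fm l s b) :
    ins fm l (2 * s) (2 * s) (l :: b) = 0 := by
  have hc : insCoeff (2 * s) (2 * s) + insCoeff (2 * s) 0 = 0 := by
    simp [insCoeff]
  rw [ins, hl, add_neg_cancel]
  rcases hb with rfl | ⟨y, b', rfl, hy, hb'⟩
  · rw [ins, map_smul, pre_single, List.singleton_append, ← add_smul, hc, zero_smul]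
  · rw [ins, hy, zero_add, ins_eq_zero fm rfl hb', map_zero, add_zero, map_smul, pre_single,
      List.singleton_append, ← add_smul, hc, zero_smul]

/-- For `σ = 2s` all positions strictly between `x` and `x'`, or next to them on the inner side,
have pairing `s` and coefficient zero, and the rest cancels by `ins_tail`. Only the insertion in
front survives. -/
theorem ins_front {l x x' : ℕ} {s : ℤ} (hl : fm l l = -(2 * s)) (hx : fm x l = s)
    (hx' : fm x' l = s) {a b : List ℕ} (ha : ∀ y ∈ a, fm y l = 0) (hb : TailOK fm l s b) :
    ins fm l (2 * s) 0 (x :: a ++ x' :: l :: b) =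
      insCoeff (2 * s) 0 • Finsupp.single (l :: (x :: a ++ x' :: l :: b)) 1 := by
  rw [List.cons_append, ins, hx, zero_add, ins_skip fm rfl a _ ha, ins, insCoeff_eq_zero rfl,
    zero_smul, zero_add, hx', ← two_mul, ins_tail fm hl hb, map_zero, map_zero, map_zero, add_zero]

theorem ins_front_of_two {l x : ℕ} {s : ℤ} (hl : fm l l = -(2 * s)) (hx : fm x l = 2 * s)
    {b : List ℕ} (hb : TailOK fm l s b) :
    ins fm l (2 * s) 0 (x :: l :: b) =
      insCoeff (2 * s) 0 • Finsupp.single (l :: x :: l :: b) 1 := by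
  rw [ins, hx, zero_add, ins_tail fm hl hb, map_zero, add_zero]

variable {fm}

theorem letter_bracket_mem {f : FreeWords ℕ} (hf : f ∈ shuffleSubalgebra fm) (l : ℕ)
    (c : RatFunc ℚ) : shuffleHom fm f (Finsupp.single [l] 1) -
      c • shuffleHom fm (Finsupp.single [l] 1) f ∈ shuffleSubalgebra fm :=
  Submodule.sub_mem _ (shuffleHom_mem fm hf (letter_mem fm l))
    (Submodule.smul_mem _ _ (shuffleHom_mem fm (letter_mem fm l) hf))

/-- Membership of a word in the shuffle subalgebra. -/
def WordMem (fm : ℕ → ℕ → ℤ) (u : List ℕ) : Prop := Finsupp.single u 1 ∈ shuffleSubalgebra fm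

theorem ins_mem (hs : ∀ i j, fm i j = fm j i) {u : List ℕ} (hu : WordMem fm u) (l : ℕ) (σ : ℤ) :
    ins fm l σ 0 u ∈ shuffleSubalgebra fm := by
  have := letter_bracket_mem hu l (qvar ^ (pairWord fm u l - σ))
  rw [shuffleHom_single, shuffleHom_single] at this
  rw [← shuffleWord_sub fm hs]
  simpa using this

theorem WordMem.of_smul {u : List ℕ} {c : RatFunc ℚ} (hc : c ≠ 0)
    (h : c • Finsupp.single u 1 ∈ shuffleSubalgebra fm) : WordMem fm u :=
  (Submodule.smul_mem_iff _ hc).1 h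

theorem WordMem.concat (hs : ∀ i j, fm i j = fm j i) {a : List ℕ} {x l : ℕ}
    (h : WordMem fm (a ++ [x])) (ha : ∀ y ∈ a, fm y l = 0) (hx : fm x l ≠ 0) :
    WordMem fm (a ++ [x] ++ [l]) := by
  have := ins_mem hs h l 0
  rw [ins_concat fm ha] at this
  exact WordMem.of_smul (insCoeff_ne_zero (by omega)) this

theorem WordMem.front (hs : ∀ i j, fm i j = fm j i) {l x x' : ℕ} {s : ℤ} (h0 : s ≠ 0)
    (hl : fm l l = -(2 * s)) (hx : fm x l = s) (hx' : fm x' l = s) {a b : List ℕ}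
    (ha : ∀ y ∈ a, fm y l = 0) (hb : TailOK fm l s b) (h : WordMem fm (x :: a ++ x' :: l :: b)) :
    WordMem fm (l :: (x :: a ++ x' :: l :: b)) := by
  have := ins_mem hs h l (2 * s)
  rw [ins_front fm hl hx hx' ha hb] at this
  exact WordMem.of_smul (insCoeff_ne_zero (by omega)) this

theorem WordMem.front_of_two (hs : ∀ i j, fm i j = fm j i) {l x : ℕ} {s : ℤ} (h0 : s ≠ 0)
    (hl : fm l l = -(2 * s)) (hx : fm x l = 2 * s) {b : List ℕ}
    (hb : TailOK fm l s b) (h : WordMem fm (x :: l :: b)) : WordMem fm (l :: x :: l :: b) := by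
  have := ins_mem hs h l (2 * s)
  rw [ins_front_of_two fm hl hx hb] at this
  exact WordMem.of_smul (insCoeff_ne_zero (by omega)) this

theorem WordMem.isGood {w : List ℕ} (h : WordMem fm w) : IsGood fm w := by
  refine ⟨_, h, ⟨content w, ?_⟩, ?_, ?_⟩
  · intro v hv
    rw [Finsupp.mem_support_single] at hv
    rw [hv.1]
  · rw [Finsupp.mem_support_single]
    exact ⟨rfl, one_ne_zero⟩
  · intro v hv hne
    rw [Finsupp.mem_support_single] at hv
    exact absurd hv.1 hne

theorem WordMem.up (hs : ∀ i j, fm i j = fm j i) {i : ℕ}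
    (h1 : ∀ k, i ≤ k → fm k (k + 1) ≠ 0) (h2 : ∀ k l, i ≤ k → k + 1 < l → fm k l = 0) (n : ℕ) :
    WordMem fm (up i (i + n)) := by
  induction n with
  | zero => rw [add_zero, up_self]; exact letter_mem fm i
  | succ n ih =>
    rw [← add_assoc, up_append_singleton (by omega)]
    obtain ⟨a, ha, hlt⟩ := endsWith_up (i := i) (m := i + n) (by omega)
    rw [ha] at ih ⊢
    refine ih.concat hs (fun y hy => h2 y _ ?_ (by have := hlt y hy; omega)) (h1 _ (by omega))
    have : y ∈ QLyndon.up i (i + n) := by rw [ha]; simp [hy]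
    exact (mem_up.1 this).1

/-- A proper left factor ends in a letter smaller than `m`. -/
theorem EndsWith.isLyndon {m : ℕ} {w : List ℕ} (h : EndsWith m w) : IsLyndon w := by
  refine ⟨h.ne_nil, fun p hp hpw hne => ?_⟩
  obtain ⟨u, rfl, hu⟩ := h
  rcases List.eq_nil_or_concat p with rfl | ⟨p, x, rfl⟩
  · exact absurd rfl hp
  rw [List.concat_eq_append] at *
  rw [wordLt_concat_iff]
  refine Or.inl (hu x ?_)
  rcases List.prefix_concat_iff.1 hpw with h | h
  · exact absurd h hne
  · exact h.subset (by simp)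

end Insertion

end QLyndon

namespace QLyndon

/-! ### Lower bound: words and sums of two words in `𝒲` -/

noncomputable section LowerBound

theorem up_split {i j k : ℕ} (h : i ≤ j + 1) (h' : j ≤ k) : up i k = up i j ++ up (j + 1) k := by
  have := List.range'_append_1 (s := i) (m := j + 1 - i) (n := k - j)
  rw [up, up, up, show k + 1 - (j + 1) = k - j by omega,
    show k + 1 - i = j + 1 - i + (k - j) by omega, ← this]
  congr 2
  omega

theorem up_split_cons {i j k : ℕ} (h : i ≤ j + 1) (h' : j + 1 ≤ k) :
    up i k = up i j ++ (j + 1) :: up (j + 2) k := by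
  rw [up_split h (by omega), up_cons h']

theorem up_eq_nil {i j : ℕ} (h : j < i) : up i j = [] := by
  rw [up, show j + 1 - i = 0 by omega, List.range'_zero]

theorem tailOK_up {fm : ℕ → ℕ → ℤ} {l k i : ℕ} {s : ℤ} (h1 : fm i l = s)
    (h2 : ∀ z, i < z → fm z l = 0) : TailOK fm l s (up i k) := by
  rcases Nat.lt_or_ge k i with h | h
  · exact Or.inl (up_eq_nil h)
  · refine Or.inr ⟨i, up (i + 1) k, up_cons h, h1, fun z hz => h2 z ?_⟩
    have := mem_up.1 hz
    omega

theorem isGood_up {T : ClassicalType} {i j : ℕ} (hij : i ≤ j) (hT : T = .D → 1 ≤ i) :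
    IsGood (natForm T) (up i j) := by
  obtain ⟨n, rfl⟩ := Nat.exists_eq_add_of_le hij
  refine (WordMem.up (natForm_symm T) (fun k hk => ?_) (fun k l hk hl => ?_) n).isGood
  · cases T
    all_goals try have := hT rfl
    all_goals simp only [natForm]; split_ifs <;> grind
  · cases T
    all_goals try have := hT rfl
    all_goals simp only [natForm]; split_ifs <;> grind

theorem wordMem_B {j k : ℕ} (hj : j < k) : WordMem (natForm .B) (down j 0 ++ up 0 k) := by
  have hs := natForm_symm .B
  induction j with
  | zero =>
    have h : WordMem (natForm .B) (up 0 k) := by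
      have := WordMem.up (i := 0) hs (fun k _ => by simp [natForm])
        (fun k l _ hl => (far_B k l hl).1) k
      rwa [zero_add] at this
    have h0 := ins_mem hs h 0 0
    rw [down_self, List.singleton_append]
    rw [up_cons (Nat.zero_le k), zero_add, up_cons hj] at h0 ⊢
    -- Inserting `0` into `[0,1,…,k]` with `σ = 0`: the pairings are `0` in front, `2` after `0`,
    -- and `0` from `1` on, so only `[0,0,1,…,k]` remains.
    rw [ins, insCoeff_eq_zero (by norm_num), zero_smul, zero_add, ins,
      ins_eq_zero _ (by simp [natForm]) fun y hy => (far_B 0 y ?_).2, map_zero, add_zero, map_smul,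
      pre_single] at h0
    · exact WordMem.of_smul (insCoeff_ne_zero (by simp [natForm])) h0
    · have := mem_up.1 hy; omega
  | succ j ih =>
    have h := ih (by omega)
    have hb : TailOK (natForm .B) (j + 1) (-2) (up (j + 2) k) :=
      tailOK_up (by simp [natForm]) fun z hz => (far_B (j + 1) z (by omega)).2
    rw [down_succ (by omega), List.cons_append]
    have key : ∃ a, down j 0 ++ up 0 k = j :: a ++ j :: (j + 1) :: up (j + 2) k ∧
        ∀ y ∈ a, y < j := by
      rcases j with _ | j
      · exact ⟨[], by rw [up_cons (Nat.zero_le k), zero_add, up_cons (by omega), down_self],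
          by simp⟩
      · refine ⟨down j 0 ++ up 0 j, ?_, fun y hy => ?_⟩
        · rw [down_succ (by omega), up_split_cons (j := j) (by omega) (by omega),
            up_cons (i := j + 2) (by omega)]
          simp
        · rcases List.mem_append.1 hy with hy | hy
          · have := mem_down.1 hy; omega
          · have := mem_up.1 hy; omega
    obtain ⟨a, ha, hlt⟩ := key
    rw [ha] at h ⊢
    exact h.front hs (s := -2) (by norm_num) (by simp [natForm]) (by simp [natForm])
      (by simp [natForm]) (fun y hy => (far_B y (j + 1) (by have := hlt y hy; omega)).1) hb

theorem wordMem_C {j k : ℕ} (hj : j + 1 < k) :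
    WordMem (natForm .C) (down (j + 1) 1 ++ up 0 k) := by
  have hs := natForm_symm .C
  induction j with
  | zero =>
    have h : WordMem (natForm .C) (up 0 k) := by
      have := WordMem.up (i := 0) hs (fun k _ => by simp only [natForm]; split_ifs <;> grind)
        (fun k l _ hl => (far_C k l hl).1) k
      rwa [zero_add] at this
    rw [zero_add, down_self, List.singleton_append]
    rw [up_cons (Nat.zero_le k), zero_add, up_cons (by omega)] at h ⊢
    -- The long root `α_0` pairs with `α_1` to `-2 = 2s`, so a single letter `0` replaces the pair
    -- `x`, `x'` of the general insertion.
    exact h.front_of_two hs (s := -1) (by norm_num) (by simp [natForm]) (by simp [natForm])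
      (tailOK_up (by simp [natForm]) fun z hz => (far_C 1 z (by omega)).2)
  | succ j ih =>
    have h := ih (by omega)
    have hb : TailOK (natForm .C) (j + 2) (-1) (up (j + 3) k) :=
      tailOK_up (by simp [natForm]) fun z hz => (far_C (j + 2) z (by omega)).2
    rw [down_succ (by omega), List.cons_append]
    have key : down (j + 1) 1 ++ up 0 k =
        (j + 1) :: (down j 1 ++ up 0 j) ++ (j + 1) :: (j + 2) :: up (j + 3) k := by
      rw [down_succ (by omega), up_split_cons (j := j) (by omega) (by omega),
        up_cons (i := j + 2) (by omega)]
      simp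
    rw [key] at h ⊢
    refine h.front hs (s := -1) (by norm_num) (by simp [natForm]) (by simp [natForm])
      (by simp [natForm]) (fun y hy => (far_C y (j + 2) ?_).1) hb
    rcases List.mem_append.1 hy with hy | hy
    · have := mem_down.1 hy; omega
    · have := mem_up.1 hy; omega

theorem wordMem_D_zero {k : ℕ} (hk : 2 ≤ k) : WordMem (natForm .D) (0 :: up 2 k) := by
  have hs := natForm_symm .D
  induction k, hk using Nat.le_induction with
  | base =>
    rw [up_self]
    exact WordMem.concat (a := []) hs (letter_mem _ 0) (by simp) (by simp [natForm])
  | succ k hk ih =>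
    rw [up_append_singleton (by omega)]
    obtain ⟨a, ha, hlt⟩ := endsWith_up hk
    rw [ha, ← List.cons_append] at ih ⊢
    rw [← List.cons_append]
    refine ih.concat hs (fun y hy => (far_D y (k + 1) ?_ (by omega)).1) ?_
    · rcases List.mem_cons.1 hy with rfl | hy
      · omega
      · have := hlt y hy; omega
    · simp only [natForm]; split_ifs <;> grind

theorem pairWord_perm {fm : ℕ → ℕ → ℤ} {u v : List ℕ} (h : u.Perm v) (l : ℕ) :
    pairWord fm u l = pairWord fm v l :=
  (h.map _).sum_eq

/-- The words `u` and `v` have the same content, so one and the same `q`-commutator inserts `l` in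
front of both, with equal coefficients. -/
theorem front_add_mem {fm : ℕ → ℕ → ℤ} (hs : ∀ i j, fm i j = fm j i) {l x x' y y' : ℕ} {s : ℤ}
    (h0 : s ≠ 0) (hl : fm l l = -(2 * s)) (hx : fm x l = s) (hx' : fm x' l = s) (hy : fm y l = s)
    (hy' : fm y' l = s) {a a' b : List ℕ} (ha : ∀ y ∈ a, fm y l = 0) (ha' : ∀ y ∈ a', fm y l = 0)
    (hb : TailOK fm l s b) {u v : List ℕ} (hu : u = x :: a ++ x' :: l :: b)
    (hv : v = y :: a' ++ y' :: l :: b) (huv : u.Perm v)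
    (h : Finsupp.single u 1 + Finsupp.single v 1 ∈ shuffleSubalgebra fm) :
    Finsupp.single (l :: u) 1 + Finsupp.single (l :: v) 1 ∈ shuffleSubalgebra fm := by
  have h1 := shuffleWord_sub fm hs l (2 * s) u 0
  have h2 := shuffleWord_sub fm hs l (2 * s) v 0
  rw [← pairWord_perm huv] at h2
  have e1 := ins_front fm hl hx hx' ha hb
  have e2 := ins_front fm hl hy hy' ha' hb
  rw [← hu] at e1
  rw [← hv] at e2
  have h3 := letter_bracket_mem h l (qvar ^ (0 + pairWord fm u l - 2 * s))
  rw [map_add, map_add, LinearMap.add_apply, shuffleHom_single, shuffleHom_single,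
    shuffleHom_single, shuffleHom_single, smul_add, add_sub_add_comm] at h3
  rw [neg_zero, zpow_zero, one_smul] at h1 h2
  rw [h1, h2, e1, e2, ← smul_add] at h3
  exact (Submodule.smul_mem_iff _ (insCoeff_ne_zero (by omega))).1 h3

theorem perm_D (j k : ℕ) :
    (down j 2 ++ 1 :: 0 :: up 2 k).Perm (down j 2 ++ 0 :: 1 :: up 2 k) :=
  (List.Perm.swap _ _ _).append_left _

/-- Deletions of `0` and `1` commute on `𝒲`, so the two orders of these letters always occur with
equal coefficients; hence a sum rather than a single word. -/
theorem sum_mem_D {j k : ℕ} (hj : j + 1 < k) :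
    Finsupp.single (down (j + 1) 2 ++ 1 :: 0 :: up 2 k) 1 +
      Finsupp.single (down (j + 1) 2 ++ 0 :: 1 :: up 2 k) 1 ∈ shuffleSubalgebra (natForm .D) := by
  have hs := natForm_symm .D
  induction j with
  | zero =>
    -- For `σ = -2` the letter `1` enters `[0,2,…,k]` in front of or after `0`, both with pairing
    -- `0`; after `2` the pairing is `-1` and the coefficient zero.
    have h := ins_mem hs (wordMem_D_zero (k := k) (by omega)) 1 (-2)
    have hd : down (0 + 1) 2 = [] := rfl
    rw [hd, List.nil_append, List.nil_append]
    rw [up_cons (by omega)] at h ⊢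
    have e1 : natForm .D 0 1 = 0 := by simp [natForm]
    have e2 : natForm .D 2 1 = -1 := by simp [natForm]
    rw [ins, ins, e1, e2, add_zero, zero_add,
      ins_eq_zero _ (by norm_num) fun y hy => (far_D 1 y ?_ ?_).2, map_zero, add_zero, map_smul,
      pre_single, ← smul_add] at h
    · exact (Submodule.smul_mem_iff _ (insCoeff_ne_zero (by norm_num))).1 h
    · have := mem_up.1 hy; omega
    · have := mem_up.1 hy; omega
  | succ j ih =>
    have h := ih (by omega)
    have hb : TailOK (natForm .D) (j + 2) (-1) (up (j + 3) k) :=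
      tailOK_up (by simp [natForm]) fun z hz => (far_D (j + 2) z (by omega) (by omega)).2
    rw [down_succ (j := j + 1) (by omega), List.cons_append, List.cons_append]
    rcases j with _ | j
    · have hd : down (0 + 1) 2 = [] := rfl
      rw [hd, List.nil_append, List.nil_append] at h ⊢
      exact front_add_mem hs (s := -1) (x := 1) (x' := 0) (y := 0) (y' := 1) (a := []) (a' := [])
        (by norm_num) (by simp [natForm]) (by simp [natForm]) (by simp [natForm])
        (by simp [natForm]) (by simp [natForm]) (by simp) (by simp) hb
        (by rw [up_cons (by omega)]; rfl) (by rw [up_cons (by omega)]; rfl)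
        (List.Perm.swap _ _ _) h
    · have hfar : ∀ a : List ℕ, (∀ y ∈ a, y < j + 2) → ∀ y ∈ a, natForm .D y (j + 1 + 2) = 0 :=
        fun a ha y hy => (far_D y (j + 3) (by have := ha y hy; omega) (by omega)).1
      have hlt : ∀ p q : ℕ, p < j + 2 → q < j + 2 →
          ∀ y ∈ down (j + 1) 2 ++ p :: q :: up 2 (j + 1), y < j + 2 := fun p q hp hq y hy => by
        rcases List.mem_append.1 hy with hy | hy
        · have := mem_down.1 hy; omega
        · rcases List.mem_cons.1 hy with rfl | hy
          · exact hp
          · rcases List.mem_cons.1 hy with rfl | hy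
            · exact hq
            · have := mem_up.1 hy; omega
      have hsplit : ∀ p q : ℕ, down (j + 1 + 1) 2 ++ p :: q :: up 2 k =
          (j + 2) :: (down (j + 1) 2 ++ p :: q :: up 2 (j + 1)) ++
            (j + 2) :: (j + 3) :: up (j + 4) k := fun p q => by
        rw [down_succ (by omega), up_split_cons (i := 2) (j := j + 1) (k := k) (by omega)
          (by omega), up_cons (i := j + 1 + 2) (by omega)]
        simp
      exact front_add_mem hs (s := -1) (x := j + 2) (x' := j + 2) (y := j + 2) (y' := j + 2)
        (by norm_num) (by simp [natForm]) (by simp [natForm]) (by simp [natForm])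
        (by simp [natForm]) (by simp [natForm]) (hfar _ (hlt 1 0 (by omega) (by omega)))
        (hfar _ (hlt 0 1 (by omega) (by omega))) hb (hsplit 1 0) (hsplit 0 1) (perm_D _ _) h

theorem content_perm {u v : List ℕ} (h : u.Perm v) : content u = content v := by
  funext i
  exact h.count_eq i

theorem isGood_D {j k : ℕ} (h1 : 1 ≤ j) (hj : j < k) :
    IsGood (natForm .D) (down j 1 ++ 0 :: up 2 k) := by
  obtain ⟨j, rfl⟩ := Nat.exists_eq_add_of_le' h1
  have hd : down (j + 1) 1 ++ 0 :: up 2 k = down (j + 1) 2 ++ 1 :: 0 :: up 2 k := by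
    rw [down, up_cons (by omega), down]
    simp
  rw [hd]
  set u := down (j + 1) 2 ++ 1 :: 0 :: up 2 k with hu
  set v := down (j + 1) 2 ++ 0 :: 1 :: up 2 k with hv
  have hlt : wordLt u v := by
    have := wordLt_append_right ((wordLt_concat_iff (down (j + 1) 2 ++ [1])
      (down (j + 1) 2 ++ [0]) 0 1).2 (Or.inl (by omega))) (up 2 k)
    simpa [hu, hv] using this
  have hne : u ≠ v := fun h => wordLt_irrefl u (by rw [← h] at hlt; exact hlt)
  have hsupp : ∀ w ∈ (Finsupp.single u (1 : RatFunc ℚ) + Finsupp.single v 1).support,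
      w = u ∨ w = v := fun w hw => by
    by_contra! hcon
    rw [Finsupp.mem_support_iff, Finsupp.add_apply, Finsupp.single_apply, Finsupp.single_apply,
      if_neg hcon.1.symm, if_neg hcon.2.symm, add_zero] at hw
    exact hw rfl
  refine ⟨_, sum_mem_D hj, ⟨content u, fun w hw => ?_⟩, ?_, fun w hw hwu => ?_⟩
  · rcases hsupp w hw with rfl | rfl
    · rfl
    · exact (content_perm (perm_D _ _)).symm
  · rw [Finsupp.mem_support_iff, Finsupp.add_apply, Finsupp.single_eq_same, Finsupp.single_apply,
      if_neg hne.symm, add_zero]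
    exact one_ne_zero
  · rcases hsupp w hw with rfl | rfl
    · exact absurd rfl hwu
    · exact hlt

end LowerBound

end QLyndon

namespace QLyndon

/-! ### The words `[0,…,j,1,…,j]` of type `C` -/

noncomputable section LastFamily

section General

variable (fm : ℕ → ℕ → ℤ)

/-- The span of the words with `(|w|, α_l) = t`. -/
def pairSpan (l : ℕ) (t : ℤ) : Submodule (RatFunc ℚ) (FreeWords ℕ) :=
  Submodule.span (RatFunc ℚ) {f | ∃ u, pairWord fm u l = t ∧ f = Finsupp.single u 1}

theorem shuffleWord_mem_span (n : ℕ) : ∀ u v : List ℕ, u.length + v.length = n →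
    shuffleWord fm u v ∈ Submodule.span (RatFunc ℚ)
      {f | ∃ w : List ℕ, w.Perm (u ++ v) ∧ f = Finsupp.single w (1 : RatFunc ℚ)} := by
  induction n with
  | zero =>
    intro u v h
    rw [List.length_eq_zero_iff.1 (show u.length = 0 by omega), shuffleWord_nil_left]
    exact Submodule.subset_span ⟨v, List.Perm.refl _, rfl⟩
  | succ n ih =>
    intro u v h
    rcases List.eq_nil_or_concat' u with rfl | ⟨u, i, rfl⟩
    · rw [shuffleWord_nil_left]
      exact Submodule.subset_span ⟨v, List.Perm.refl _, rfl⟩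
    rcases List.eq_nil_or_concat' v with rfl | ⟨v, j, rfl⟩
    · rw [shuffleWord_nil_right]
      exact Submodule.subset_span ⟨u ++ [i], by simp, rfl⟩
    have key : ∀ (k : ℕ) (u' v' : List ℕ), (u' ++ v' ++ [k]).Perm (u ++ [i] ++ (v ++ [j])) →
        u'.length + v'.length = n → concatLetter k (shuffleWord fm u' v') ∈
        Submodule.span (RatFunc ℚ) {f | ∃ w : List ℕ, w.Perm (u ++ [i] ++ (v ++ [j])) ∧
          f = Finsupp.single w (1 : RatFunc ℚ)} := by
      intro k u' v' hp hn
      have hmem := ih u' v' hn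
      generalize shuffleWord fm u' v' = f at hmem ⊢
      induction hmem using Submodule.span_induction with
      | zero => simp [concatLetter]
      | add x y _ _ hx hy => rw [concatLetter_add]; exact Submodule.add_mem _ hx hy
      | smul a x _ hx => rw [concatLetter_smul]; exact Submodule.smul_mem _ _ hx
      | mem x hx =>
        obtain ⟨w, hw, rfl⟩ := hx
        rw [concatLetter_single]
        exact Submodule.subset_span ⟨_, (hw.append_right [k]).trans hp, rfl⟩
    rw [shuffleWord_concat]
    simp only [List.length_append, List.length_cons, List.length_nil] at h
    refine Submodule.add_mem _ (key i _ _ ?_ (by simp; omega))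
      (Submodule.smul_mem _ _ (key j _ _ (by simp) (by simp; omega)))
    refine List.perm_iff_count.2 fun a => ?_
    simp only [List.count_append]
    omega

theorem shuffleWord_mem_pairSpan {l : ℕ} {t : ℤ} (u v : List ℕ)
    (h : pairWord fm u l + pairWord fm v l = t) : shuffleWord fm u v ∈ pairSpan fm l t := by
  refine Submodule.span_mono ?_ (shuffleWord_mem_span fm _ u v rfl)
  rintro f ⟨w, hw, rfl⟩
  refine ⟨w, ?_, rfl⟩
  rw [pairWord_perm hw, ← h]
  simp [pairWord]

theorem perm_of_mem_support {u v w : List ℕ} (hw : w ∈ (shuffleWord fm u v).support) :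
    w.Perm (u ++ v) := by
  have key : ∀ f ∈ Submodule.span (RatFunc ℚ)
      {f | ∃ w : List ℕ, w.Perm (u ++ v) ∧ f = Finsupp.single w (1 : RatFunc ℚ)},
      ¬ w.Perm (u ++ v) → f w = 0 := by
    intro f hf hnp
    induction hf using Submodule.span_induction with
    | zero => rfl
    | add x y _ _ hx hy => rw [Finsupp.add_apply, hx, hy, add_zero]
    | smul a x _ hx => rw [Finsupp.smul_apply, hx, smul_zero]
    | mem x hx =>
      obtain ⟨w', hw', rfl⟩ := hx
      rw [Finsupp.single_apply, if_neg]
      rintro rfl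
      exact hnp hw'
  by_contra hnp
  exact Finsupp.mem_support_iff.1 hw (key _ (shuffleWord_mem_span fm _ u v rfl) hnp)

/-- The `q`-commutator with a letter. -/
def letterComm (l : ℕ) (c : RatFunc ℚ) : FreeWords ℕ →ₗ[RatFunc ℚ] FreeWords ℕ :=
  (shuffleHom fm).flip (Finsupp.single [l] 1) - c • shuffleHom fm (Finsupp.single [l] 1)

variable {fm}

theorem letterComm_apply (l : ℕ) (c : RatFunc ℚ) (f : FreeWords ℕ) : letterComm fm l c f =
    shuffleHom fm f (Finsupp.single [l] 1) - c • shuffleHom fm (Finsupp.single [l] 1) f := rfl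

theorem letterComm_mem {f : FreeWords ℕ} (hf : f ∈ shuffleSubalgebra fm) (l : ℕ)
    (c : RatFunc ℚ) : letterComm fm l c f ∈ shuffleSubalgebra fm :=
  letter_bracket_mem hf l c

/-- A skew Leibniz rule, a consequence of associativity alone. -/
theorem letterComm_shuffleHom (l : ℕ) (a b : RatFunc ℚ) (f g : FreeWords ℕ) :
    letterComm fm l (a * b) (shuffleHom fm f g) =
      shuffleHom fm f (letterComm fm l b g) + b • shuffleHom fm (letterComm fm l a f) g := by
  simp only [letterComm_apply, map_sub, map_smul, LinearMap.sub_apply, LinearMap.smul_apply,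
    shuffleHom_assoc, smul_sub, smul_smul]
  rw [mul_comm b a]
  abel

theorem letterComm_single (hs : ∀ i j, fm i j = fm j i) (l : ℕ) (u : List ℕ) :
    letterComm fm l (qvar ^ pairWord fm u l) (Finsupp.single u 1) = ins fm l 0 0 u := by
  rw [← shuffleWord_sub fm hs, letterComm_apply, shuffleHom_single, shuffleHom_single]
  simp

/-- No insertion in front of `x` occurs, since the pairing there is `0`; and a letter orthogonal to
`l` does not change the later coefficients. -/
theorem letterComm_pre (hs : ∀ i j, fm i j = fm j i) {l x : ℕ} (hx : fm x l = 0) {t : ℤ}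
    {f : FreeWords ℕ} (hf : f ∈ pairSpan fm l t) :
    letterComm fm l (qvar ^ t) (pre [x] f) = pre [x] (letterComm fm l (qvar ^ t) f) := by
  induction hf using Submodule.span_induction with
  | zero => simp
  | add f g _ _ hf hg => simp only [map_add, hf, hg]
  | smul a f _ hf => simp only [map_smul, hf]
  | mem f hf =>
    obtain ⟨u, rfl, rfl⟩ := hf
    have h1 := letterComm_single hs l u
    have h2 := letterComm_single hs l (x :: u)
    rw [pairWord_cons, hx, zero_add] at h2
    rw [pre_single, List.singleton_append, h1, h2, ins, insCoeff_eq_zero (by norm_num), zero_smul,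
      zero_add, hx, add_zero]

theorem one_add_qvar_zpow_ne_zero (n : ℤ) : 1 + qvar ^ n ≠ 0 := by
  intro h
  have h1 : qvar ^ n = -1 := eq_neg_of_add_eq_zero_right h
  rcases eq_or_ne n 0 with rfl | hn
  · norm_num at h
  · apply qvar_zpow_ne_one (n := n * 2) (by omega)
    rw [zpow_mul, h1]
    norm_num

end General

/-- The word `[1, …, a]` as an element of the shuffle algebra. -/
def upSingle (a : ℕ) : FreeWords ℕ := Finsupp.single (up 1 a) 1

theorem pairWord_C_up {j : ℕ} (hj : 1 ≤ j) : pairWord (natForm .C) (up 1 j) (j + 1) = -1 := by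
  obtain ⟨j, rfl⟩ := Nat.exists_eq_add_of_le' hj
  rw [up_append_singleton (by omega), pairWord_concat,
    pairWord_eq_zero fun x hx => (far_C x _ (by have := mem_up.1 hx; omega)).1]
  simp [natForm]

theorem letterComm_upSingle {j : ℕ} (hj : 1 ≤ j) :
    letterComm (natForm .C) (j + 1) (qvar ^ (-1 : ℤ)) (upSingle j) =
      insCoeff 0 (-1) • upSingle (j + 1) := by
  have h := letterComm_single (natForm_symm .C) (j + 1) (up 1 j)
  rw [pairWord_C_up hj] at h
  rw [upSingle, h, upSingle, up_append_singleton (i := 1) (m := j) (by omega)]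
  obtain ⟨j, rfl⟩ := Nat.exists_eq_add_of_le' hj
  rw [up_append_singleton (by omega),
    ins_concat _ fun y hy => (far_C y _ (by have := mem_up.1 hy; omega)).1]
  simp [natForm]

/-- The insertions before and after the final `j + 1` give the same word, with pairings `-1` and `1`
and hence opposite coefficients. -/
theorem letterComm_upSingle_succ {j : ℕ} (hj : 1 ≤ j) :
    letterComm (natForm .C) (j + 1) (qvar ^ (1 : ℤ)) (upSingle (j + 1)) = 0 := by
  have hp : pairWord (natForm .C) (up 1 (j + 1)) (j + 1) = 1 := by
    rw [up_append_singleton (by omega), pairWord_concat, pairWord_C_up hj]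
    simp [natForm]
  rw [upSingle, ← hp, letterComm_single (natForm_symm .C),
    up_append_singleton (i := 1) (m := j) (by omega)]
  obtain ⟨j, rfl⟩ := Nat.exists_eq_add_of_le' hj
  have e1 : natForm .C (j + 1) (j + 1 + 1) = -1 := by simp [natForm]
  have e2 : natForm .C (j + 1 + 1) (j + 1 + 1) = 2 := by simp [natForm]
  rw [up_append_singleton (by omega), List.append_assoc,
    ins_skip _ (by norm_num) _ _ fun y hy => (far_C y _ (by have := mem_up.1 hy; omega)).1,
    List.singleton_append, ins, insCoeff_eq_zero (by norm_num), zero_smul, zero_add, ins, ins, e1,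
    e2, map_smul, pre_single, List.singleton_append, ← add_smul]
  simp [insCoeff]

/-- The elements whose smallest words are `[0, 1, …, j, 1, …, j]`. -/
def doubleUp (j : ℕ) : FreeWords ℕ :=
  pre [0] (shuffleHom (natForm .C) (upSingle j) (upSingle j))

/-- With `U = [1,…,j]` and `V = [1,…,j+1]`, commutation with `j + 1` sends `U` to a multiple `κ V`
and `V` to zero. Applied twice to `U * U` it yields `κ² (q + q⁻¹) V * V`, and the leading letter `0`
is untouched, being orthogonal to `j + 1`. -/
theorem doubleUp_mem (j : ℕ) : doubleUp (j + 1) ∈ shuffleSubalgebra (natForm .C) := by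
  have hs := natForm_symm .C
  induction j with
  | zero =>
    have h : WordMem (natForm .C) [0, 1] :=
      WordMem.concat (a := []) hs (letter_mem _ 0) (by simp) (by simp [natForm])
    have h2 := ins_mem hs h 1 0
    have e1 : natForm .C 0 1 = -2 := by simp [natForm]
    have e2 : natForm .C 1 1 = 2 := by simp [natForm]
    rw [ins, ins, ins, e1, e2, insCoeff_eq_zero (s := 0) (by norm_num),
      insCoeff_eq_zero (s := 0 + -2 + 2) (by norm_num), zero_smul, zero_smul, map_zero, add_zero,
      zero_add, map_smul, pre_single] at h2
    have h3 := WordMem.of_smul (insCoeff_ne_zero (by norm_num)) h2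
    have h4 := shuffleWord_concat (natForm .C) [] [] 1 1
    simp only [List.nil_append, shuffleWord_nil_left, shuffleWord_nil_right,
      concatLetter_single] at h4
    rw [doubleUp, upSingle, zero_add, up_self, shuffleHom_single, h4, map_add, map_smul,
      pre_single]
    exact Submodule.add_mem _ h3 (Submodule.smul_mem _ _ h3)
  | succ j ih =>
    have q0 := qvar_ne_zero
    have hx : natForm .C 0 (j + 1 + 1) = 0 := (far_C 0 _ (by omega)).1
    have h := letterComm_mem (letterComm_mem ih (j + 1 + 1) (qvar ^ (-2 : ℤ))) (j + 1 + 1)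
      (qvar ^ (0 : ℤ))
    have hp := pairWord_C_up (j := j + 1) (by omega)
    have hp' : pairWord (natForm .C) (up 1 (j + 1 + 1)) (j + 1 + 1) = 1 := by
      rw [up_append_singleton (by omega), pairWord_concat, hp]
      simp [natForm]
    have b1 := letterComm_upSingle (j := j + 1) (by omega)
    have b2 := letterComm_upSingle_succ (j := j + 1) (by omega)
    rw [doubleUp, letterComm_pre hs hx
        (by rw [upSingle, shuffleHom_single]
            exact shuffleWord_mem_pairSpan _ _ _ (by rw [hp]; norm_num)),
      show (-2 : ℤ) = -1 + -1 by norm_num, zpow_add₀ q0, letterComm_shuffleHom, b1, map_smul,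
      map_smul, LinearMap.smul_apply, smul_comm, ← smul_add, letterComm_pre hs hx, map_smul,
      map_add, map_smul] at h
    · have e1 : letterComm (natForm .C) (j + 1 + 1) (qvar ^ (0 : ℤ))
          (shuffleHom (natForm .C) (upSingle (j + 1)) (upSingle (j + 1 + 1))) =
          (qvar ^ (1 : ℤ) * insCoeff 0 (-1)) •
            shuffleHom (natForm .C) (upSingle (j + 1 + 1)) (upSingle (j + 1 + 1)) := by
        rw [show (0 : ℤ) = -1 + 1 by norm_num, zpow_add₀ q0, letterComm_shuffleHom, b1, b2,
          map_zero, zero_add, map_smul, LinearMap.smul_apply, smul_smul]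
        rfl
      have e2 : letterComm (natForm .C) (j + 1 + 1) (qvar ^ (0 : ℤ))
          (shuffleHom (natForm .C) (upSingle (j + 1 + 1)) (upSingle (j + 1))) =
          insCoeff 0 (-1) •
            shuffleHom (natForm .C) (upSingle (j + 1 + 1)) (upSingle (j + 1 + 1)) := by
        rw [show (0 : ℤ) = 1 + -1 by norm_num, zpow_add₀ q0, letterComm_shuffleHom, b1, b2,
          map_zero, LinearMap.zero_apply, smul_zero, add_zero, map_smul]
        rfl
      rw [e1, map_smul, e2, smul_smul, ← add_smul, ← add_mul, map_smul, smul_smul] at h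
      refine (Submodule.smul_mem_iff _ (mul_ne_zero ?_ (mul_ne_zero ?_ ?_))).1 h
      · exact insCoeff_ne_zero (by norm_num)
      · exact qvar_two_ne_zero (by norm_num)
      · exact insCoeff_ne_zero (by norm_num)
    · refine Submodule.smul_mem _ _ (Submodule.add_mem _ ?_ (Submodule.smul_mem _ _ ?_)) <;>
      · rw [upSingle, upSingle, shuffleHom_single]
        exact shuffleWord_mem_pairSpan _ _ _ (by rw [hp, hp']; norm_num)

theorem scaleK_upSingle (k a : ℕ) : scaleK (natForm .C) k (upSingle a) =
    qvar ^ (-pairWord (natForm .C) (up 1 a) k) • upSingle a := scaleK_single _ _ _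

theorem dR_upSingle_succ (k a : ℕ) :
    dR k (upSingle (a + 1)) = if a + 1 = k then upSingle a else 0 := by
  rw [upSingle, up_append_singleton (by omega), dR_single_concat]
  rfl

/-- The last letter of a shuffle is the end of one of the factors; taking the smaller end at each
step, from the right, exhausts the shorter factor first. -/
theorem shuffle_upSingle_le (n : ℕ) : ∀ a b : ℕ, a + b = n → ∀ w : List ℕ,
    shuffleHom (natForm .C) (upSingle a) (upSingle b) w ≠ 0 →
    w = up 1 (max a b) ++ up 1 (min a b) ∨ wordLt (up 1 (max a b) ++ up 1 (min a b)) w := by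
  induction n with
  | zero =>
    intro a b h w hw
    obtain rfl : a = 0 := by omega
    obtain rfl : b = 0 := by omega
    rw [upSingle, shuffleHom_single, show up 1 0 = [] from rfl, shuffleWord_nil_left] at hw
    by_contra! hcon
    rw [Finsupp.single_apply, if_neg] at hw
    · exact hw rfl
    · exact fun h => hcon.1 h.symm
  | succ n ih =>
    intro a b h w hw
    have hup0 : up 1 0 = [] := rfl
    rcases a with _ | a
    · rw [upSingle, hup0, one_shuffleHom, upSingle, Finsupp.single_apply] at hw
      left
      by_contra hcon
      rw [if_neg] at hw
      · exact hw rfl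
      · rintro rfl
        simp [hup0] at hcon
    rcases b with _ | b
    · rw [upSingle, upSingle, hup0, shuffleHom_one, Finsupp.single_apply] at hw
      left
      by_contra hcon
      rw [if_neg] at hw
      · exact hw rfl
      · rintro rfl
        simp [hup0] at hcon
    rcases List.eq_nil_or_concat' w with rfl | ⟨w, k, rfl⟩
    · rw [shuffleHom_apply_nil, upSingle, Finsupp.single_apply,
        if_neg (up_ne_nil (by omega)), zero_mul] at hw
      exact absurd rfl hw
    have hcase : (a + 1 = k ∧
        shuffleHom (natForm .C) (upSingle a) (upSingle (b + 1)) w ≠ 0) ∨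
        (b + 1 = k ∧ shuffleHom (natForm .C) (upSingle (a + 1)) (upSingle b) w ≠ 0) := by
      by_contra! hcon
      rw [← dR_apply, dR_shuffleHom, dR_upSingle_succ, dR_upSingle_succ, Finsupp.add_apply] at hw
      apply hw
      have t1 : shuffleHom (natForm .C) (if a + 1 = k then upSingle a else 0)
          (upSingle (b + 1)) w = 0 := by
        split_ifs with h
        · exact hcon.1 h
        · simp
      have t2 : shuffleHom (natForm .C) (scaleK (natForm .C) k (upSingle (a + 1)))
          (if b + 1 = k then upSingle b else 0) w = 0 := by
        split_ifs with h
        · rw [scaleK_upSingle, map_smul, LinearMap.smul_apply, Finsupp.smul_apply, hcon.2 h,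
            smul_zero]
        · simp
      rw [t1, t2, add_zero]
    have hmm : up 1 (max (a + 1) (b + 1)) ++ up 1 (min (a + 1) (b + 1)) =
        up 1 (max (a + 1) (b + 1)) ++ up 1 (min a b) ++ [min a b + 1] := by
      rw [show min (a + 1) (b + 1) = min a b + 1 by omega, up_append_singleton (m := min a b)
        (by omega), List.append_assoc]
    have key : ∀ p, k = p + 1 → min a b ≤ p → (p = min a b →
        w = up 1 (max (a + 1) (b + 1)) ++ up 1 (min a b) ∨
          wordLt (up 1 (max (a + 1) (b + 1)) ++ up 1 (min a b)) w) →
        w ++ [k] = up 1 (max (a + 1) (b + 1)) ++ up 1 (min (a + 1) (b + 1)) ∨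
          wordLt (up 1 (max (a + 1) (b + 1)) ++ up 1 (min (a + 1) (b + 1))) (w ++ [k]) := by
      rintro p rfl hp hw
      rw [hmm, wordLt_concat_iff]
      rcases eq_or_lt_of_le hp with h | h
      · rcases hw h.symm with h' | h'
        · exact Or.inl (by rw [h', h])
        · exact Or.inr (Or.inr ⟨by rw [h], h'⟩)
      · exact Or.inr (Or.inl (by omega))
    rcases hcase with ⟨rfl, hw'⟩ | ⟨rfl, hw'⟩
    · refine key a rfl (Nat.min_le_left _ _) fun ha => ?_
      have := ih a (b + 1) (by omega) w hw'
      rwa [show max a (b + 1) = max (a + 1) (b + 1) by omega,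
        show min a (b + 1) = min a b by omega] at this
    · refine key b rfl (Nat.min_le_right _ _) fun hb => ?_
      have := ih (a + 1) b (by omega) w hw'
      rwa [show max (a + 1) b = max (a + 1) (b + 1) by omega,
        show min (a + 1) b = min a b by omega] at this

theorem shuffle_upSingle_apply (a : ℕ) : ∀ b, a < b →
    shuffleHom (natForm .C) (upSingle a) (upSingle b) (up 1 b ++ up 1 a) = 1 ∧
    ∃ n : ℤ, shuffleHom (natForm .C) (upSingle b) (upSingle a) (up 1 b ++ up 1 a) = qvar ^ n := by
  have hup0 : up 1 0 = [] := rfl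
  induction a with
  | zero =>
    intro b hb
    refine ⟨?_, 0, ?_⟩
    · rw [upSingle, hup0, one_shuffleHom, List.append_nil, upSingle, Finsupp.single_eq_same]
    · rw [upSingle, upSingle, hup0, shuffleHom_one, List.append_nil, Finsupp.single_eq_same,
        zpow_zero]
  | succ a ih =>
    intro b hb
    obtain ⟨b, rfl⟩ := Nat.exists_eq_add_of_le' (show 1 ≤ b by omega)
    obtain ⟨h1, n, h2⟩ := ih (b + 1) (by omega)
    rw [up_append_singleton (m := a) (by omega), ← List.append_assoc]
    refine ⟨?_, n - pairWord (natForm .C) (up 1 (b + 1)) (a + 1), ?_⟩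
    · rw [← dR_apply, dR_shuffleHom, dR_upSingle_succ, dR_upSingle_succ, if_pos rfl,
        if_neg (by omega), map_zero, add_zero, h1]
    · rw [← dR_apply, dR_shuffleHom, dR_upSingle_succ, dR_upSingle_succ, if_pos rfl,
        if_neg (by omega), map_zero, LinearMap.zero_apply, zero_add]
      rw [scaleK_upSingle, map_smul, LinearMap.smul_apply, Finsupp.smul_apply, h2, smul_eq_mul, ← zpow_add₀ qvar_ne_zero]
      congr 1
      ring

/-- The final letter may come from either factor; the two contributions are `1` and a power of `q`,
which cannot cancel. -/
theorem shuffle_upSingle_self_ne_zero (a : ℕ) :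
    shuffleHom (natForm .C) (upSingle (a + 1)) (upSingle (a + 1))
      (up 1 (a + 1) ++ up 1 (a + 1)) ≠ 0 := by
  obtain ⟨h1, n, h2⟩ := shuffle_upSingle_apply a (a + 1) (by omega)
  have hc : up 1 (a + 1) ++ up 1 (a + 1) = up 1 (a + 1) ++ up 1 a ++ [a + 1] := by
    nth_rewrite 2 [up_append_singleton (m := a) (by omega)]
    rw [List.append_assoc]
  rw [hc, ← dR_apply, dR_shuffleHom, dR_upSingle_succ, if_pos rfl, Finsupp.add_apply, h1,
    scaleK_upSingle, map_smul, LinearMap.smul_apply, Finsupp.smul_apply, h2, smul_eq_mul, ← zpow_add₀ qvar_ne_zero]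
  exact one_add_qvar_zpow_ne_zero _

theorem isGood_doubleUp {j : ℕ} (hj : 1 ≤ j) : IsGood (natForm .C) (up 0 j ++ up 1 j) := by
  obtain ⟨j, rfl⟩ := Nat.exists_eq_add_of_le' hj
  have hw : up 0 (j + 1) ++ up 1 (j + 1) = [0] ++ (up 1 (j + 1) ++ up 1 (j + 1)) := by
    rw [up_cons (Nat.zero_le _)]
    rfl
  have hsupp : ∀ w ∈ (doubleUp (j + 1)).support, ∃ v, w = [0] ++ v ∧
      shuffleHom (natForm .C) (upSingle (j + 1)) (upSingle (j + 1)) v ≠ 0 := fun w hw => by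
    obtain ⟨v, hv, rfl⟩ := Finset.mem_image.1 (Finsupp.mapDomain_support hw)
    exact ⟨v, rfl, Finsupp.mem_support_iff.1 hv⟩
  rw [hw]
  refine ⟨_, doubleUp_mem j, ⟨content ([0] ++ (up 1 (j + 1) ++ up 1 (j + 1))), fun w hw => ?_⟩, ?_,
    fun w hw hne => ?_⟩
  · obtain ⟨v, rfl, hv⟩ := hsupp w hw
    rw [upSingle, shuffleHom_single] at hv
    exact content_perm ((perm_of_mem_support _ (Finsupp.mem_support_iff.2 hv)).append_left [0])
  · rw [Finsupp.mem_support_iff, doubleUp, pre_apply_append]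
    exact shuffle_upSingle_self_ne_zero j
  · obtain ⟨v, rfl, hv⟩ := hsupp w hw
    have hle := shuffle_upSingle_le _ (j + 1) (j + 1) rfl v hv
    rw [max_self, min_self] at hle
    rcases hle with rfl | h
    · exact absurd rfl hne
    · refine wordLt_append_left _ rfl ?_ h [0]
      rw [upSingle, shuffleHom_single] at hv
      exact (perm_of_mem_support _ (Finsupp.mem_support_iff.2 hv)).length_eq

/-- The largest letter occurs twice, so one left factor needs care, namely `[0,…,j]`: after removing
the common right factor `[1,…,j]` the comparison is between `[0]` and a word ending in `j > 0`. -/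
theorem isLyndon_double {j : ℕ} (hj : 1 ≤ j) : IsLyndon (up 0 j ++ up 1 j) := by
  obtain ⟨j, rfl⟩ := Nat.exists_eq_add_of_le' hj
  refine ⟨by simp [up_ne_nil], fun p hp hpw hne => ?_⟩
  have hend := fun i (hi : i ≤ j + 1) => up_append_singleton (i := i) (m := j) hi
  rcases List.eq_nil_or_concat' p with rfl | ⟨p, x, rfl⟩
  · exact absurd rfl hp
  have hw : up 0 (j + 1) ++ up 1 (j + 1) = up 0 (j + 1) ++ up 1 j ++ [j + 1] := by
    rw [hend 1 (by omega), List.append_assoc]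
  have hx : x ≤ j ∨ p ++ [x] = up 0 (j + 1) := by
    rcases List.prefix_or_prefix_of_prefix hpw (List.prefix_append _ _) with h | ⟨t, ht⟩
    · rw [hend 0 (by omega)] at h
      rcases List.prefix_concat_iff.1 h with h | h
      · exact Or.inr (h.trans (hend 0 (by omega)).symm)
      · have := mem_up.1 (h.subset (show x ∈ p ++ [x] by simp))
        exact Or.inl this.2
    · have hpre := hpw
      rw [← ht, List.prefix_append_right_inj] at hpre
      replace ht := ht.symm
      rcases List.eq_nil_or_concat' t with rfl | ⟨t, y, rfl⟩
      · exact Or.inr (by rw [ht, List.append_nil])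
      · rw [← List.append_assoc] at ht
        obtain ⟨-, hxy⟩ := List.append_inj' ht rfl
        simp only [List.cons.injEq, and_true] at hxy
        subst hxy
        rw [hend 1 (by omega)] at hpre
        rcases List.prefix_concat_iff.1 hpre with h | h
        · exfalso
          refine hne ?_
          rw [ht, List.append_assoc, h, hend 1 (by omega)]
        · have := mem_up.1 (h.subset (show x ∈ t ++ [x] by simp))
          exact Or.inl this.2
  rcases hx with hx | hx
  · rw [hw, wordLt_concat_iff]
    exact Or.inl (by omega)
  · rw [hx]
    have h0 : wordLt [0] (up 0 (j + 1)) := by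
      rw [hend 0 (by omega)]
      exact (wordLt_concat_iff [] _ 0 (j + 1)).2 (Or.inl (by omega))
    have := wordLt_append_right h0 (up 1 (j + 1))
    rwa [List.singleton_append, ← zero_add 1, ← up_cons (Nat.zero_le _)] at this

end LastFamily

end QLyndon

/-! ### Both bounds combined -/

theorem proposition5p1p1 (r : ℕ) :
    -- type A
    (1 ≤ r → QLyndon.goodLyndonWords .A r =
      {w | ∃ i j : ℕ, i ≤ j ∧ j < r ∧ w = QLyndon.up i j}) ∧
    -- type B
    (1 ≤ r → QLyndon.goodLyndonWords .B r =
      {w | ∃ i j : ℕ, i ≤ j ∧ j < r ∧ w = QLyndon.up i j} ∪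
      {w | ∃ j k : ℕ, j < k ∧ k < r ∧ w = QLyndon.down j 0 ++ QLyndon.up 0 k}) ∧
    -- type C
    (1 ≤ r → QLyndon.goodLyndonWords .C r =
      {w | ∃ i j : ℕ, i ≤ j ∧ j < r ∧ w = QLyndon.up i j} ∪
      {w | ∃ j k : ℕ, 1 ≤ j ∧ j < k ∧ k < r ∧ w = QLyndon.down j 1 ++ QLyndon.up 0 k} ∪
      {w | ∃ j : ℕ, 1 ≤ j ∧ j < r ∧ w = QLyndon.up 0 j ++ QLyndon.up 1 j}) ∧
    -- type D
    (3 ≤ r → QLyndon.goodLyndonWords .D r =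
      {[0]} ∪
      {w | ∃ i : ℕ, 2 ≤ i ∧ i < r ∧ w = 0 :: QLyndon.up 2 i} ∪
      {w | ∃ i j : ℕ, 1 ≤ i ∧ i ≤ j ∧ j < r ∧ w = QLyndon.up i j} ∪
      {w | ∃ j k : ℕ, 1 ≤ j ∧ j < k ∧ k < r ∧
        w = QLyndon.down j 1 ++ 0 :: QLyndon.up 2 k}) := by
  open QLyndon in
  have hnot : ∀ {T : ClassicalType}, T ≠ .D → T = .D → 3 ≤ r := fun h h' => absurd h' h
  have hend : ∀ {m : ℕ} {w : List ℕ}, EndsWith m w → m < r → ∀ x ∈ w, x < r := by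
    rintro m w ⟨u, rfl, hu⟩ hm x hx
    rcases List.mem_append.1 hx with hx | hx
    · exact (hu x hx).trans hm
    · rw [List.mem_singleton.1 hx]; exact hm
  have hup : ∀ {T : ClassicalType} {i j : ℕ}, (T = .D → 3 ≤ r) → (T = .D → 1 ≤ i) → i ≤ j →
      j < r → up i j ∈ goodLyndonWords T r := fun hT hi hij hj =>
    mem_goodLyndonWords hT (hend (endsWith_up hij) hj) (isGood_up hij hi)
      (endsWith_up hij).isLyndon
  refine ⟨fun _ => ?_, fun _ => ?_, fun _ => ?_, fun hr => ?_⟩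
  · ext w
    constructor
    · intro hw
      obtain ⟨hS, u, m, rfl, hm, hu, hred, hL⟩ := exists_of_mem_goodLyndonWords (hnot (by simp)) hw
      obtain ⟨i, hi, h⟩ := isLyndon_reducible_A hS hu hred hL
      exact ⟨i, m, hi, hm, h⟩
    · rintro ⟨i, j, hij, hj, rfl⟩
      exact hup (hnot (by simp)) (by simp) hij hj
  · ext w
    constructor
    · intro hw
      obtain ⟨hS, u, m, rfl, hm, hu, hred, hL⟩ := exists_of_mem_goodLyndonWords (hnot (by simp)) hw
      rcases isLyndon_reducible_B hS hu hred hL with ⟨i, hi, h⟩ | ⟨j, hj, h⟩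
      · exact Or.inl ⟨i, m, hi, hm, h⟩
      · exact Or.inr ⟨j, m, hj, hm, h⟩
    · rintro (⟨i, j, hij, hj, rfl⟩ | ⟨j, k, hj, hk, rfl⟩)
      · exact hup (hnot (by simp)) (by simp) hij hj
      · have h := endsWith_down_append (i := 0) (endsWith_up (Nat.zero_le k)) hj
        exact mem_goodLyndonWords (hnot (by simp)) (hend h hk) (wordMem_B hj).isGood h.isLyndon
  · ext w
    constructor
    · intro hw
      obtain ⟨hS, u, m, rfl, hm, hu, hred, hL⟩ := exists_of_mem_goodLyndonWords (hnot (by simp)) hw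
      rcases isLyndon_reducible_C hS hu hred hL with ⟨i, hi, h⟩ | ⟨j, hj, hj1, h⟩ | ⟨h1, h⟩
      · exact Or.inl (Or.inl ⟨i, m, hi, hm, h⟩)
      · exact Or.inl (Or.inr ⟨j, m, hj1, hj, hm, h⟩)
      · exact Or.inr ⟨m, h1, hm, h⟩
    · rintro ((⟨i, j, hij, hj, rfl⟩ | ⟨j, k, hj1, hj, hk, rfl⟩) | ⟨j, h1, hj, rfl⟩)
      · exact hup (hnot (by simp)) (by simp) hij hj
      · have h := endsWith_down_append (i := 1) (endsWith_up (Nat.zero_le k)) hj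
        obtain ⟨j, rfl⟩ := Nat.exists_eq_add_of_le' hj1
        exact mem_goodLyndonWords (hnot (by simp)) (hend h hk) (wordMem_C hj).isGood h.isLyndon
      · refine mem_goodLyndonWords (hnot (by simp)) (fun x hx => ?_) (isGood_doubleUp h1)
          (isLyndon_double h1)
        rcases List.mem_append.1 hx with hx | hx
        · exact hend (endsWith_up (Nat.zero_le j)) hj x hx
        · exact hend (endsWith_up h1) hj x hx
  · have hT : ClassicalType.D = .D → 3 ≤ r := fun _ => hr
    ext w
    constructor
    · intro hw
      obtain ⟨hS, u, m, rfl, hm, hu, hred, hL⟩ := exists_of_mem_goodLyndonWords hT hw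
      rcases isLyndon_reducible_D hS hu hred hL with h | ⟨i, hi, h1, h⟩ | ⟨h2, h⟩ | ⟨j, hj, h1, h⟩
      · exact Or.inl (Or.inl (Or.inl h))
      · exact Or.inl (Or.inr ⟨i, m, h1, hi, hm, h⟩)
      · exact Or.inl (Or.inl (Or.inr ⟨m, h2, hm, h⟩))
      · exact Or.inr ⟨j, m, h1, hj, hm, h⟩
    · rintro (((rfl | ⟨i, hi, hir, rfl⟩) | ⟨i, j, hi, hij, hj, rfl⟩) | ⟨j, k, h1, hj, hk, rfl⟩)
      · exact mem_goodLyndonWords hT (hend (endsWith_singleton 0) (by omega))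
          (WordMem.isGood (letter_mem _ 0)) (endsWith_singleton 0).isLyndon
      · have h := (endsWith_up hi).cons (k := 0) (by omega)
        exact mem_goodLyndonWords hT (hend h hir) (wordMem_D_zero hi).isGood h.isLyndon
      · exact hup hT (fun _ => hi) hij hj
      · have h := endsWith_down_append (i := 1)
          ((endsWith_up (m := k) (show 2 ≤ k by omega)).cons (k := 0) (by omega)) hj
        exact mem_goodLyndonWords hT (hend h hk) (isGood_D h1 hj) h.isLyndon
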